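/- Let $\overline M$ be a complex manifold of complex dimension $2n+1$ with complex structure $J$, carrying a complex contact structure: an open cover $\{\mathcal O_i\}$ by coordinate neighbourhoods and holomorphic 1-forms $\theta_i$ on $\mathcal O_i$ with $\theta_i\wedge(d\theta_i)^n\neq 0$ everywhere and $\theta_i=f_{ij}\theta_j$ on $\mathcal O_i\cap\mathcal O_j$ for nonvanishing holomorphic $f_{ij}$; put $\mathcal H=\ker\theta_i$. Let $\overline g$ be a Hermitian semi-Riemannian metric of constant index $4q$, $0<q<n$, with Levi-Civita connection $\overline\nabla$. Suppose given a complex contact metric structure: on each $\mathcal O_i$ there are smooth 1-forms $u,\sigma$, a vector field $U$ and a $(1,1)$-tensor $G$ such that, with $v=u\circ J$, $V=-JU$, $H=GJ$, $$G^2=H^2=-I+u\otimes U+v\otimes V,\quad \overline g(GX,Y)=-\overline g(X,GY),\quad \overline g(U,X)=u(X),\quad GJ=-JG,\quad GU=0,\quad u(U)=1,$$ $$du(X,Y)=\overline g(X,GY)+(\sigma\wedge v)(X,Y),\qquad dv(X,Y)=\overline g(X,HY)-(\sigma\wedge u)(X,Y),$$ where $d\omega(X,Y)=\tfrac12\{X\omega(Y)-Y\omega(X)-\omega([X,Y])\}$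 and $(\alpha\wedge\beta)(X,Y)=\tfrac12\{\alpha(X)\beta(Y)-\alpha(Y)\beta(X)\}$; $\theta_i$ is a nonvanishing complex multiple of $u_i-\sqrt{-1}\,v_i$; and on $\mathcal O_i\cap\mathcal O_j$ one has $u_j=au_i-bv_i$, $v_j=bu_i+av_i$, $G_j=aG_i-bH_i$, $H_j=bG_i+aH_i$ for functions $a,b$ with $a^2+b^2=1$. Assume the structure is normal: $S(X,Y)=T(X,Y)=0$ for all $X,Y\in\Gamma(\mathcal H)$ and $S(U,X)=T(V,X)=0$ for all $X$, where, with the Nijenhuis tensor $[A,A](X,Y)=A^2[X,Y]+[AX,AY]-A[AX,Y]-A[X,AY]$, $$\begin{aligned}S(X,Y)={}&[G,G](X,Y)+2\overline g(X,GY)U-2\overline g(X,HY)V+2\{v(Y)HX-v(X)HY\}\\&+\sigma(GY)HX-\sigma(GX)HY+\sigma(X)GHY-\sigma(Y)GHX,\\ T(X,Y)={}&[H,H](X,Y)-2\overline g(X,GY)U+2\overline g(X,HY)V+2\{u(Y)GX-u(X)GY\}\\&+\sigma(HX)GY-\sigma(HY)GX+\sigma(X)GHY-\sigma(Y)GHX.\end{aligned}$$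 Let $M$ be an (immersed) $r$-null submanifold of $\overline M$: $\mathrm{Rad}\,TM=TM\cap TM^\perp$ is a smooth distribution of rank $r>0$. Let $S(TM)$ be a screen distribution (a smooth complement of $\mathrm{Rad}\,TM$ in $TM$), $S(TM^\perp)$ a screen transversal bundle (a smooth complement of $\mathrm{Rad}\,TM$ in $TM^\perp$), and $l\mathrm{tr}(TM)$ a null transversal bundle: locally it is spanned by smooth $N_1,\dots,N_r$, orthogonal to $S(TM)$ and $S(TM^\perp)$, with $\overline g(N_a,N_b)=0$ and $\overline g(\xi_a,N_b)=\delta_{ab}$ for a local frame $\xi_1,\dots,\xi_r$ of $\mathrm{Rad}\,TM$. Then $T\overline M|_M=TM\oplus l\mathrm{tr}(TM)\oplus S(TM^\perp)$, and for $X,Y\in\Gamma(TM)$ one decomposes accordingly $$\overline\nabla_XY=\nabla_XY+h^l(X,Y)+h^s(X,Y).$$ Assume that $M$ is a quaternion null submanifold: $\mathrm{Span}\{U,V\}\subset S(TM)$ along $M$, and each of $J$, $G$, $H$ maps $\mathrm{Rad}\,TM$ into $\mathrm{Rad}\,TM$ and $S(TM)$ into $S(TM)$. Then for all (local) smooth vector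 fields $X,Y$ tangent to $M$, $$h^l(JX,JY)=-h^l(X,Y),\qquad h^s(JX,JY)=-h^s(X,Y),$$ $$h^l(GX,GY)=-h^l(X,Y),\qquad h^s(GX,GY)=-h^s(X,Y),$$ $$h^l(HX,HY)=-h^l(X,Y),\qquad h^s(HX,HY)=-h^s(X,Y),$$ where the identities for the local tensors $G=G_i$ and $H=H_i$ hold over each $\mathcal O_i$. -/

import Mathlib

open Bundle Set
open scoped Manifold ContDiff Topology

noncomputable section

namespace ComplexContact

/-! ### Complex manifolds as real manifolds -/

section Ambient

variable {E : Type*} [NormedAddCommGroup E] [NormedSpace ℂ E]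
  {M : Type*} [TopologicalSpace M] [ChartedSpace E M]

/-- A complex manifold is in particular a smooth real manifold. -/
instance realManifold [IsManifold 𝓘(ℂ, E) ∞ M] : IsManifold 𝓘(ℝ, E) ∞ M := by
  refine isManifold_of_contDiffOn 𝓘(ℝ, E) ∞ M fun e e' he he' => ?_
  have h := HasGroupoid.compatible (G := contDiffGroupoid ∞ 𝓘(ℂ, E)) he he'
  rw [contDiffGroupoid, mem_groupoid_of_pregroupoid] at h
  exact ContDiffOn.restrict_scalars ℝ h.1

/-- The complex structure `J` on the real tangent spaces of a complex manifold: multiplication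
by `i`.  The real and the complex tangent space at a point are both read in the preferred chart
at that point. -/
def J (y : M) : TangentSpace 𝓘(ℝ, E) y →L[ℝ] TangentSpace 𝓘(ℝ, E) y :=
  show E →L[ℝ] E from Complex.I • ContinuousLinearMap.id ℝ E

/-- A real tangent vector, read in the holomorphic tangent space. -/
def toHol (y : M) (x : TangentSpace 𝓘(ℝ, E) y) : TangentSpace 𝓘(ℂ, E) y :=
  show E from x

end Ambient

/-! ### Exterior derivative of 1-forms -/

section Forms

variable {𝕜 : Type*} [NontriviallyNormedField 𝕜]
  {E : Type*} [NormedAddCommGroup E] [NormedSpace 𝕜 E]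
  {M : Type*} [TopologicalSpace M] [ChartedSpace E M]

/-- `dη(X, Y) = ½ (X(η(Y)) - Y(η(X)) - η([X, Y]))`. -/
def dForm (η : Π y : M, TangentSpace 𝓘(𝕜, E) y →L[𝕜] 𝕜)
    (X Y : Π y : M, TangentSpace 𝓘(𝕜, E) y) (y : M) : 𝕜 :=
  (2 : 𝕜)⁻¹ * (mvfderiv 𝓘(𝕜, E) (fun z => η z (Y z)) y (X y)
    - mvfderiv 𝓘(𝕜, E) (fun z => η z (X z)) y (Y y)
    - η y (VectorField.mlieBracket 𝓘(𝕜, E) X Y y))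

/-- The value of `θ ∧ (dθ)ⁿ` on `2n + 1` vector fields, up to a nonzero constant factor. -/
def wedgeTop (n : ℕ) (θ : Π y : M, TangentSpace 𝓘(𝕜, E) y →L[𝕜] 𝕜)
    (X : Fin (2 * n + 1) → Π y : M, TangentSpace 𝓘(𝕜, E) y) (y : M) : 𝕜 :=
  ∑ τ : Equiv.Perm (Fin (2 * n + 1)), ((Equiv.Perm.sign τ : ℤ) : 𝕜) *
    (θ y (X (τ 0) y) *
      ∏ k : Fin n, dForm θ (X (τ ⟨2 * k + 1, by omega⟩)) (X (τ ⟨2 * k + 2, by omega⟩)) y)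

end Forms

/-! ### Semi-Riemannian metrics and the Levi-Civita connection -/

section Metric

variable (E : Type*) [NormedAddCommGroup E] [NormedSpace ℂ E]
  (M : Type*) [TopologicalSpace M] [ChartedSpace E M] [IsManifold 𝓘(ℂ, E) ∞ M]

/-- A smooth semi-Riemannian metric on (the real manifold underlying) `M`. -/
structure SemiRiemannianMetric where
  inner (y : M) : TangentSpace 𝓘(ℝ, E) y →L[ℝ] TangentSpace 𝓘(ℝ, E) y →L[ℝ] ℝ
  symm (y : M) (v w : TangentSpace 𝓘(ℝ, E) y) : inner y v w = inner y w v
  nondegenerate (y : M) (v : TangentSpace 𝓘(ℝ, E) y) (hv : ∀ w, inner y v w = 0) : v = 0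
  contMDiff : ContMDiff 𝓘(ℝ, E) (𝓘(ℝ, E).prod 𝓘(ℝ, E →L[ℝ] E →L[ℝ] ℝ)) ∞
    (fun y => TotalSpace.mk' (E →L[ℝ] E →L[ℝ] ℝ) y (inner y))

variable {E M}

namespace SemiRiemannianMetric

/-- The metric at a point as a bilinear form. -/
def bilin (g : SemiRiemannianMetric E M) (y : M) :
    LinearMap.BilinForm ℝ (TangentSpace 𝓘(ℝ, E) y) :=
  LinearMap.mk₂ ℝ (fun v w => g.inner y v w) (by simp) (by simp) (by simp) (by simp)

/-- The metric has constant index `k`: the maximal dimension of a subspace of `T_y M` on which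
the metric is negative definite is `k`. -/
def HasIndex (g : SemiRiemannianMetric E M) (k : ℕ) : Prop :=
  ∀ y : M, sigNeg (LinearMap.BilinMap.toQuadraticMap (g.bilin y)) = k

/-- The vector field `X` on the real manifold underlying `M` is differentiable at `y`. -/
def DiffAt (X : Π y : M, TangentSpace 𝓘(ℝ, E) y) (y : M) : Prop :=
  MDifferentiableAt 𝓘(ℝ, E) 𝓘(ℝ, E).tangent
    (fun z => (⟨z, X z⟩ : TangentBundle 𝓘(ℝ, E) M)) y

/-- `D` is the Levi-Civita connection of `g`: it is torsion-free and metric.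
Note that `D Y y x` is `(D_x Y)(y)`. -/
structure IsLeviCivita (g : SemiRiemannianMetric E M)
    (D : CovariantDerivative 𝓘(ℝ, E) E (TangentSpace 𝓘(ℝ, E) : M → Type _)) : Prop where
  torsion_free : ∀ (X Y : Π y : M, TangentSpace 𝓘(ℝ, E) y) (y : M),
    DiffAt X y → DiffAt Y y →
      D Y y (X y) - D X y (Y y) = VectorField.mlieBracket 𝓘(ℝ, E) X Y y
  metric : ∀ (Y Z : Π y : M, TangentSpace 𝓘(ℝ, E) y) (y : M) (x : TangentSpace 𝓘(ℝ, E) y),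
    DiffAt Y y → DiffAt Z y →
      mvfderiv 𝓘(ℝ, E) (fun z => g.inner z (Y z) (Z z)) y x
        = g.inner y (D Y y x) (Z y) + g.inner y (Y y) (D Z y x)

end SemiRiemannianMetric

end Metric

/-! ### Complex contact manifolds -/

section Contact

variable (E : Type*) [NormedAddCommGroup E] [NormedSpace ℂ E]
  (M : Type*) [TopologicalSpace M] [ChartedSpace E M] [IsManifold 𝓘(ℂ, E) ∞ M]

/-- A complex contact structure on a complex manifold of complex dimension `2n + 1`. -/
structure ContactStructure (n : ℕ) (ι : Type*) where
  finrank_eq : Module.finrank ℂ E = 2 * n + 1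
  O : ι → Set M
  isOpen_O : ∀ i, IsOpen (O i)
  cover : ⋃ i, O i = univ
  /-- each `O i` is a holomorphic coordinate neighbourhood -/
  coord : ∀ i, ∃ φ ∈ IsManifold.maximalAtlas 𝓘(ℂ, E) ∞ M, φ.source = O i
  θ : ι → Π y : M, TangentSpace 𝓘(ℂ, E) y →L[ℂ] ℂ
  holomorphic_θ : ∀ i, ContMDiffOn 𝓘(ℂ, E) (𝓘(ℂ, E).prod 𝓘(ℂ, E →L[ℂ] ℂ)) ∞
    (fun y => TotalSpace.mk' (E →L[ℂ] ℂ) y (θ i y)) (O i)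
  /-- `θ ∧ (dθ)ⁿ` does not vanish at any point of `O i` -/
  contact : ∀ i, ∀ y ∈ O i, ∃ X : Fin (2 * n + 1) → Π z : M, TangentSpace 𝓘(ℂ, E) z,
    (∀ a, ContMDiffAt 𝓘(ℂ, E) 𝓘(ℂ, E).tangent ∞
      (fun z => (⟨z, X a z⟩ : TangentBundle 𝓘(ℂ, E) M)) y) ∧ wedgeTop n (θ i) X y ≠ 0
  overlap_θ : ∀ i j, ∃ f : M → ℂ, ContMDiffOn 𝓘(ℂ, E) 𝓘(ℂ, ℂ) ∞ f (O i ∩ O j) ∧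
    ∀ y ∈ O i ∩ O j, f y ≠ 0 ∧ θ i y = f y • θ j y

variable {E M} {n : ℕ} {ι : Type*}

/-- The vector field `X` is, near `y`, a smooth section of the tangent bundle. -/
def SmoothAt (X : Π z : M, TangentSpace 𝓘(ℝ, E) z) (y : M) : Prop :=
  ContMDiffAt 𝓘(ℝ, E) 𝓘(ℝ, E).tangent ∞ (fun z => (⟨z, X z⟩ : TangentBundle 𝓘(ℝ, E) M)) y

/-- The contact (horizontal) subbundle `𝓗 = ker θ`, at a point `y` of `O i`. -/
def ContactStructure.IsHorizontal (C : ContactStructure E M n ι) (i : ι) (y : M)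
    (x : TangentSpace 𝓘(ℝ, E) y) : Prop :=
  C.θ i y (toHol y x) = 0

/-- A complex contact metric structure, with local tensors `u i`, `U i`, `G i`, `σ i` on `O i`
(their values outside of `O i` are irrelevant).  The remaining tensors are `v = u ∘ J`,
`V = -JU` and `H = GJ`. -/
structure ContactMetricStructure (C : ContactStructure E M n ι)
    (g : SemiRiemannianMetric E M) where
  u : ι → Π y : M, TangentSpace 𝓘(ℝ, E) y →L[ℝ] ℝ
  U : ι → Π y : M, TangentSpace 𝓘(ℝ, E) y
  G : ι → Π y : M, TangentSpace 𝓘(ℝ, E) y →L[ℝ] TangentSpace 𝓘(ℝ, E) y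
  σ : ι → Π y : M, TangentSpace 𝓘(ℝ, E) y →L[ℝ] ℝ
  smooth_u : ∀ i, ContMDiffOn 𝓘(ℝ, E) (𝓘(ℝ, E).prod 𝓘(ℝ, E →L[ℝ] ℝ)) ∞
    (fun y => TotalSpace.mk' (E →L[ℝ] ℝ) y (u i y)) (C.O i)
  smooth_U : ∀ i, ∀ y ∈ C.O i, SmoothAt (U i) y
  smooth_G : ∀ i, ContMDiffOn 𝓘(ℝ, E) (𝓘(ℝ, E).prod 𝓘(ℝ, E →L[ℝ] E)) ∞
    (fun y => TotalSpace.mk' (E →L[ℝ] E) y (G i y)) (C.O i)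
  smooth_σ : ∀ i, ContMDiffOn 𝓘(ℝ, E) (𝓘(ℝ, E).prod 𝓘(ℝ, E →L[ℝ] ℝ)) ∞
    (fun y => TotalSpace.mk' (E →L[ℝ] ℝ) y (σ i y)) (C.O i)
  /-- the metric is Hermitian -/
  hermitian : ∀ (y : M) (x z : TangentSpace 𝓘(ℝ, E) y),
    g.inner y (J y x) (J y z) = g.inner y x z
  G_sq : ∀ i, ∀ y ∈ C.O i, ∀ x : TangentSpace 𝓘(ℝ, E) y,
    G i y (G i y x) = -x + u i y x • U i y + u i y (J y x) • (-J y (U i y))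
  H_sq : ∀ i, ∀ y ∈ C.O i, ∀ x : TangentSpace 𝓘(ℝ, E) y,
    G i y (J y (G i y (J y x))) = -x + u i y x • U i y + u i y (J y x) • (-J y (U i y))
  G_skew : ∀ i, ∀ y ∈ C.O i, ∀ x z : TangentSpace 𝓘(ℝ, E) y,
    g.inner y (G i y x) z = -g.inner y x (G i y z)
  u_dual : ∀ i, ∀ y ∈ C.O i, ∀ x : TangentSpace 𝓘(ℝ, E) y, g.inner y (U i y) x = u i y x
  G_J : ∀ i, ∀ y ∈ C.O i, ∀ x : TangentSpace 𝓘(ℝ, E) y, G i y (J y x) = -J y (G i y x)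
  G_U : ∀ i, ∀ y ∈ C.O i, G i y (U i y) = 0
  u_U : ∀ i, ∀ y ∈ C.O i, u i y (U i y) = 1
  /-- transformation of the local tensors on overlaps -/
  overlap : ∀ i j, ∃ a b : M → ℝ, ∀ y ∈ C.O i ∩ C.O j, a y ^ 2 + b y ^ 2 = 1 ∧
    ∀ x : TangentSpace 𝓘(ℝ, E) y,
      u j y x = a y * u i y x - b y * u i y (J y x) ∧
      u j y (J y x) = b y * u i y x + a y * u i y (J y x) ∧
      G j y x = a y • G i y x - b y • G i y (J y x) ∧
      G j y (J y x) = b y • G i y x + a y • G i y (J y x)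
  /-- `θ` is a nonvanishing multiple of `u - i v` -/
  theta_eq : ∀ i, ∃ l : M → ℂ, ∀ y ∈ C.O i, l y ≠ 0 ∧ ∀ x : TangentSpace 𝓘(ℝ, E) y,
    C.θ i y (toHol y x) = l y * ((u i y x : ℂ) - Complex.I * (u i y (J y x) : ℂ))
  /-- `du(X, Y) = g(X, GY) + (σ ∧ v)(X, Y)` -/
  du_eq : ∀ i, ∀ y ∈ C.O i, ∀ X Y : Π z : M, TangentSpace 𝓘(ℝ, E) z,
    SmoothAt X y → SmoothAt Y y →
    dForm (u i) X Y y = g.inner y (X y) (G i y (Y y))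
      + (1 / 2) * (σ i y (X y) * u i y (J y (Y y)) - σ i y (Y y) * u i y (J y (X y)))
  /-- `dv(X, Y) = g(X, HY) - (σ ∧ u)(X, Y)` -/
  dv_eq : ∀ i, ∀ y ∈ C.O i, ∀ X Y : Π z : M, TangentSpace 𝓘(ℝ, E) z,
    SmoothAt X y → SmoothAt Y y →
    dForm (fun z => (u i z).comp (J z)) X Y y = g.inner y (X y) (G i y (J y (Y y)))
      - (1 / 2) * (σ i y (X y) * u i y (Y y) - σ i y (Y y) * u i y (X y))

/-- The Nijenhuis tensor
`[A, A](X, Y) = A²[X, Y] + [AX, AY] - A[AX, Y] - A[X, AY]` of a (1,1)-tensor field. -/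
def nijenhuis (A : Π y : M, TangentSpace 𝓘(ℝ, E) y →L[ℝ] TangentSpace 𝓘(ℝ, E) y)
    (X Y : Π y : M, TangentSpace 𝓘(ℝ, E) y) (y : M) : TangentSpace 𝓘(ℝ, E) y :=
  A y (A y (VectorField.mlieBracket 𝓘(ℝ, E) X Y y))
    + VectorField.mlieBracket 𝓘(ℝ, E) (fun z => A z (X z)) (fun z => A z (Y z)) y
    - A y (VectorField.mlieBracket 𝓘(ℝ, E) (fun z => A z (X z)) Y y)
    - A y (VectorField.mlieBracket 𝓘(ℝ, E) X (fun z => A z (Y z)) y)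

namespace ContactMetricStructure

variable {C : ContactStructure E M n ι} {g : SemiRiemannianMetric E M}

/-- `v = u ∘ J` -/
def v (K : ContactMetricStructure C g) (i : ι) (y : M) : TangentSpace 𝓘(ℝ, E) y →L[ℝ] ℝ :=
  (K.u i y).comp (J y)

/-- `V = -JU` -/
def V (K : ContactMetricStructure C g) (i : ι) (y : M) : TangentSpace 𝓘(ℝ, E) y :=
  -J y (K.U i y)

/-- `H = GJ` -/
def H (K : ContactMetricStructure C g) (i : ι) (y : M) :
    TangentSpace 𝓘(ℝ, E) y →L[ℝ] TangentSpace 𝓘(ℝ, E) y :=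
  (K.G i y).comp (J y)

/-- The tensor field
`S(X, Y) = [G, G](X, Y) + 2g(X, GY)U - 2g(X, HY)V + 2(v(Y)HX - v(X)HY)
  + σ(GY)HX - σ(GX)HY + σ(X)GHY - σ(Y)GHX`. -/
def S (K : ContactMetricStructure C g) (i : ι) (X Y : Π y : M, TangentSpace 𝓘(ℝ, E) y)
    (y : M) : TangentSpace 𝓘(ℝ, E) y :=
  nijenhuis (K.G i) X Y y
    + (2 * g.inner y (X y) (K.G i y (Y y))) • K.U i y
    - (2 * g.inner y (X y) (K.H i y (Y y))) • K.V i y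
    + (2 : ℝ) • (K.v i y (Y y) • K.H i y (X y) - K.v i y (X y) • K.H i y (Y y))
    + K.σ i y (K.G i y (Y y)) • K.H i y (X y)
    - K.σ i y (K.G i y (X y)) • K.H i y (Y y)
    + K.σ i y (X y) • K.G i y (K.H i y (Y y))
    - K.σ i y (Y y) • K.G i y (K.H i y (X y))

/-- The tensor field
`T(X, Y) = [H, H](X, Y) - 2g(X, GY)U + 2g(X, HY)V + 2(u(Y)GX - u(X)GY)
  + σ(HX)GY - σ(HY)GX + σ(X)GHY - σ(Y)GHX`. -/
def T (K : ContactMetricStructure C g) (i : ι) (X Y : Π y : M, TangentSpace 𝓘(ℝ, E) y)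
    (y : M) : TangentSpace 𝓘(ℝ, E) y :=
  nijenhuis (K.H i) X Y y
    - (2 * g.inner y (X y) (K.G i y (Y y))) • K.U i y
    + (2 * g.inner y (X y) (K.H i y (Y y))) • K.V i y
    + (2 : ℝ) • (K.u i y (Y y) • K.G i y (X y) - K.u i y (X y) • K.G i y (Y y))
    + K.σ i y (K.H i y (X y)) • K.G i y (Y y)
    - K.σ i y (K.H i y (Y y)) • K.G i y (X y)
    + K.σ i y (X y) • K.G i y (K.H i y (Y y))
    - K.σ i y (Y y) • K.G i y (K.H i y (X y))

/-- Normality: `S(X, Y) = T(X, Y) = 0` for all horizontal `X, Y`, and `S(U, X) = T(V, X) = 0`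
for all `X`. -/
structure IsNormal (K : ContactMetricStructure C g) : Prop where
  horizontal : ∀ i, ∀ y ∈ C.O i, ∀ X Y : Π z : M, TangentSpace 𝓘(ℝ, E) z,
    SmoothAt X y → SmoothAt Y y →
    (∀ᶠ z in 𝓝 y, C.IsHorizontal i z (X z)) → (∀ᶠ z in 𝓝 y, C.IsHorizontal i z (Y z)) →
    K.S i X Y y = 0 ∧ K.T i X Y y = 0
  vertical : ∀ i, ∀ y ∈ C.O i, ∀ X : Π z : M, TangentSpace 𝓘(ℝ, E) z, SmoothAt X y →
    K.S i (K.U i) X y = 0 ∧ K.T i (K.V i) X y = 0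

end ContactMetricStructure

end Contact

/-! ### Linear algebra behind the transversal decomposition -/

section LinearAlgebra

variable {W : Type*} [AddCommGroup W] [Module ℝ W]

theorem decomposition_unique {B : LinearMap.BilinForm ℝ W} (hs : ∀ v w, B v w = B w v)
    {A S' L : Submodule ℝ W} {r : ℕ} {ξ N : Fin r → W}
    (hξ : Submodule.span ℝ (range ξ) = A ⊓ B.orthogonal A)
    (hN : Submodule.span ℝ (range N) = L)
    (hdual : ∀ i j, B (ξ i) (N j) = if i = j then 1 else 0)
    (hS' : S' ≤ B.orthogonal A) (hd : Disjoint (A ⊓ B.orthogonal A) S')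
    {t l s : W} (ht : t ∈ A) (hl : l ∈ L) (hs' : s ∈ S') (h0 : t + l + s = 0) :
    t = 0 ∧ l = 0 ∧ s = 0 := by
  have hξmem : ∀ i, ξ i ∈ A ⊓ B.orthogonal A := fun i => by
    rw [← hξ]; exact Submodule.subset_span (mem_range_self i)
  have hl0 : l = 0 := by
    rw [← hN] at hl
    obtain ⟨c, rfl⟩ := (Submodule.mem_span_range_iff_exists_fun ℝ).1 hl
    refine Finset.sum_eq_zero fun i _ => ?_
    have h1 : B (ξ i) t = 0 := by
      rw [hs]; exact LinearMap.BilinForm.mem_orthogonal_iff.1 (hξmem i).2 t ht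
    have h2 : B (ξ i) s = 0 := LinearMap.BilinForm.mem_orthogonal_iff.1 (hS' hs') _ (hξmem i).1
    have h3 := congrArg (B (ξ i)) h0
    have h4 : B (ξ i) (∑ j, c j • N j) = c i := by
      simp [map_sum, hdual]
    rw [map_add, map_add, h1, h2, h4] at h3
    simp at h3
    simp [h3]
  subst hl0
  have hst : s = -t := by
    rw [add_zero] at h0
    exact (neg_eq_of_add_eq_zero_right h0).symm
  have hsA : s ∈ A := hst ▸ A.neg_mem ht
  have hs0 : s = 0 := Submodule.disjoint_def.1 hd s ⟨hsA, hS' hs'⟩ hs'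
  refine ⟨?_, rfl, hs0⟩
  rw [hs0] at hst
  exact neg_eq_zero.1 hst.symm

theorem decomposition_exists [FiniteDimensional ℝ W] {B : LinearMap.BilinForm ℝ W} (hs : ∀ v w, B v w = B w v)
    (hnd : B.Nondegenerate)
    {A S' L : Submodule ℝ W} {r : ℕ} {ξ N : Fin r → W}
    (hξ : Submodule.span ℝ (range ξ) = A ⊓ B.orthogonal A)
    (hN : Submodule.span ℝ (range N) = L)
    (hdual : ∀ i j, B (ξ i) (N j) = if i = j then 1 else 0)
    (hS' : (A ⊓ B.orthogonal A) ⊔ S' = B.orthogonal A) (hd : Disjoint (A ⊓ B.orthogonal A) S')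
    (w : W) : ∃ d : W × W × W, d.1 ∈ A ∧ d.2.1 ∈ L ∧ d.2.2 ∈ S' ∧ w = d.1 + d.2.1 + d.2.2 := by
  have huniq := fun {t l s : W} => decomposition_unique hs hξ hN hdual
    (hS' ▸ le_sup_right : S' ≤ B.orthogonal A) hd (t := t) (l := l) (s := s)
  have hNind : LinearIndependent ℝ N := by
    rw [Fintype.linearIndependent_iff]
    intro c hc i
    have h4 : B (ξ i) (∑ j, c j • N j) = c i := by simp [map_sum, hdual]
    rw [← h4, hc, map_zero]
  have hLrank : Module.finrank ℝ L = r := by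
    rw [← hN, finrank_span_eq_card hNind, Fintype.card_fin]
  have hRrank : Module.finrank ℝ (A ⊓ B.orthogonal A : Submodule ℝ W) ≤ r := by
    rw [← hξ]
    exact (finrank_range_le_card ξ).trans_eq (Fintype.card_fin r)
  have hS'rank := Submodule.finrank_add_le_finrank_add_finrank (A ⊓ B.orthogonal A) S'
  rw [hS'] at hS'rank
  have hAo := LinearMap.BilinForm.finrank_orthogonal hnd A
  have hAle := Submodule.finrank_le A
  let φ : (A × L × S') →ₗ[ℝ] W :=
    A.subtype.coprod (L.subtype.coprod S'.subtype)
  have hφ : ∀ x : A × L × S', φ x = (x.1 : W) + ((x.2.1 : W) + (x.2.2 : W)) := fun x => rfl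
  have hinj : Function.Injective φ := by
    rw [← LinearMap.ker_eq_bot, LinearMap.ker_eq_bot']
    rintro ⟨t, l, s⟩ h
    rw [hφ, ← add_assoc] at h
    obtain ⟨h1, h2, h3⟩ := huniq t.2 l.2 s.2 h
    simp only [Prod.mk_eq_zero]
    exact ⟨Subtype.ext h1, Subtype.ext h2, Subtype.ext h3⟩
  have hdim : Module.finrank ℝ (A × L × S') = Module.finrank ℝ W := by
    have hle := LinearMap.finrank_le_finrank_of_injective hinj
    rw [Module.finrank_prod, Module.finrank_prod] at hle ⊢
    omega
  have hsurj := (LinearMap.injective_iff_surjective_of_finrank_eq_finrank hdim).1 hinj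
  obtain ⟨⟨t, l, s⟩, h⟩ := hsurj w
  refine ⟨(t, l, s), t.2, l.2, s.2, ?_⟩
  rw [← h, hφ, ← add_assoc]

end LinearAlgebra

/-! ### Null submanifolds -/

section Null

variable {E : Type*} [NormedAddCommGroup E] [NormedSpace ℂ E]
  {M' : Type*} [TopologicalSpace M'] [ChartedSpace E M'] [IsManifold 𝓘(ℂ, E) ∞ M']
  {F : Type*} [NormedAddCommGroup F] [NormedSpace ℝ F]
  {M : Type*} [TopologicalSpace M] [ChartedSpace F M]

/-- Smooth sections over `O ⊆ M` of the pullback bundle `f^* TM'` (vector fields along `f`). -/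
def SmoothAlong (f : M → M') (X : Π p : M, TangentSpace 𝓘(ℝ, E) (f p)) (O : Set M) : Prop :=
  ContMDiffOn 𝓘(ℝ, F) 𝓘(ℝ, E).tangent ∞
    (fun p => (⟨f p, X p⟩ : TangentBundle 𝓘(ℝ, E) M')) O

/-- The family of subspaces `P` is a smooth subbundle of rank `k` of `f^* TM'`. -/
def IsSubbundle (f : M → M') (P : Π p : M, Submodule ℝ (TangentSpace 𝓘(ℝ, E) (f p)))
    (k : ℕ) : Prop :=
  ∀ p₀ : M, ∃ O : Set M, IsOpen O ∧ p₀ ∈ O ∧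
    ∃ s : Fin k → Π p : M, TangentSpace 𝓘(ℝ, E) (f p), (∀ a, SmoothAlong (F := F) f (s a) O) ∧
      ∀ p ∈ O, LinearIndependent ℝ (fun a => s a p) ∧
        Submodule.span ℝ (range fun a => s a p) = P p

/-- The covariant derivative `D_x W` at `p` of a vector field `W` along `f` in the direction
`x ∈ T_p M` (the pullback connection): if `W = ∑ w^a (e_a ∘ f)` in the local frame `e_a` around
`f p` given by the trivialization of the tangent bundle, then
`D_x W = ∑ (dw^a(x) e_a + w^a(p) D_{df(x)} e_a)`. -/
def covAlong (D : CovariantDerivative 𝓘(ℝ, E) E (TangentSpace 𝓘(ℝ, E) : M' → Type _))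
    (f : M → M') (W : Π p : M, TangentSpace 𝓘(ℝ, E) (f p)) (p : M)
    (x : TangentSpace 𝓘(ℝ, F) p) : TangentSpace 𝓘(ℝ, E) (f p) :=
  (trivializationAt E (TangentSpace 𝓘(ℝ, E) : M' → Type _) (f p)).symm (f p)
    (mvfderiv 𝓘(ℝ, F)
      (fun q => (trivializationAt E (TangentSpace 𝓘(ℝ, E) : M' → Type _) (f p)
        ⟨f q, W q⟩).2) p x)
    + D (FiberBundle.extend E (W p)) (f p) (mfderiv 𝓘(ℝ, F) 𝓘(ℝ, E) f p x)

/-- The tangent space of an immersed manifold, as a subspace of the ambient tangent space. -/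
def tangentAt (f : M → M') (p : M) : Submodule ℝ (TangentSpace 𝓘(ℝ, E) (f p)) :=
  LinearMap.range (mfderiv 𝓘(ℝ, F) 𝓘(ℝ, E) f p).toLinearMap

/-- `Rad T_p M = T_p M ∩ T_p M^⊥`. -/
def radAt (g : SemiRiemannianMetric E M') (f : M → M') (p : M) :
    Submodule ℝ (TangentSpace 𝓘(ℝ, E) (f p)) :=
  tangentAt (F := F) f p ⊓ (g.bilin (f p)).orthogonal (tangentAt (F := F) f p)

variable (F M) in
/-- An `r`-null submanifold `f : M → M'` (`r > 0`) together with a screen distribution `S(TM)`,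
a screen transversal bundle `S(TM^⊥)` and a null transversal bundle `ltr(TM)`.  All bundles over
`M` are regarded as subbundles of `f^* TM'`. Nondegeneracy of `S(TM)` and `S(TM^⊥)` follows from
their being complementary to the radical. -/
structure NullSubmanifold (g : SemiRiemannianMetric E M') (r : ℕ) where
  f : M → M'
  smooth : ContMDiff 𝓘(ℝ, F) 𝓘(ℝ, E) ∞ f
  immersion : ∀ p, Function.Injective (mfderiv 𝓘(ℝ, F) 𝓘(ℝ, E) f p)
  r_pos : 0 < r
  rad_bundle : IsSubbundle (F := F) f (radAt (F := F) g f) r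
  screen : Π p : M, Submodule ℝ (TangentSpace 𝓘(ℝ, E) (f p))
  screen_bundle : ∃ k, IsSubbundle (F := F) f screen k
  screen_sup : ∀ p, radAt (F := F) g f p ⊔ screen p = tangentAt (F := F) f p
  screen_disjoint : ∀ p, Disjoint (radAt (F := F) g f p) (screen p)
  screenTr : Π p : M, Submodule ℝ (TangentSpace 𝓘(ℝ, E) (f p))
  screenTr_bundle : ∃ k, IsSubbundle (F := F) f screenTr k
  screenTr_sup : ∀ p, radAt (F := F) g f p ⊔ screenTr p =
    (g.bilin (f p)).orthogonal (tangentAt (F := F) f p)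
  screenTr_disjoint : ∀ p, Disjoint (radAt (F := F) g f p) (screenTr p)
  ltr : Π p : M, Submodule ℝ (TangentSpace 𝓘(ℝ, E) (f p))
  /-- `ltr(TM)` is locally spanned by a null frame `N_a`, with values in the orthogonal complement
  of `S(TM^⊥)` in `S(TM)^⊥`, which is dual to a local frame `ξ_a` of the radical -/
  ltr_frame : ∀ p₀ : M, ∃ O : Set M, IsOpen O ∧ p₀ ∈ O ∧
    ∃ ξ N : Fin r → Π p : M, TangentSpace 𝓘(ℝ, E) (f p),
      (∀ a, SmoothAlong (F := F) f (ξ a) O) ∧ (∀ a, SmoothAlong (F := F) f (N a) O) ∧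
      ∀ p ∈ O, Submodule.span ℝ (range fun a => ξ a p) = radAt (F := F) g f p ∧
        Submodule.span ℝ (range fun a => N a p) = ltr p ∧
        (∀ a b, g.inner (f p) (ξ a p) (N b p) = if a = b then 1 else 0) ∧
        (∀ a b, g.inner (f p) (N a p) (N b p) = 0) ∧
        ∀ a, (∀ x ∈ screen p, g.inner (f p) (N a p) x = 0) ∧
          ∀ x ∈ screenTr p, g.inner (f p) (N a p) x = 0

namespace NullSubmanifold

variable {g : SemiRiemannianMetric E M'} {r : ℕ}

/-- The decomposition `TM' = TM ⊕ ltr(TM) ⊕ S(TM^⊥)` along `M`. -/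
theorem exists_decomp [FiniteDimensional ℂ E] (N : NullSubmanifold F M g r) (p : M)
    (w : TangentSpace 𝓘(ℝ, E) (N.f p)) :
    ∃ d : TangentSpace 𝓘(ℝ, E) (N.f p) × TangentSpace 𝓘(ℝ, E) (N.f p) ×
        TangentSpace 𝓘(ℝ, E) (N.f p),
      d.1 ∈ tangentAt (F := F) N.f p ∧ d.2.1 ∈ N.ltr p ∧ d.2.2 ∈ N.screenTr p ∧
        w = d.1 + d.2.1 + d.2.2 := by
  obtain ⟨O, -, hp, ξ, ν, -, -, h⟩ := N.ltr_frame p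
  obtain ⟨h1, h2, h3, -, -⟩ := h p hp
  have : FiniteDimensional ℝ (TangentSpace 𝓘(ℝ, E) (N.f p)) :=
    inferInstanceAs (FiniteDimensional ℝ E)
  refine decomposition_exists (B := g.bilin (N.f p)) (g.symm _) ?_ h1 h2 h3
    (N.screenTr_sup p) (N.screenTr_disjoint p) w
  refine ⟨fun v hv => g.nondegenerate _ v hv, fun v hv => g.nondegenerate _ v fun w => ?_⟩
  rw [g.symm]
  exact hv w

/-- The three components of the decomposition are unique. -/
theorem decomp_unique (N : NullSubmanifold F M g r) (p : M)
    {t l s t' l' s' : TangentSpace 𝓘(ℝ, E) (N.f p)}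
    (ht : t ∈ tangentAt (F := F) N.f p) (hl : l ∈ N.ltr p) (hs : s ∈ N.screenTr p)
    (ht' : t' ∈ tangentAt (F := F) N.f p) (hl' : l' ∈ N.ltr p) (hs' : s' ∈ N.screenTr p)
    (h0 : t + l + s = t' + l' + s') : t = t' ∧ l = l' ∧ s = s' := by
  obtain ⟨O, -, hp, ξ, ν, -, -, h⟩ := N.ltr_frame p
  obtain ⟨h1, h2, h3, -, -⟩ := h p hp
  have := decomposition_unique (B := g.bilin (N.f p)) (g.symm _) h1 h2 h3
    (N.screenTr_sup p ▸ le_sup_right) (N.screenTr_disjoint p)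
    (Submodule.sub_mem _ ht ht') (Submodule.sub_mem _ hl hl') (Submodule.sub_mem _ hs hs')
    (by rw [← sub_eq_zero] at h0; rw [← h0]; abel)
  exact ⟨sub_eq_zero.1 this.1, sub_eq_zero.1 this.2.1, sub_eq_zero.1 this.2.2⟩

/-- The vector field `AX` on `M`, for a (1,1)-tensor field `A` on `M'` which maps tangent vectors
of `M` to tangent vectors of `M`: `df(AX) = A(df X)`. -/
def act (N : NullSubmanifold F M g r)
    (A : Π y : M', TangentSpace 𝓘(ℝ, E) y →L[ℝ] TangentSpace 𝓘(ℝ, E) y)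
    (X : Π p : M, TangentSpace 𝓘(ℝ, F) p) (p : M) : TangentSpace 𝓘(ℝ, F) p :=
  Function.invFun (mfderiv 𝓘(ℝ, F) 𝓘(ℝ, E) N.f p)
    (A (N.f p) (mfderiv 𝓘(ℝ, F) 𝓘(ℝ, E) N.f p (X p)))

/-- `Rad TM` and `S(TM)` are invariant, at the point `p`, under the endomorphism `A`. -/
def InvariantAt (N : NullSubmanifold F M g r) (p : M)
    (A : TangentSpace 𝓘(ℝ, E) (N.f p) →L[ℝ] TangentSpace 𝓘(ℝ, E) (N.f p)) : Prop :=
  (∀ x ∈ radAt (F := F) g N.f p, A x ∈ radAt (F := F) g N.f p) ∧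
    ∀ x ∈ N.screen p, A x ∈ N.screen p

/-- Quaternion null submanifolds: the characteristic bundle `𝓥 = Span{U, V}` is contained in
`S(TM)`, and `Rad TM` and `S(TM)` are invariant under `J`, `G` and `H`. -/
structure IsQuaternion {n : ℕ} {ι : Type*} {C : ContactStructure E M' n ι}
    (N : NullSubmanifold F M g r) (K : ContactMetricStructure C g) : Prop where
  vertical : ∀ i p, N.f p ∈ C.O i → K.U i (N.f p) ∈ N.screen p ∧ K.V i (N.f p) ∈ N.screen p
  J_invariant : ∀ p, N.InvariantAt p (J (N.f p))
  G_invariant : ∀ i p, N.f p ∈ C.O i → N.InvariantAt p (K.G i (N.f p))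
  H_invariant : ∀ i p, N.f p ∈ C.O i → N.InvariantAt p (K.H i (N.f p))

variable [FiniteDimensional ℂ E]

/-- The components of a vector in `TM`, `ltr(TM)` and `S(TM^⊥)`. -/
def decomp (N : NullSubmanifold F M g r) (p : M) (w : TangentSpace 𝓘(ℝ, E) (N.f p)) :
    TangentSpace 𝓘(ℝ, E) (N.f p) × TangentSpace 𝓘(ℝ, E) (N.f p) ×
        TangentSpace 𝓘(ℝ, E) (N.f p) :=
  Classical.choose (N.exists_decomp p w)

/-- The component `h^l(X, Y)` in `ltr(TM)` of `D_X Y`. -/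
def hl (N : NullSubmanifold F M g r)
    (D : CovariantDerivative 𝓘(ℝ, E) E (TangentSpace 𝓘(ℝ, E) : M' → Type _))
    (X Y : Π p : M, TangentSpace 𝓘(ℝ, F) p) (p : M) : TangentSpace 𝓘(ℝ, E) (N.f p) :=
  (N.decomp p (covAlong D N.f (fun q => mfderiv 𝓘(ℝ, F) 𝓘(ℝ, E) N.f q (Y q)) p (X p))).2.1

/-- The component `h^s(X, Y)` in `S(TM^⊥)` of `D_X Y`. -/
def hs (N : NullSubmanifold F M g r)
    (D : CovariantDerivative 𝓘(ℝ, E) E (TangentSpace 𝓘(ℝ, E) : M' → Type _))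
    (X Y : Π p : M, TangentSpace 𝓘(ℝ, F) p) (p : M) : TangentSpace 𝓘(ℝ, E) (N.f p) :=
  (N.decomp p (covAlong D N.f (fun q => mfderiv 𝓘(ℝ, F) 𝓘(ℝ, E) N.f q (Y q)) p (X p))).2.2

end NullSubmanifold

end Null

end ComplexContact

end

/-!
A quaternion null submanifold of a normal complex contact metric manifold is totally geodesic: the
covariant derivative `D_X Y` of a tangent vector field in a tangent direction is tangent. Hence
`h^l` and `h^s` vanish identically on differentiable vector fields, and the asserted identities
hold because both of their sides are zero.

The reason is the following. Normality determines the covariant derivatives of the structure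
tensors to the extent that `D_X U = -GX + aV` and `(D_X G)Y = σ(X)HY + bU + cV` for horizontal
`X, Y`, and similarly for `V` and `H`. The computation takes place at one point
(`ContactJet.covariant_U`, `ContactJet.covariant_G`); its inputs are `S = 0`, the formulas for `du`
and `dv`, and the identity `d(du) = 0`. The data `(V, -U, H, -G)` satisfy the same equations as
`(U, V, G, H)`, with `T` in the role of `S`, so the statements for `V` and `H` need no separate
proof (`IsNormal.germ_G`, `IsNormal.germ_H`, `ContactGerm.jet`).

Let `β` be the second fundamental form with values in the quotient of the ambient tangent space by
the tangent space of `M`; no choice of transversal bundles enters. It is bilinear and symmetric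
(`secondForm`, `secondForm_symm`). Since the tangent spaces of `M` contain `U` and `V` and are
invariant under `G` and `H`, the formulas above yield `β(X, U) = β(X, V) = 0` and, on horizontal
vectors, `β(X, GY) = Gβ(X, Y)` and `β(X, HY) = Hβ(X, Y)`. Thus `β(GX, HY)` is equal both to
`HGβ(X, Y)` and to `GHβ(X, Y) = -HGβ(X, Y)`, which forces `β = 0` (`eq_zero_of_quaternionic`,
`IsQuaternion.secondForm_eq_zero`).

The remaining work is calculus: the pullback connection `covAlong` obeys the Leibniz and chain rules
and is torsion-free (`covAlong_smul`, `covAlong_comp`, `covAlong_clm`, `covAlong_push_sub`), and a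
vector field on an immersed manifold is differentiable as soon as its image is
(`mdifferentiableAt_of_diffAlong_push`), which applies to `JY`, `GY` and `HY`.
-/

noncomputable section

namespace ComplexContact

open VectorField

/-! ### The structure equations at a point -/

section Jet

variable {W : Type*} [AddCommGroup W] [Module ℝ W]

/-- The values at one point of the tensors of a complex contact metric structure and of their
covariant derivatives, with the equations that the proof uses.  Here `P x y`, `A x` and `B x`
stand for `(∇_x G) y`, `∇_x U` and `∇_x V`, and the fields `S_horizontal` and `S_U` express the
tensor `S` through `∇G`. -/
structure ContactJet (g : LinearMap.BilinForm ℝ W) (G H : W →ₗ[ℝ] W) (U V : W) (σ : W →ₗ[ℝ] ℝ)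
    (P : W → W → W) (A B : W →ₗ[ℝ] W) : Prop where
  symm : ∀ x y, g x y = g y x
  nondegenerate : ∀ x, (∀ y, g x y = 0) → x = 0
  G_sq : ∀ x, G (G x) = -x + g U x • U + g V x • V
  HG : ∀ x, H (G x) = -G (H x)
  G_skew : ∀ x y, g (G x) y = -g x (G y)
  H_skew : ∀ x y, g (H x) y = -g x (H y)
  G_U : G U = 0
  G_V : G V = 0
  H_U : H U = 0
  H_V : H V = 0
  U_U : g U U = 1
  V_V : g V V = 1
  U_V : g U V = 0
  A_U : ∀ x, g (A x) U = 0
  A_V : ∀ x, g (A x) V + g U (B x) = 0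
  P_zero : ∀ y, P 0 y = 0
  P_skew : ∀ x y z, g (P x y) z = -g y (P x z)
  P_G : ∀ x y, P x (G y) + G (P x y)
    = (g (A x) y • U + g U y • A x) + (g (B x) y • V + g V y • B x)
  P_U : ∀ x, P x U = -G (A x)
  P_V : ∀ x, P x V = -G (B x)
  dU : ∀ x y, g (A x) y - g (A y) x = 2 * g x (G y) + (σ x * g V y - σ y * g V x)
  dV : ∀ x y, g (B x) y - g (B y) x = 2 * g x (H y) - (σ x * g U y - σ y * g U x)
  cyclic : ∀ x y z, g V x = 0 → g V y = 0 → g V z = 0 →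
    2 * (g y (P x z) + g z (P y x) + g x (P z y))
      = σ x * (g (B y) z - g (B z) y) + σ y * (g (B z) x - g (B x) z)
        + σ z * (g (B x) y - g (B y) x)
  S_horizontal : ∀ x y, g U x = 0 → g V x = 0 → g U y = 0 → g V y = 0 →
    (P (G x) y - P (G y) x + G (P y x) - G (P x y))
      + (2 * g x (G y)) • U - (2 * g x (H y)) • V
      + σ (G y) • H x - σ (G x) • H y + σ x • G (H y) - σ y • G (H x) = 0
  S_U : ∀ x, (P (G U) x - P (G x) U + G (P x U) - G (P U x))
      + (2 * g U (G x)) • U - (2 * g U (H x)) • V + (2 : ℝ) • (g V x • H U - g V U • H x)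
      + σ (G x) • H U - σ (G U) • H x + σ U • G (H x) - σ x • G (H U) = 0

namespace ContactJet

variable {g : LinearMap.BilinForm ℝ W} {G H : W →ₗ[ℝ] W} {U V : W} {σ : W →ₗ[ℝ] ℝ}
  {P : W → W → W} {A B : W →ₗ[ℝ] W}

theorem V_U (c : ContactJet g G H U V σ P A B) : g V U = 0 := by rw [c.symm, c.U_V]

theorem U_G (c : ContactJet g G H U V σ P A B) (x : W) : g U (G x) = 0 := by
  have := c.G_skew U x
  rw [c.G_U] at this
  simpa using this.symm

theorem V_G (c : ContactJet g G H U V σ P A B) (x : W) : g V (G x) = 0 := by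
  have := c.G_skew V x
  rw [c.G_V] at this
  simpa using this.symm

theorem U_H (c : ContactJet g G H U V σ P A B) (x : W) : g U (H x) = 0 := by
  have := c.H_skew U x
  rw [c.H_U] at this
  simpa using this.symm

theorem V_H (c : ContactJet g G H U V σ P A B) (x : W) : g V (H x) = 0 := by
  have := c.H_skew V x
  rw [c.H_V] at this
  simpa using this.symm

/-- On horizontal vectors, `G` is an isometry. -/
theorem G_G (c : ContactJet g G H U V σ P A B) (x : W) {y : W} (hU : g U y = 0)
    (hV : g V y = 0) : g (G x) (G y) = g x y := by
  rw [c.G_skew, c.G_sq, hU, hV]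
  simp

theorem G_sq_horizontal (c : ContactJet g G H U V σ P A B) {y : W} (hU : g U y = 0)
    (hV : g V y = 0) : G (G y) = -y := by
  rw [c.G_sq, hU, hV]
  simp

/-- A vector orthogonal to all horizontal vectors is vertical. -/
theorem eq_vertical (c : ContactJet g G H U V σ P A B) {w : W}
    (h : ∀ y, g U y = 0 → g V y = 0 → g w y = 0) : w = g U w • U + g V w • V := by
  refine sub_eq_zero.1 (c.nondegenerate _ fun z => ?_)
  have h1 := h (z - g U z • U - g V z • V)
    (by simp [c.U_U, c.U_V]) (by simp [c.V_V, c.V_U])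
  simp only [map_sub, map_smul, map_add, LinearMap.sub_apply, LinearMap.add_apply,
    LinearMap.smul_apply, smul_eq_mul] at h1 ⊢
  rw [c.symm U w, c.symm V w]
  linarith

/-- The flow of `U` preserves the metric on horizontal vectors: this is the derivative of
`du(x, y) = g(x, Gy) + (σ ∧ v)(x, y)` along `U`, computed once from `d(du) = 0` and once from
`S(U, x) = 0`. -/
theorem killing_aux (c : ContactJet g G H U V σ P A B) {x y : W} (hx : g U x = 0)
    (hx' : g V x = 0) (hy : g U y = 0) (hy' : g V y = 0) :
    g (A (G x)) y + g (A y) (G x) = 0 := by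
  have e1 : g x (P U y) = -g (P U x) y := by rw [c.symm, c.P_skew, c.symm]
  have e2 : g y (P x U) = g (A x) (G y) := by rw [c.P_U, c.symm, map_neg, LinearMap.neg_apply,
    c.G_skew, neg_neg]
  have e3 : g U (P y x) = -g (A y) (G x) := by
    rw [c.symm, c.P_skew, c.P_U, map_neg, neg_neg, c.symm, c.G_skew]
  have e4 : g x (H y) = -g (H x) y := by rw [c.H_skew, neg_neg]
  have h1 := c.cyclic U x y c.V_U hx' hy'
  rw [c.dV y U, c.dV U x, c.dV x y, e1, e2, e3, e4, c.H_U, c.U_H, c.U_U, hx, hy] at h1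
  have h2 := congrArg (fun w => g w (G y)) (c.S_U x)
  simp only [c.P_U, c.G_U, c.H_U, c.P_zero, map_zero, smul_zero, c.U_G, c.U_H, c.V_U, mul_zero,
    zero_smul, sub_zero, add_zero, zero_sub, map_add, map_sub, map_neg, map_smul,
    LinearMap.add_apply, LinearMap.sub_apply, LinearMap.neg_apply, LinearMap.smul_apply,
    smul_eq_mul, c.G_G _ hy hy', c.G_skew _ y, LinearMap.zero_apply] at h2
  simp only [map_zero, mul_zero] at h1
  linarith

theorem killing (c : ContactJet g G H U V σ P A B) {x y : W} (hx : g U x = 0)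
    (hx' : g V x = 0) (hy : g U y = 0) (hy' : g V y = 0) : g (A x) y + g (A y) x = 0 := by
  have h := c.killing_aux (x := -G x) (y := y) (by simp [c.U_G]) (by simp [c.V_G]) hy hy'
  rw [map_neg, c.G_sq_horizontal hx hx', neg_neg] at h
  exact h

/-- `[U, V]` is vertical. -/
theorem bracket_vertical (c : ContactJet g G H U V σ P A B) {y : W} (hy : g U y = 0)
    (hy' : g V y = 0) : g (B U) y = g (A V) y := by
  have h2 := congrArg (fun w => g w y) (c.S_U V)
  simp only [c.P_U, c.P_V, c.G_U, c.H_U, c.G_V, c.H_V, c.V_U, c.G_sq, hy, hy',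
    map_zero, smul_zero, mul_zero,
    zero_smul, sub_zero, add_zero, map_add, map_sub, map_neg, map_smul,
    LinearMap.add_apply, LinearMap.sub_apply, LinearMap.neg_apply, LinearMap.smul_apply,
    smul_eq_mul, LinearMap.zero_apply, neg_neg] at h2
  linarith

/-- `∇_x U = -Gx` up to a multiple of `V`. -/
theorem covariant_U (c : ContactJet g G H U V σ P A B) (x : W) :
    ∃ a : ℝ, A x = -G x + a • V := by
  have key : ∀ x y, g U y = 0 → g V y = 0 → g (A x + G x) y = 0 := by
    intro x y hy hy'
    -- the three cases `x` horizontal, `x = U`, `x = V`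
    have h0 : ∀ x, g U x = 0 → g V x = 0 → g (A x + G x) y = 0 := by
      intro x hx hx'
      have h1 := c.dU x y
      have h2 := c.killing hx hx' hy hy'
      have h3 := c.G_skew x y
      rw [hy', hx'] at h1
      simp only [map_add, LinearMap.add_apply]
      linarith
    have hU : g (A U + G U) y = 0 := by
      have h1 := c.dU U y
      rw [c.A_U, c.U_G, hy', c.V_U] at h1
      simp only [map_add, LinearMap.add_apply, c.G_U, map_zero, LinearMap.zero_apply]
      linarith
    have hV : g (A V + G V) y = 0 := by
      have h1 := c.dU V y
      have h2 := c.dV U y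
      have h3 := c.bracket_vertical hy hy'
      have h4 := c.A_V y
      have h5 := c.symm U (B y)
      rw [c.V_G, hy', c.V_V] at h1
      rw [c.U_H, hy, c.U_U] at h2
      simp only [map_add, LinearMap.add_apply, c.G_V, map_zero, LinearMap.zero_apply]
      linarith
    have h := h0 (x - g U x • U - g V x • V) (by simp [c.U_U, c.U_V]) (by simp [c.V_V, c.V_U])
    simp only [map_add, map_sub, map_smul, LinearMap.add_apply, LinearMap.sub_apply,
      LinearMap.smul_apply, smul_eq_mul] at h hU hV ⊢
    linear_combination h + g U x * hU + g V x * hV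
  refine ⟨g V (A x + G x), ?_⟩
  have h := c.eq_vertical (key x)
  rw [map_add (g U), c.symm U (A x), c.A_U, c.U_G, add_zero, zero_smul, zero_add] at h
  rw [← h]
  abel

/-- On horizontal vectors, `(∇_x G) y = σ(x) Hy` up to vertical terms.  Modulo these, the
difference of the two sides behaves like the covariant derivative of an almost complex structure
whose Kähler form is closed and whose Nijenhuis tensor is zero, and the classical computation
shows that it vanishes. -/
theorem covariant_G (c : ContactJet g G H U V σ P A B) {x y : W} (hx : g U x = 0)
    (hx' : g V x = 0) (hy : g U y = 0) (hy' : g V y = 0) :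
    ∃ a b : ℝ, P x y = σ x • H y + a • U + b • V := by
  set q : W → W → W → ℝ := fun x y z => g (P x y) z - σ x * g (H y) z with hq
  have q_skew : ∀ x y z, q x y z = -q x z y := by
    intro x y z
    simp only [hq]
    rw [c.P_skew, c.symm y, c.H_skew, c.symm y]
    ring
  have q_G : ∀ x y z, g U y = 0 → g V y = 0 → g U z = 0 → g V z = 0 →
      q x (G y) z = q x y (G z) := by
    intro x y z hy hy' hz hz'
    have h := congrArg (fun w => g w z) (c.P_G x y)
    simp only [map_add, map_smul, LinearMap.add_apply, LinearMap.smul_apply, smul_eq_mul, hz, hz',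
      hy, hy', zero_mul, mul_zero, c.G_skew (P x y) z] at h
    have h2 := c.G_skew (H y) z
    simp only [hq]
    rw [c.HG, map_neg, LinearMap.neg_apply]
    linear_combination h + σ x * h2
  have q_cyc : ∀ x y z, g U x = 0 → g V x = 0 → g U y = 0 → g V y = 0 → g U z = 0 → g V z = 0 →
      q x y z + q y z x + q z x y = 0 := by
    intro x y z hx hx' hy hy' hz hz'
    have h := c.cyclic x y z hx' hy' hz'
    rw [c.dV y z, c.dV z x, c.dV x y, hx, hy, hz, c.symm y (P x z), c.symm z (P y x),
      c.symm x (P z y), c.P_skew x z y, c.P_skew y x z, c.P_skew z y x] at h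
    have h1 := c.H_skew y z
    have h2 := c.H_skew z x
    have h3 := c.H_skew x y
    have h4 := c.symm z (P x y)
    have h5 := c.symm x (P y z)
    have h6 := c.symm y (P z x)
    simp only [hq]
    linear_combination (-1 / 2) * h - h4 - h5 - h6 - σ x * h1 - σ y * h2 - σ z * h3
  have q_S : ∀ x y z, g U x = 0 → g V x = 0 → g U y = 0 → g V y = 0 → g U z = 0 → g V z = 0 →
      q (G x) y z - q (G y) x z - q y x (G z) + q x y (G z) = 0 := by
    intro x y z hx hx' hy hy' hz hz'
    have h := congrArg (fun w => g w z) (c.S_horizontal x y hx hx' hy hy')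
    simp only [map_add, map_sub, map_smul, LinearMap.add_apply, LinearMap.sub_apply,
      LinearMap.smul_apply, smul_eq_mul, hz, hz', mul_zero, map_zero, LinearMap.zero_apply,
      c.G_skew _ z] at h
    simp only [hq]
    linear_combination h
  have q_zero : ∀ z, g U z = 0 → g V z = 0 → q x y z = 0 := by
    intro z hz hz'
    have GU := c.U_G
    have GV := c.V_G
    -- As for Kähler manifolds: the cyclic identity for `(x, y, z)` and for `(x, Gy, Gz)`, and the
    -- vanishing of the Nijenhuis tensor on `(y, z)` paired with `Gx`.
    have h1 := q_cyc x y z hx hx' hy hy' hz hz'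
    have h2 := q_cyc x (G y) (G z) hx hx' (GU y) (GV y) (GU z) (GV z)
    have h3 := q_S y z (G x) hy hy' hz hz' (GU x) (GV x)
    have e1 := q_G x y (G z) hy hy' (GU z) (GV z)
    have e2 := q_G (G y) z x hz hz' hx hx'
    have e3 := q_G (G z) x y hx hx' hy hy'
    rw [c.G_sq_horizontal hz hz'] at e1
    rw [c.G_sq_horizontal hx hx'] at h3
    have n1 : q x y (-z) = -q x y z := by simp only [hq, map_neg]; ring
    have n2 : q z y (-x) = -q z y x := by simp only [hq, map_neg]; ring
    have n3 : q y z (-x) = -q y z x := by simp only [hq, map_neg]; ring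
    have s1 := q_skew (G z) (G x) y
    have s2 := q_skew z x y
    linarith
  have h := c.eq_vertical (w := P x y - σ x • H y) fun z hz hz' => by
    have := q_zero z hz hz'
    simpa [hq] using this
  refine ⟨g U (P x y - σ x • H y), g V (P x y - σ x • H y), ?_⟩
  rw [add_assoc, ← h]
  abel

end ContactJet

end Jet

/-! ### Bilinear forms which are linear over the quaternions -/

section Quaternionic

variable {W : Type*} [AddCommGroup W] [Module ℝ W]

/-- A symmetric bilinear map on `T` with values in `W ⧸ T` vanishes if it is zero on the vertical
vectors `U`, `V` and commutes, on horizontal vectors, with both `G` and `H`: these anticommute, so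
`β(Gx, Hy)` is equal both to `HG β(x, y)` and to `GH β(x, y) = -HG β(x, y)`. -/
theorem eq_zero_of_quaternionic {g : LinearMap.BilinForm ℝ W} {G H : W →ₗ[ℝ] W} {U V : W}
    {T : Submodule ℝ W} (hGT : T ≤ T.comap G) (hHT : T ≤ T.comap H) (hU : U ∈ T) (hV : V ∈ T)
    (G_sq : ∀ x, G (G x) = -x + g U x • U + g V x • V)
    (H_sq : ∀ x, H (H x) = -x + g U x • U + g V x • V)
    (HG : ∀ x, H (G x) = -G (H x))
    (UU : g U U = 1) (VV : g V V = 1) (UV : g U V = 0) (VU : g V U = 0)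
    (UG : ∀ x, g U (G x) = 0) (VG : ∀ x, g V (G x) = 0)
    (UH : ∀ x, g U (H x) = 0) (VH : ∀ x, g V (H x) = 0)
    (β : T →ₗ[ℝ] T →ₗ[ℝ] W ⧸ T) (hβ : ∀ a b, β a b = β b a)
    (hβU : ∀ a, β a ⟨U, hU⟩ = 0) (hβV : ∀ a, β a ⟨V, hV⟩ = 0)
    (hβG : ∀ a b : T, g U a = 0 → g V a = 0 → g U b = 0 → g V b = 0 →
      β a (G.restrict hGT b) = T.mapQ T G hGT (β a b))
    (hβH : ∀ a b : T, g U a = 0 → g V a = 0 → g U b = 0 → g V b = 0 →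
      β a (H.restrict hHT b) = T.mapQ T H hHT (β a b)) : β = 0 := by
  -- Modulo `T`, both `G` and `H` square to `-1`, so that `GH` is injective.
  have hinj : ∀ w : W ⧸ T, T.mapQ T G hGT (T.mapQ T H hHT w) = 0 → w = 0 := by
    intro w hw
    obtain ⟨w, rfl⟩ := T.mkQ_surjective w
    simp only [Submodule.mkQ_apply, Submodule.mapQ_apply, Submodule.Quotient.mk_eq_zero] at hw ⊢
    have h1 := hGT hw
    rw [Submodule.mem_comap, G_sq, UH, VH, zero_smul, zero_smul, add_zero, add_zero,
      neg_mem_iff] at h1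
    have h2 := hHT h1
    rw [Submodule.mem_comap, H_sq, add_assoc] at h2
    have h3 := T.sub_mem (T.add_mem (T.smul_mem (g U w) hU) (T.smul_mem (g V w) hV)) h2
    simpa using h3
  have hanti : ∀ w : W ⧸ T,
      T.mapQ T H hHT (T.mapQ T G hGT w) = -T.mapQ T G hGT (T.mapQ T H hHT w) := by
    intro w
    obtain ⟨w, rfl⟩ := T.mkQ_surjective w
    simp only [Submodule.mkQ_apply, Submodule.mapQ_apply, HG]
    rfl
  have hhor : ∀ a b : T, g U a = 0 → g V a = 0 → g U b = 0 → g V b = 0 → β a b = 0 := by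
    intro a b ha ha' hb hb'
    have h1 : β (G.restrict hGT a) (H.restrict hHT b)
        = T.mapQ T H hHT (T.mapQ T G hGT (β a b)) := by
      rw [hβH _ _ (UG _) (VG _) hb hb', hβ, hβG _ _ hb hb' ha ha', hβ b a]
    have h2 : β (G.restrict hGT a) (H.restrict hHT b)
        = T.mapQ T G hGT (T.mapQ T H hHT (β a b)) := by
      rw [hβ, hβG _ _ (UH _) (VH _) ha ha', hβ _ a, hβH _ _ ha ha' hb hb']
    refine hinj _ ?_
    rw [h1, hanti] at h2
    have h3 : (2 : ℝ) • T.mapQ T G hGT (T.mapQ T H hHT (β a b)) = 0 := by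
      rw [two_smul]
      nth_rewrite 1 [← h2]
      exact neg_add_cancel _
    exact (smul_eq_zero.1 h3).resolve_left two_ne_zero
  -- Splitting off the vertical part reduces the claim to horizontal vectors.
  have hdec : ∀ a : T, ∃ b : T, g U b = 0 ∧ g V b = 0 ∧
      a = b + (g U a • ⟨U, hU⟩ + g V a • ⟨V, hV⟩ : T) := fun a =>
    ⟨a - (g U a • ⟨U, hU⟩ + g V a • ⟨V, hV⟩ : T), by simp [UU, UV], by simp [VV, VU], by simp⟩
  ext a b
  obtain ⟨a', h1, h2, ha⟩ := hdec a
  obtain ⟨b', h3, h4, hb⟩ := hdec b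
  have h5 : β a b = β a b' := by
    rw [hb, map_add, map_add, map_smul, map_smul, hβU, hβV, smul_zero, smul_zero, add_zero,
      add_zero]
  rw [h5, hβ, ha, map_add, map_add, map_smul, map_smul, hβU, hβV, smul_zero, smul_zero, add_zero,
    add_zero, hhor _ _ h3 h4 h1 h2]
  rfl

end Quaternionic

/-! ### Derivatives of functions along vector fields -/

section Commutator
variable {E : Type*} [NormedAddCommGroup E] [NormedSpace ℝ E]
  {M : Type*} [TopologicalSpace M] [ChartedSpace E M]
  {E' : Type*} [NormedAddCommGroup E'] [NormedSpace ℝ E']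

/-- A smooth function, read in a chart. -/
theorem contDiffAt_comp_extChartAt_symm {p : M} {ψ : M → E'}
    (hψ : ContMDiffAt 𝓘(ℝ, E) 𝓘(ℝ, E') ∞ ψ p) :
    ContDiffAt ℝ ∞ (ψ ∘ (extChartAt 𝓘(ℝ, E) p).symm) (extChartAt 𝓘(ℝ, E) p p) := by
  have h := (contMDiffAt_iff.1 hψ).2
  rw [modelWithCornersSelf_coe, range_id, contDiffWithinAt_univ] at h
  exact h

/-- `X(Yψ) - Y(Xψ) = [X, Y]ψ` in a normed space: the second derivatives of `ψ` cancel by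
symmetry. -/
theorem fderiv_commutator {ψ : E → E'} {a : E} (hψ : ContDiffAt ℝ ∞ ψ a) {X Y : E → E}
    (hX : DifferentiableAt ℝ X a) (hY : DifferentiableAt ℝ Y a) :
    fderiv ℝ (fun z => fderiv ℝ ψ z (Y z)) a (X a) - fderiv ℝ (fun z => fderiv ℝ ψ z (X z)) a (Y a)
      = fderiv ℝ ψ a (lieBracket ℝ X Y a) := by
  have h3 : DifferentiableAt ℝ (fderiv ℝ ψ) a :=
    (hψ.fderiv_right (m := 1) (by decide)).differentiableAt one_ne_zero
  have hs : IsSymmSndFDerivAt ℝ ψ a :=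
    hψ.isSymmSndFDerivAt (by simpa using (ENat.LEInfty.out : (2 : ℕ∞ω) ≤ ∞))
  rw [fderiv_clm_apply h3 hX, fderiv_clm_apply h3 hY, lieBracket_eq]
  simp only [add_apply, ContinuousLinearMap.comp_apply,
    ContinuousLinearMap.flip_apply, map_sub]
  rw [hs.eq]
  abel

/-- A vector field, read in the preferred chart at `p`. -/
def chartField (p : M) (X : Π q : M, TangentSpace 𝓘(ℝ, E) q) (z : E) : E :=
  mpullbackWithin 𝓘(ℝ, E) 𝓘(ℝ, E) (extChartAt 𝓘(ℝ, E) p).symm X (range 𝓘(ℝ, E)) z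

theorem mvfderiv_congr {p : M} {φ ψ : M → E'} (h : φ =ᶠ[𝓝 p] ψ) :
    mvfderiv 𝓘(ℝ, E) φ p = mvfderiv 𝓘(ℝ, E) ψ p := by
  rw [mvfderiv, h.mfderiv_eq]
  rfl

variable [IsManifold 𝓘(ℝ, E) ∞ M]

/-- The derivative of a function along a vector field, in a chart. -/
theorem mvfderiv_extChartAt_symm {p : M} {ψ : M → E'} {z : E}
    (hz : z ∈ (extChartAt 𝓘(ℝ, E) p).target)
    (hψ : MDifferentiableAt 𝓘(ℝ, E) 𝓘(ℝ, E') ψ ((extChartAt 𝓘(ℝ, E) p).symm z))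
    (X : Π q : M, TangentSpace 𝓘(ℝ, E) q) :
    mvfderiv 𝓘(ℝ, E) ψ ((extChartAt 𝓘(ℝ, E) p).symm z) (X ((extChartAt 𝓘(ℝ, E) p).symm z)) =
      fderiv ℝ (ψ ∘ (extChartAt 𝓘(ℝ, E) p).symm) z
        (chartField p X z) := by
  have h1 := mdifferentiableWithinAt_extChartAt_symm (I := 𝓘(ℝ, E)) hz
  have h2 := isInvertible_mfderivWithin_extChartAt_symm (I := 𝓘(ℝ, E)) hz
  rw [chartField, mpullbackWithin_apply, ← mfderiv_eq_fderiv]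
  rw [modelWithCornersSelf_coe, range_id, mdifferentiableWithinAt_univ] at h1
  rw [modelWithCornersSelf_coe, range_id, mfderivWithin_univ] at h2 ⊢
  have h3 := mfderiv_comp z hψ h1
  rw [h3]
  obtain ⟨e, he⟩ := h2
  rw [← he]
  simp only [mvfderiv, ContinuousLinearMap.comp_apply, ContinuousLinearMap.inverse_equiv]
  exact (congrArg _ (e.apply_symm_apply _)).symm

theorem mdifferentiableAt_of_comp_extChartAt_symm {p : M} {h : M → E'}
    (hh : DifferentiableAt ℝ (h ∘ (extChartAt 𝓘(ℝ, E) p).symm) (extChartAt 𝓘(ℝ, E) p p)) :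
    MDifferentiableAt 𝓘(ℝ, E) 𝓘(ℝ, E') h p := by
  refine MDifferentiableAt.congr_of_eventuallyEq
    (f := (h ∘ (extChartAt 𝓘(ℝ, E) p).symm) ∘ extChartAt 𝓘(ℝ, E) p)
    (hh.mdifferentiableAt.comp p
      (mdifferentiableAt_extChartAt (mem_chart_source E p))) ?_
  filter_upwards [extChartAt_source_mem_nhds (I := 𝓘(ℝ, E)) p] with q hq
  rw [Function.comp_apply, Function.comp_apply, (extChartAt 𝓘(ℝ, E) p).left_inv hq]

/-- A smooth function, differentiated along a vector field, in a chart. -/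
theorem mvfderiv_comp_extChartAt_symm_eventuallyEq {p : M} {ψ : M → E'}
    (hψ : ContMDiffAt 𝓘(ℝ, E) 𝓘(ℝ, E') ∞ ψ p) (X : Π q : M, TangentSpace 𝓘(ℝ, E) q) :
    (fun q => mvfderiv 𝓘(ℝ, E) ψ q (X q)) ∘ (extChartAt 𝓘(ℝ, E) p).symm
      =ᶠ[𝓝 (extChartAt 𝓘(ℝ, E) p p)]
      fun z => fderiv ℝ (ψ ∘ (extChartAt 𝓘(ℝ, E) p).symm) z
        (chartField p X z) := by
  have h1 : ∀ᶠ q in 𝓝 p, MDifferentiableAt 𝓘(ℝ, E) 𝓘(ℝ, E') ψ q :=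
    ((contMDiffAt_iff_contMDiffAt_nhds (n := 1) (by simp)).1 (hψ.of_le (by simp))).mono
      fun q hq => hq.mdifferentiableAt one_ne_zero
  have h2 := (continuousAt_extChartAt_symm (I := 𝓘(ℝ, E)) p)
  rw [ContinuousAt, extChartAt_to_inv] at h2
  filter_upwards [extChartAt_target_mem_nhds (I := 𝓘(ℝ, E)) p, h2.eventually h1] with z hz hz'
  exact mvfderiv_extChartAt_symm hz hz' X

variable [CompleteSpace E]

theorem differentiableAt_chartField {p : M} {X : Π q : M, TangentSpace 𝓘(ℝ, E) q}
    (hX : MDifferentiableAt 𝓘(ℝ, E) 𝓘(ℝ, E).tangent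
      (fun q => (⟨q, X q⟩ : TangentBundle 𝓘(ℝ, E) M)) p) :
    DifferentiableAt ℝ (chartField p X) (extChartAt 𝓘(ℝ, E) p p) := by
  have : IsManifold 𝓘(ℝ, E) 2 M := .of_le (n := ∞) ENat.LEInfty.out
  have h := (mdifferentiableWithinAt_univ.2
    hX).differentiableWithinAt_mpullbackWithin_vectorField
  have h' : DifferentiableWithinAt ℝ (chartField p X)
    ((extChartAt 𝓘(ℝ, E) p).symm ⁻¹' univ ∩ range 𝓘(ℝ, E)) (extChartAt 𝓘(ℝ, E) p p) := h
  simpa only [preimage_univ, univ_inter, modelWithCornersSelf_coe, range_id,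
    differentiableWithinAt_univ] using h'

/-- The derivative of a smooth function along a differentiable vector field is differentiable. -/
theorem mdifferentiableAt_mvfderiv_apply {p : M} {ψ : M → E'}
    (hψ : ContMDiffAt 𝓘(ℝ, E) 𝓘(ℝ, E') ∞ ψ p) {X : Π q : M, TangentSpace 𝓘(ℝ, E) q}
    (hX : MDifferentiableAt 𝓘(ℝ, E) 𝓘(ℝ, E).tangent
      (fun q => (⟨q, X q⟩ : TangentBundle 𝓘(ℝ, E) M)) p) :
    MDifferentiableAt 𝓘(ℝ, E) 𝓘(ℝ, E') (fun q => mvfderiv 𝓘(ℝ, E) ψ q (X q)) p := by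
  refine mdifferentiableAt_of_comp_extChartAt_symm ?_
  refine DifferentiableAt.congr_of_eventuallyEq ?_
    (mvfderiv_comp_extChartAt_symm_eventuallyEq hψ X)
  have h2 := contDiffAt_comp_extChartAt_symm hψ
  exact ((h2.fderiv_right (m := 1) (by decide)).differentiableAt
    one_ne_zero).clm_apply (differentiableAt_chartField hX)

/-- `X(Yψ) - Y(Xψ) = [X, Y]ψ`. -/
theorem mvfderiv_commutator {p : M} {ψ : M → E'} (hψ : ContMDiffAt 𝓘(ℝ, E) 𝓘(ℝ, E') ∞ ψ p)
    {X Y : Π q : M, TangentSpace 𝓘(ℝ, E) q}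
    (hX : MDifferentiableAt 𝓘(ℝ, E) 𝓘(ℝ, E).tangent
      (fun q => (⟨q, X q⟩ : TangentBundle 𝓘(ℝ, E) M)) p)
    (hY : MDifferentiableAt 𝓘(ℝ, E) 𝓘(ℝ, E).tangent
      (fun q => (⟨q, Y q⟩ : TangentBundle 𝓘(ℝ, E) M)) p) :
    mvfderiv 𝓘(ℝ, E) (fun q => mvfderiv 𝓘(ℝ, E) ψ q (Y q)) p (X p)
      - mvfderiv 𝓘(ℝ, E) (fun q => mvfderiv 𝓘(ℝ, E) ψ q (X q)) p (Y p)
      = mvfderiv 𝓘(ℝ, E) ψ p (mlieBracket 𝓘(ℝ, E) X Y p) := by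
  have ha : (extChartAt 𝓘(ℝ, E) p).symm (extChartAt 𝓘(ℝ, E) p p) = p := extChartAt_to_inv p
  have haT : extChartAt 𝓘(ℝ, E) p p ∈ (extChartAt 𝓘(ℝ, E) p).target := mem_extChartAt_target p
  have h2 := contDiffAt_comp_extChartAt_symm hψ
  -- derivatives at `p` along vector fields, computed in the chart
  have key : ∀ (h : M → E') (Z : Π q : M, TangentSpace 𝓘(ℝ, E) q),
      MDifferentiableAt 𝓘(ℝ, E) 𝓘(ℝ, E') h p → mvfderiv 𝓘(ℝ, E) h p (Z p) =
        fderiv ℝ (h ∘ (extChartAt 𝓘(ℝ, E) p).symm) (extChartAt 𝓘(ℝ, E) p p)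
          (chartField p Z (extChartAt 𝓘(ℝ, E) p p)) := by
    intro h Z hh
    rw [← ha] at hh
    have := mvfderiv_extChartAt_symm haT hh Z
    rwa [ha] at this
  -- the bracket is computed in the chart by definition
  have hb : mvfderiv 𝓘(ℝ, E) ψ p (mlieBracket 𝓘(ℝ, E) X Y p)
      = fderiv ℝ (ψ ∘ (extChartAt 𝓘(ℝ, E) p).symm) (extChartAt 𝓘(ℝ, E) p p)
        (lieBracket ℝ (chartField p X) (chartField p Y) (extChartAt 𝓘(ℝ, E) p p)) := by
    have hψ' : ψ =ᶠ[𝓝 p] (ψ ∘ (extChartAt 𝓘(ℝ, E) p).symm) ∘ extChartAt 𝓘(ℝ, E) p := by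
      filter_upwards [extChartAt_source_mem_nhds (I := 𝓘(ℝ, E)) p] with q hq
      rw [Function.comp_apply, Function.comp_apply, (extChartAt 𝓘(ℝ, E) p).left_inv hq]
    have hi := isInvertible_mfderiv_extChartAt (I := 𝓘(ℝ, E)) (mem_extChartAt_source p)
    have hc := mfderiv_comp p (h2.differentiableAt (by simp)).mdifferentiableAt
      (mdifferentiableAt_extChartAt (I := 𝓘(ℝ, E)) (mem_chart_source E p))
    rw [← mlieBracketWithin_univ, mlieBracketWithin_apply, mvfderiv, hψ'.mfderiv_eq, hc]
    obtain ⟨e, he⟩ := hi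
    rw [← he, ContinuousLinearMap.inverse_equiv, mfderiv_eq_fderiv]
    refine (congrArg (fderiv ℝ (ψ ∘ (extChartAt 𝓘(ℝ, E) p).symm) (extChartAt 𝓘(ℝ, E) p p))
      (e.apply_symm_apply _)).trans (congrArg _ ?_)
    change lieBracketWithin ℝ (chartField p X) (chartField p Y)
      ((extChartAt 𝓘(ℝ, E) p).symm ⁻¹' univ ∩ range 𝓘(ℝ, E)) (extChartAt 𝓘(ℝ, E) p p) = _
    simp only [preimage_univ, univ_inter, modelWithCornersSelf_coe, range_id,
      lieBracketWithin_univ]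
  rw [hb, key _ X (mdifferentiableAt_mvfderiv_apply hψ hY),
    key _ Y (mdifferentiableAt_mvfderiv_apply hψ hX),
    (mvfderiv_comp_extChartAt_symm_eventuallyEq hψ X).fderiv_eq,
    (mvfderiv_comp_extChartAt_symm_eventuallyEq hψ Y).fderiv_eq]
  exact fderiv_commutator h2 (differentiableAt_chartField hX) (differentiableAt_chartField hY)

end Commutator

/-! ### Tangent vectors in charts, and `d(dη) = 0` -/

section Coordinates
variable {E : Type*} [NormedAddCommGroup E] [NormedSpace ℝ E]
  {M : Type*} [TopologicalSpace M] [ChartedSpace E M] [IsManifold 𝓘(ℝ, E) ∞ M]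

/-- Coordinates of tangent vectors in the trivialization at `p` are derivatives of the chart. -/
theorem trivializationAt_snd_eq_mvfderiv {p q : M} (hq : q ∈ (chartAt E p).source)
    (w : TangentSpace 𝓘(ℝ, E) q) :
    (trivializationAt E (TangentSpace 𝓘(ℝ, E) : M → Type _) p ⟨q, w⟩).2
      = mvfderiv 𝓘(ℝ, E) (extChartAt 𝓘(ℝ, E) p) q w := by
  rw [(mdifferentiableAt_extChartAt hq).mvfderiv]
  rfl

theorem mvfderiv_extChartAt_trivializationAt_symm {p q : M} (hq : q ∈ (chartAt E p).source)
    (w : E) : mvfderiv 𝓘(ℝ, E) (extChartAt 𝓘(ℝ, E) p) q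
      ((trivializationAt E (TangentSpace 𝓘(ℝ, E) : M → Type _) p).symm q w) = w := by
  rw [← trivializationAt_snd_eq_mvfderiv hq, Trivialization.apply_mk_symm _ hq]

theorem trivializationAt_symm_mvfderiv_extChartAt {p q : M} (hq : q ∈ (chartAt E p).source)
    (w : TangentSpace 𝓘(ℝ, E) q) :
    (trivializationAt E (TangentSpace 𝓘(ℝ, E) : M → Type _) p).symm q
      (mvfderiv 𝓘(ℝ, E) (extChartAt 𝓘(ℝ, E) p) q w) = w := by
  rw [← trivializationAt_snd_eq_mvfderiv hq]
  exact Trivialization.symm_apply_apply_mk _ hq w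

theorem trivializationAt_extend_snd {p q : M} (hq : q ∈ (chartAt E p).source)
    (v : TangentSpace 𝓘(ℝ, E) p) :
    (trivializationAt E (TangentSpace 𝓘(ℝ, E) : M → Type _) p
      ⟨q, FiberBundle.extend E v q⟩).2
      = (trivializationAt E (TangentSpace 𝓘(ℝ, E) : M → Type _) p ⟨p, v⟩).2 := by
  rw [FiberBundle.extend, Trivialization.apply_mk_symm _ hq]

theorem contMDiffAt_extend_of_mem {p q : M} (hq : q ∈ (chartAt E p).source)
    (v : TangentSpace 𝓘(ℝ, E) p) : ContMDiffAt 𝓘(ℝ, E) 𝓘(ℝ, E).tangent ∞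
      (fun z => (⟨z, FiberBundle.extend E v z⟩ : TangentBundle 𝓘(ℝ, E) M)) q := by
  refine ((trivializationAt E (TangentSpace 𝓘(ℝ, E) : M → Type _) p).contMDiffAt_section_iff
    (F := E) hq).2 ?_
  refine ContMDiffAt.congr_of_eventuallyEq (contMDiffAt_const
    (c := (trivializationAt E (TangentSpace 𝓘(ℝ, E) : M → Type _) p ⟨p, v⟩).2)) ?_
  filter_upwards [(chartAt E p).open_source.mem_nhds hq] with z hz
  exact trivializationAt_extend_snd hz v

variable [CompleteSpace E]

/-- Vector fields with constant coordinates commute. -/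
theorem mlieBracket_extend {p q : M} (hq : q ∈ (chartAt E p).source)
    (v w : TangentSpace 𝓘(ℝ, E) p) :
    mlieBracket 𝓘(ℝ, E) (FiberBundle.extend E v) (FiberBundle.extend E w) q = 0 := by
  have h := mvfderiv_commutator (contMDiffAt_extChartAt' hq)
    ((contMDiffAt_extend_of_mem hq v).mdifferentiableAt (by simp))
    ((contMDiffAt_extend_of_mem hq w).mdifferentiableAt (by simp))
  have hc : ∀ v : TangentSpace 𝓘(ℝ, E) p,
      (fun z => mvfderiv 𝓘(ℝ, E) (extChartAt 𝓘(ℝ, E) p) z (FiberBundle.extend E v z)) =ᶠ[𝓝 q]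
      fun _ => (trivializationAt E (TangentSpace 𝓘(ℝ, E) : M → Type _) p ⟨p, v⟩).2 := by
    intro v
    filter_upwards [(chartAt E p).open_source.mem_nhds hq] with z hz
    exact mvfderiv_extChartAt_trivializationAt_symm hz _
  have h0 : ∀ v : TangentSpace 𝓘(ℝ, E) p, mvfderiv 𝓘(ℝ, E)
      (fun z => mvfderiv 𝓘(ℝ, E) (extChartAt 𝓘(ℝ, E) p) z (FiberBundle.extend E v z)) q = 0 := by
    intro v
    rw [mvfderiv, (hc v).mfderiv_eq]
    exact mvfderiv_const _
  rw [h0, h0] at h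
  rw [← trivializationAt_symm_mvfderiv_extChartAt hq (mlieBracket _ _ _ q), ← h]
  rw [zero_apply, zero_apply, sub_zero, ← Trivialization.coe_symmₗ (R := ℝ) _ hq]
  exact map_zero _

/-- `∑_{cyc} X(dη(Y, Z)) = 0` for vector fields with constant coordinates. -/
theorem cyclic_mvfderiv_dForm {p : M} {η : Π q : M, TangentSpace 𝓘(ℝ, E) q →L[ℝ] ℝ}
    (hη : ContMDiffAt 𝓘(ℝ, E) (𝓘(ℝ, E).prod 𝓘(ℝ, E →L[ℝ] ℝ)) ∞
      (fun y => TotalSpace.mk' (E →L[ℝ] ℝ) y (η y)) p) (x y z : TangentSpace 𝓘(ℝ, E) p) :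
    mvfderiv 𝓘(ℝ, E) (dForm η (FiberBundle.extend E y) (FiberBundle.extend E z)) p x
      + mvfderiv 𝓘(ℝ, E) (dForm η (FiberBundle.extend E z) (FiberBundle.extend E x)) p y
      + mvfderiv 𝓘(ℝ, E) (dForm η (FiberBundle.extend E x) (FiberBundle.extend E y)) p z = 0 := by
  set e : TangentSpace 𝓘(ℝ, E) p → Π q : M, TangentSpace 𝓘(ℝ, E) q :=
    fun v => FiberBundle.extend E v with he
  have hp := mem_chart_source E p
  have hs : ∀ v, ContMDiffAt 𝓘(ℝ, E) 𝓘(ℝ) ∞ (fun q => η q (e v q)) p := fun v => by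
    have := ContMDiffAt.clm_bundle_apply (F₁ := E) (E₁ := (TangentSpace 𝓘(ℝ, E) : M → Type _))
      (F₂ := ℝ) (E₂ := Bundle.Trivial M ℝ) (b := fun q : M => q) hη
      (contMDiffAt_extend_of_mem hp v)
    exact ((Trivialization.contMDiffAt_section_iff (F := ℝ) (E := Bundle.Trivial M ℝ)
      (trivializationAt ℝ (Bundle.Trivial M ℝ) p) (by simp)).1 this)
  have hd : ∀ v w, MDifferentiableAt 𝓘(ℝ, E) 𝓘(ℝ)
      (fun q => mvfderiv 𝓘(ℝ, E) (fun q => η q (e v q)) q (e w q)) p := fun v w =>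
    mdifferentiableAt_mvfderiv_apply (hs v)
      ((contMDiffAt_extend_of_mem hp w).mdifferentiableAt (by simp))
  have key : ∀ v w u : TangentSpace 𝓘(ℝ, E) p, mvfderiv 𝓘(ℝ, E) (dForm η (e v) (e w)) p u
      = 2⁻¹ * (mvfderiv 𝓘(ℝ, E) (fun q => mvfderiv 𝓘(ℝ, E) (fun q => η q (e w q)) q (e v q)) p u
        - mvfderiv 𝓘(ℝ, E) (fun q => mvfderiv 𝓘(ℝ, E) (fun q => η q (e v q)) q (e w q)) p u) := by
    intro v w u
    have h1 : dForm η (e v) (e w) =ᶠ[𝓝 p] (fun _ : M => (2 : ℝ)⁻¹) •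
        ((fun q => mvfderiv 𝓘(ℝ, E) (fun q => η q (e w q)) q (e v q))
          - fun q => mvfderiv 𝓘(ℝ, E) (fun q => η q (e v q)) q (e w q)) := by
      filter_upwards [(chartAt E p).open_source.mem_nhds hp] with q hq
      simp only [dForm, he, mlieBracket_extend hq, map_zero, sub_zero]
      rfl
    rw [mvfderiv, h1.mfderiv_eq]
    change mvfderiv 𝓘(ℝ, E) _ p u = _
    rw [mvfderiv_smul mdifferentiableAt_const ((hd w v).sub (hd v w)),
      mvfderiv_sub (hd w v) (hd v w), mvfderiv_const]
    simp
  have hc : ∀ v w u : TangentSpace 𝓘(ℝ, E) p,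
      mvfderiv 𝓘(ℝ, E) (fun q => mvfderiv 𝓘(ℝ, E) (fun q => η q (e u q)) q (e w q)) p v
      = mvfderiv 𝓘(ℝ, E) (fun q => mvfderiv 𝓘(ℝ, E) (fun q => η q (e u q)) q (e v q)) p w := by
    intro v w u
    have h := mvfderiv_commutator (hs u)
      ((contMDiffAt_extend_of_mem hp v).mdifferentiableAt (by simp))
      ((contMDiffAt_extend_of_mem hp w).mdifferentiableAt (by simp))
    rw [mlieBracket_extend hp, map_zero, FiberBundle.extend_apply_self,
      FiberBundle.extend_apply_self] at h
    exact sub_eq_zero.1 h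
  rw [key, key, key, hc x y z, hc z x y, hc y z x]
  ring

end Coordinates

section ComplexStructure

variable {E : Type*} [NormedAddCommGroup E] [NormedSpace ℂ E]
  {M : Type*} [TopologicalSpace M] [ChartedSpace E M] [IsManifold 𝓘(ℂ, E) ∞ M]

/-- The derivatives of holomorphic charts commute with `J`. -/
theorem mvfderiv_extChartAt_J {p q : M} (hq : q ∈ (chartAt E p).source)
    (w : TangentSpace 𝓘(ℝ, E) q) :
    mvfderiv 𝓘(ℝ, E) (extChartAt 𝓘(ℝ, E) p) q (J q w)
      = Complex.I • mvfderiv 𝓘(ℝ, E) (extChartAt 𝓘(ℝ, E) p) q w := by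
  have : IsManifold 𝓘(ℂ, E) 1 M := .of_le (n := ∞) (by simp)
  have h := (mdifferentiableAt_extChartAt (I := 𝓘(ℂ, E))
    hq).differentiableWithinAt_writtenInExtChartAt
  rw [modelWithCornersSelf_coe, range_id, differentiableWithinAt_univ] at h
  have h2 := h.hasFDerivAt.restrictScalars ℝ
  rw [(mdifferentiableAt_extChartAt hq).mvfderiv, modelWithCornersSelf_coe, range_id,
    fderivWithin_univ]
  have h3 := h2.fderiv
  rw [show writtenInExtChartAt 𝓘(ℝ, E) 𝓘(ℝ, E) q (extChartAt 𝓘(ℝ, E) p)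
    = writtenInExtChartAt 𝓘(ℂ, E) 𝓘(ℂ, E) q (extChartAt 𝓘(ℂ, E) p) from rfl,
    show extChartAt 𝓘(ℝ, E) q q = extChartAt 𝓘(ℂ, E) q q from rfl, h3]
  exact map_smul (fderiv ℂ (writtenInExtChartAt 𝓘(ℂ, E) 𝓘(ℂ, E) q (extChartAt 𝓘(ℂ, E) p))
    (extChartAt 𝓘(ℂ, E) q q)) Complex.I (show E from w)

theorem SmoothAt.J {X : Π z : M, TangentSpace 𝓘(ℝ, E) z} {y : M} (hX : SmoothAt X y) :
    SmoothAt (fun z => J z (X z)) y := by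
  have h := (contMDiffAt_section (F := E) (E := (TangentSpace 𝓘(ℝ, E) : M → Type _))
    (IB := 𝓘(ℝ, E)) y).1 hX
  refine (contMDiffAt_section (F := E) (E := (TangentSpace 𝓘(ℝ, E) : M → Type _))
    (IB := 𝓘(ℝ, E)) y).2 ?_
  have h2 : ContMDiffAt 𝓘(ℝ, E) 𝓘(ℝ, E) ∞ (fun z => Complex.I •
      (trivializationAt E (TangentSpace 𝓘(ℝ, E) : M → Type _) y ⟨z, X z⟩).2) y :=
    ((Complex.I • ContinuousLinearMap.id ℝ E).contMDiff (n := ∞)).contMDiffAt.comp y h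
  refine h2.congr_of_eventuallyEq ?_
  filter_upwards [(chartAt E y).open_source.mem_nhds (mem_chart_source E y)] with z hz
  rw [trivializationAt_snd_eq_mvfderiv hz, trivializationAt_snd_eq_mvfderiv hz,
    mvfderiv_extChartAt_J hz]

theorem SemiRiemannianMetric.DiffAt.J {X : Π z : M, TangentSpace 𝓘(ℝ, E) z} {y : M}
    (hX : SemiRiemannianMetric.DiffAt X y) :
    SemiRiemannianMetric.DiffAt (fun z => J z (X z)) y := by
  have h := (mdifferentiableAt_section (F := E) (E := (TangentSpace 𝓘(ℝ, E) : M → Type _))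
    (IB := 𝓘(ℝ, E)) _).1 hX
  refine (mdifferentiableAt_section (F := E) (E := (TangentSpace 𝓘(ℝ, E) : M → Type _))
    (IB := 𝓘(ℝ, E)) _).2 ?_
  have h2 : MDifferentiableAt 𝓘(ℝ, E) 𝓘(ℝ, E) (fun z => Complex.I •
      (trivializationAt E (TangentSpace 𝓘(ℝ, E) : M → Type _) y ⟨z, X z⟩).2) y :=
    ((Complex.I • ContinuousLinearMap.id ℝ E).mdifferentiableAt).comp y h
  refine h2.congr_of_eventuallyEq ?_
  filter_upwards [(chartAt E y).open_source.mem_nhds (mem_chart_source E y)] with z hz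
  rw [trivializationAt_snd_eq_mvfderiv hz, trivializationAt_snd_eq_mvfderiv hz,
    mvfderiv_extChartAt_J hz]

end ComplexStructure

/-! ### Differentiable tensor fields and covariant derivatives -/

section Ambient

open SemiRiemannianMetric

variable {E : Type*} [NormedAddCommGroup E] [NormedSpace ℂ E]
  {M : Type*} [TopologicalSpace M] [ChartedSpace E M]
  {X Y Z : Π z : M, TangentSpace 𝓘(ℝ, E) z} {y : M} {f : M → ℝ}

/-- The smoothness of a function follows from that of the corresponding section of the trivial line
bundle, which is what the lemmas on bundle maps provide. -/
theorem contMDiffAt_trivial {φ : M → ℝ}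
    (h : ContMDiffAt 𝓘(ℝ, E) (𝓘(ℝ, E).prod 𝓘(ℝ)) ∞
      (fun z => TotalSpace.mk' ℝ (E := Bundle.Trivial M ℝ) z (φ z)) y) :
    ContMDiffAt 𝓘(ℝ, E) 𝓘(ℝ) ∞ φ y :=
  (Trivialization.contMDiffAt_section_iff (F := ℝ) (E := Bundle.Trivial M ℝ)
      (trivializationAt ℝ (Bundle.Trivial M ℝ) y) (by simp)).1 h

/-- The counterpart of `contMDiffAt_trivial` for differentiability. -/
theorem mdifferentiableAt_trivial {φ : M → ℝ}
    (h : MDifferentiableAt 𝓘(ℝ, E) (𝓘(ℝ, E).prod 𝓘(ℝ))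
      (fun z => TotalSpace.mk' ℝ (E := Bundle.Trivial M ℝ) z (φ z)) y) :
    MDifferentiableAt 𝓘(ℝ, E) 𝓘(ℝ) φ y :=
  (mdifferentiableAt_section (F := ℝ) (E := Bundle.Trivial M ℝ) (IB := 𝓘(ℝ, E)) _).1 h

variable [IsManifold 𝓘(ℂ, E) ∞ M]

theorem SmoothAt.diffAt (hX : SmoothAt X y) : DiffAt X y :=
  ContMDiffAt.mdifferentiableAt hX (by simp)

theorem smoothAt_extend {p q : M} (hq : q ∈ (chartAt E p).source) (v : TangentSpace 𝓘(ℝ, E) p) :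
    SmoothAt (FiberBundle.extend E v) q :=
  contMDiffAt_extend_of_mem hq v

theorem smoothAt_extend_self (v : TangentSpace 𝓘(ℝ, E) y) : SmoothAt (FiberBundle.extend E v) y :=
  smoothAt_extend (mem_chart_source E y) v

theorem diffAt_extend (v : TangentSpace 𝓘(ℝ, E) y) : DiffAt (FiberBundle.extend E v) y :=
  (smoothAt_extend_self v).diffAt

theorem SemiRiemannianMetric.DiffAt.add (hX : DiffAt X y) (hY : DiffAt Y y) : DiffAt (X + Y) y :=
  mdifferentiableAt_add_section hX hY

theorem SemiRiemannianMetric.DiffAt.neg (hX : DiffAt X y) : DiffAt (-X) y :=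
  mdifferentiableAt_neg_section hX

theorem SemiRiemannianMetric.DiffAt.smul (hf : MDifferentiableAt 𝓘(ℝ, E) 𝓘(ℝ) f y)
    (hX : DiffAt X y) : DiffAt (f • X) y :=
  hf.smul_section hX

theorem SmoothAt.sub (hX : SmoothAt X y) (hY : SmoothAt Y y) : SmoothAt (X - Y) y :=
  ContMDiffAt.sub_section hX hY

theorem SmoothAt.neg (hX : SmoothAt X y) : SmoothAt (-X) y :=
  ContMDiffAt.neg_section hX

theorem SmoothAt.smul (hf : ContMDiffAt 𝓘(ℝ, E) 𝓘(ℝ) ∞ f y) (hX : SmoothAt X y) :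
    SmoothAt (f • X) y :=
  ContMDiffAt.smul_section hf hX

theorem SemiRiemannianMetric.DiffAt.congr (hX : DiffAt X y) (h : ∀ᶠ z in 𝓝 y, Y z = X z) :
    DiffAt Y y :=
  MDifferentiableAt.congr_of_eventuallyEq hX (h.mono fun z hz => by simp only [hz])

theorem SemiRiemannianMetric.DiffAt.clm_apply
    {A : Π z : M, TangentSpace 𝓘(ℝ, E) z →L[ℝ] TangentSpace 𝓘(ℝ, E) z}
    (hA : ContMDiffAt 𝓘(ℝ, E) (𝓘(ℝ, E).prod 𝓘(ℝ, E →L[ℝ] E)) ∞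
      (fun z => TotalSpace.mk' (E →L[ℝ] E) z (A z)) y) (hX : DiffAt X y) :
    DiffAt (fun z => A z (X z)) y :=
  MDifferentiableAt.clm_bundle_apply (F₁ := E) (E₁ := (TangentSpace 𝓘(ℝ, E) : M → Type _))
      (F₂ := E) (E₂ := (TangentSpace 𝓘(ℝ, E) : M → Type _)) (b := fun z : M => z)
      (hA.mdifferentiableAt (by simp)) hX

theorem SemiRiemannianMetric.DiffAt.form_apply {η : Π z : M, TangentSpace 𝓘(ℝ, E) z →L[ℝ] ℝ}
    (hη : ContMDiffAt 𝓘(ℝ, E) (𝓘(ℝ, E).prod 𝓘(ℝ, E →L[ℝ] ℝ)) ∞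
      (fun z => TotalSpace.mk' (E →L[ℝ] ℝ) z (η z)) y) (hX : DiffAt X y) :
    MDifferentiableAt 𝓘(ℝ, E) 𝓘(ℝ) (fun z => η z (X z)) y :=
  mdifferentiableAt_trivial <| MDifferentiableAt.clm_bundle_apply (F₁ := E)
      (E₁ := (TangentSpace 𝓘(ℝ, E) : M → Type _))
      (F₂ := ℝ) (E₂ := Bundle.Trivial M ℝ) (b := fun z : M => z)
      (hη.mdifferentiableAt (by simp)) hX

namespace SemiRiemannianMetric

variable (g : SemiRiemannianMetric E M)

theorem contMDiffAt_inner (hX : SmoothAt X y) :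
    ContMDiffAt 𝓘(ℝ, E) (𝓘(ℝ, E).prod 𝓘(ℝ, E →L[ℝ] ℝ)) ∞
      (fun z => TotalSpace.mk' (E →L[ℝ] ℝ) z (g.inner z (X z))) y :=
  ContMDiffAt.clm_bundle_apply (F₁ := E) (E₁ := (TangentSpace 𝓘(ℝ, E) : M → Type _))
    (F₂ := E →L[ℝ] ℝ) (E₂ := fun z : M => TangentSpace 𝓘(ℝ, E) z →L[ℝ] ℝ)
    (b := fun z : M => z) (g.contMDiff y) hX

theorem contMDiffAt_inner_apply (hX : SmoothAt X y) (hY : SmoothAt Y y) :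
    ContMDiffAt 𝓘(ℝ, E) 𝓘(ℝ) ∞ (fun z => g.inner z (X z) (Y z)) y :=
  contMDiffAt_trivial <| ContMDiffAt.clm_bundle_apply₂ (F₁ := E)
    (E₁ := (TangentSpace 𝓘(ℝ, E) : M → Type _))
    (F₂ := E) (E₂ := (TangentSpace 𝓘(ℝ, E) : M → Type _)) (F₃ := ℝ) (E₃ := Bundle.Trivial M ℝ)
    (b := fun z : M => z) (g.contMDiff y) hX hY

theorem mdifferentiableAt_inner_apply (hX : DiffAt X y) (hY : DiffAt Y y) :
    MDifferentiableAt 𝓘(ℝ, E) 𝓘(ℝ) (fun z => g.inner z (X z) (Y z)) y :=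
  mdifferentiableAt_trivial <| MDifferentiableAt.clm_bundle_apply₂ (F₁ := E)
    (E₁ := (TangentSpace 𝓘(ℝ, E) : M → Type _))
    (F₂ := E) (E₂ := (TangentSpace 𝓘(ℝ, E) : M → Type _)) (F₃ := ℝ) (E₃ := Bundle.Trivial M ℝ)
    (b := fun z : M => z) ((g.contMDiff y).mdifferentiableAt (by simp)) hX hY

end SemiRiemannianMetric

section Connection

variable (D : CovariantDerivative 𝓘(ℝ, E) E (TangentSpace 𝓘(ℝ, E) : M → Type _))

theorem cov_add (hX : DiffAt X y) (hY : DiffAt Y y) : D (X + Y) y = D X y + D Y y :=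
  D.isCovariantDerivativeOnUniv.add hX hY

theorem cov_smul (hf : MDifferentiableAt 𝓘(ℝ, E) 𝓘(ℝ) f y) (hX : DiffAt X y)
    (x : TangentSpace 𝓘(ℝ, E) y) :
    D (f • X) y x = f y • D X y x + mvfderiv 𝓘(ℝ, E) f y x • X y := by
  rw [D.isCovariantDerivativeOnUniv.leibniz hX hf]
  rfl

theorem cov_smul_const (c : ℝ) (hX : DiffAt X y) : D (c • X) y = c • D X y :=
  D.isCovariantDerivativeOnUniv.smul_const c hX

theorem cov_neg (hX : DiffAt X y) : D (-X) y = -D X y := by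
  have h := cov_smul_const D (-1) hX
  rwa [neg_one_smul, neg_one_smul] at h

/-- A covariant derivative is a local operator. -/
theorem cov_congr (hX : DiffAt X y) (h : ∀ᶠ z in 𝓝 y, Y z = X z) : D Y y = D X y :=
  D.isCovariantDerivativeOnUniv.congr_of_eventuallyEq (hX.congr h) hX
    Filter.univ_mem h

/-- The covariant derivative `(∇_x A) w` of a (1,1)-tensor field `A` at `y`, computed with the
local extension of `w` that is constant in the preferred chart at `y`. -/
def covEnd (A : Π z : M, TangentSpace 𝓘(ℝ, E) z →L[ℝ] TangentSpace 𝓘(ℝ, E) z) (y : M)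
    (x w : TangentSpace 𝓘(ℝ, E) y) : TangentSpace 𝓘(ℝ, E) y :=
  D (fun z => A z (FiberBundle.extend E w z)) y x - A y (D (FiberBundle.extend E w) y x)

/-- The Leibniz rule `∇_x (AX) = (∇_x A) X + A (∇_x X)`.  Since `∇_x (AX) - A (∇_x X)` is tensorial
in `X`, the extension chosen in the definition of `covEnd` does not matter. -/
theorem covEnd_apply [FiniteDimensional ℂ E]
    {A : Π z : M, TangentSpace 𝓘(ℝ, E) z →L[ℝ] TangentSpace 𝓘(ℝ, E) z}
    (hA : ∀ X, DiffAt X y → DiffAt (fun z => A z (X z)) y) (hX : DiffAt X y)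
    (x : TangentSpace 𝓘(ℝ, E) y) :
    D (fun z => A z (X z)) y x = covEnd D A y x (X y) + A y (D X y x) := by
  have : IsManifold 𝓘(ℝ, E) 2 M := .of_le (n := ∞) ENat.LEInfty.out
  have hT : TensorialAt 𝓘(ℝ, E) E (fun X : Π z : M, TangentSpace 𝓘(ℝ, E) z =>
      D (fun z => A z (X z)) y x - A y (D X y x)) y := by
    refine ⟨fun {f X} hf hX => ?_, fun {X Y} hX hY => ?_⟩
    · have h1 : (fun z => A z ((f • X) z)) = f • fun z => A z (X z) :=
        funext fun z => map_smul (A z) (f z) (X z)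
      rw [h1, cov_smul D hf (hA X hX), cov_smul D hf hX, map_add, map_smul, map_smul, smul_sub]
      abel
    · have h1 : (fun z => A z ((X + Y) z)) = (fun z => A z (X z)) + fun z => A z (Y z) :=
        funext fun z => map_add (A z) (X z) (Y z)
      rw [h1, cov_add D (hA X hX) (hA Y hY), cov_add D hX hY, add_apply, add_apply, map_add]
      abel
  have h := hT.pointwise hX (diffAt_extend (X y)) (FiberBundle.extend_apply_self E (X y)).symm
  rw [← sub_eq_iff_eq_add]
  exact h

end Connection
end Ambient

/-! ### The structure equations near a point -/

section Germ

open SemiRiemannianMetric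

variable {E : Type*} [NormedAddCommGroup E] [NormedSpace ℂ E]
  {M : Type*} [TopologicalSpace M] [ChartedSpace E M] [IsManifold 𝓘(ℂ, E) ∞ M]
  {X Y Z : Π z : M, TangentSpace 𝓘(ℝ, E) z} {y : M}
  {g : SemiRiemannianMetric E M}
  {D : CovariantDerivative 𝓘(ℝ, E) E (TangentSpace 𝓘(ℝ, E) : M → Type _)}

/-- The Christoffel symbols of a torsion-free connection are symmetric. -/
theorem cov_extend_symm [FiniteDimensional ℂ E] (hD : g.IsLeviCivita D)
    (v w : TangentSpace 𝓘(ℝ, E) y) :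
    D (FiberBundle.extend E w) y v = D (FiberBundle.extend E v) y w := by
  have h := hD.torsion_free _ _ y (diffAt_extend v) (diffAt_extend w)
  rw [mlieBracket_extend (mem_chart_source E y), FiberBundle.extend_apply_self,
    FiberBundle.extend_apply_self] at h
  exact sub_eq_zero.1 h

/-- The Nijenhuis tensor of `A` in terms of `∇A`, for the torsion-free connection `∇`. -/
theorem nijenhuis_eq [FiniteDimensional ℂ E] (hD : g.IsLeviCivita D)
    {A : Π z : M, TangentSpace 𝓘(ℝ, E) z →L[ℝ] TangentSpace 𝓘(ℝ, E) z}
    (hA : ∀ X, DiffAt X y → DiffAt (fun z => A z (X z)) y) (hX : DiffAt X y) (hY : DiffAt Y y) :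
    nijenhuis A X Y y = covEnd D A y (A y (X y)) (Y y) - covEnd D A y (A y (Y y)) (X y)
      + A y (covEnd D A y (Y y) (X y)) - A y (covEnd D A y (X y) (Y y)) := by
  rw [nijenhuis, ← hD.torsion_free _ _ y hX hY, ← hD.torsion_free _ _ y (hA X hX) (hA Y hY),
    ← hD.torsion_free _ _ y (hA X hX) hY, ← hD.torsion_free _ _ y hX (hA Y hY),
    covEnd_apply D hA hX, covEnd_apply D hA hX, covEnd_apply D hA hY, covEnd_apply D hA hY]
  simp only [map_sub, map_add]
  abel

/-- The exterior derivative of the 1-form dual to `Z` is the skew part of `∇Z`. -/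
theorem dForm_inner (hD : g.IsLeviCivita D) (hZ : DiffAt Z y) (hX : DiffAt X y)
    (hY : DiffAt Y y) :
    2 * dForm (fun z => g.inner z (Z z)) X Y y
      = g.inner y (D Z y (X y)) (Y y) - g.inner y (D Z y (Y y)) (X y) := by
  rw [dForm, hD.metric _ _ y _ hZ hY, hD.metric _ _ y _ hZ hX, ← hD.torsion_free X Y y hX hY,
    map_sub]
  ring

variable (g) in
/-- The local tensors of a normal complex contact metric structure near the point `y`, in the
form that is preserved when `(U, V, G, H)` is replaced by `(V, -U, H, -G)`. -/
structure ContactGerm (U V : Π z : M, TangentSpace 𝓘(ℝ, E) z)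
    (G H : Π z : M, TangentSpace 𝓘(ℝ, E) z →L[ℝ] TangentSpace 𝓘(ℝ, E) z)
    (σ : Π z : M, TangentSpace 𝓘(ℝ, E) z →L[ℝ] ℝ) (y : M) : Prop where
  smooth_U : SmoothAt U y
  smooth_V : SmoothAt V y
  diff_G : ∀ X, DiffAt X y → DiffAt (fun z => G z (X z)) y
  diff_σ : ∀ X, DiffAt X y → MDifferentiableAt 𝓘(ℝ, E) 𝓘(ℝ) (fun z => σ z (X z)) y
  G_sq : ∀ᶠ z in 𝓝 y, ∀ x, G z (G z x) = -x + g.inner z (U z) x • U z + g.inner z (V z) x • V z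
  HG : ∀ᶠ z in 𝓝 y, ∀ x, H z (G z x) = -G z (H z x)
  G_skew : ∀ᶠ z in 𝓝 y, ∀ x w, g.inner z (G z x) w = -g.inner z x (G z w)
  H_skew : ∀ᶠ z in 𝓝 y, ∀ x w, g.inner z (H z x) w = -g.inner z x (H z w)
  G_U : ∀ᶠ z in 𝓝 y, G z (U z) = 0
  G_V : ∀ᶠ z in 𝓝 y, G z (V z) = 0
  H_U : ∀ᶠ z in 𝓝 y, H z (U z) = 0
  H_V : ∀ᶠ z in 𝓝 y, H z (V z) = 0
  U_U : ∀ᶠ z in 𝓝 y, g.inner z (U z) (U z) = 1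
  V_V : ∀ᶠ z in 𝓝 y, g.inner z (V z) (V z) = 1
  U_V : ∀ᶠ z in 𝓝 y, g.inner z (U z) (V z) = 0
  dU : ∀ᶠ z in 𝓝 y, ∀ X Y, SmoothAt X z → SmoothAt Y z →
    2 * dForm (fun z => g.inner z (U z)) X Y z = 2 * g.inner z (X z) (G z (Y z))
      + (σ z (X z) * g.inner z (V z) (Y z) - σ z (Y z) * g.inner z (V z) (X z))
  dV : ∀ X Y, SmoothAt X y → SmoothAt Y y →
    2 * dForm (fun z => g.inner z (V z)) X Y y = 2 * g.inner y (X y) (H y (Y y))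
      - (σ y (X y) * g.inner y (U y) (Y y) - σ y (Y y) * g.inner y (U y) (X y))
  S_horizontal : ∀ X Y, SmoothAt X y → SmoothAt Y y →
    (∀ᶠ z in 𝓝 y, g.inner z (U z) (X z) = 0 ∧ g.inner z (V z) (X z) = 0) →
    (∀ᶠ z in 𝓝 y, g.inner z (U z) (Y z) = 0 ∧ g.inner z (V z) (Y z) = 0) →
    nijenhuis G X Y y
      + (2 * g.inner y (X y) (G y (Y y))) • U y - (2 * g.inner y (X y) (H y (Y y))) • V y
      + σ y (G y (Y y)) • H y (X y) - σ y (G y (X y)) • H y (Y y)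
      + σ y (X y) • G y (H y (Y y)) - σ y (Y y) • G y (H y (X y)) = 0
  S_U : ∀ X, SmoothAt X y → nijenhuis G U X y
      + (2 * g.inner y (U y) (G y (X y))) • U y - (2 * g.inner y (U y) (H y (X y))) • V y
      + (2 : ℝ) • (g.inner y (V y) (X y) • H y (U y) - g.inner y (V y) (U y) • H y (X y))
      + σ y (G y (X y)) • H y (U y) - σ y (G y (U y)) • H y (X y)
      + σ y (U y) • G y (H y (X y)) - σ y (X y) • G y (H y (U y)) = 0

namespace ContactGerm

variable {U V : Π z : M, TangentSpace 𝓘(ℝ, E) z}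
  {G H : Π z : M, TangentSpace 𝓘(ℝ, E) z →L[ℝ] TangentSpace 𝓘(ℝ, E) z}
  {σ : Π z : M, TangentSpace 𝓘(ℝ, E) z →L[ℝ] ℝ}

/-- A horizontal vector extends to a smooth horizontal vector field. -/
theorem exists_horizontal_extension (c : ContactGerm g U V G H σ y) {x : TangentSpace 𝓘(ℝ, E) y}
    (hU : g.inner y (U y) x = 0) (hV : g.inner y (V y) x = 0) :
    ∃ X : Π z : M, TangentSpace 𝓘(ℝ, E) z, SmoothAt X y ∧ X y = x ∧
      ∀ᶠ z in 𝓝 y, g.inner z (U z) (X z) = 0 ∧ g.inner z (V z) (X z) = 0 := by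
  set e : Π z : M, TangentSpace 𝓘(ℝ, E) z := FiberBundle.extend E x with he
  have hs : SmoothAt e y := smoothAt_extend_self x
  have hey : e y = x := FiberBundle.extend_apply_self E x
  refine ⟨e - (fun z => g.inner z (U z) (e z)) • U - (fun z => g.inner z (V z) (e z)) • V,
    (hs.sub (SmoothAt.smul (g.contMDiffAt_inner_apply c.smooth_U hs) c.smooth_U)).sub
      (SmoothAt.smul (g.contMDiffAt_inner_apply c.smooth_V hs) c.smooth_V), ?_, ?_⟩
  · simp [hey, hU, hV]
  · filter_upwards [c.U_U, c.V_V, c.U_V] with z h1 h2 h3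
    have h4 : g.inner z (V z) (U z) = 0 := by rw [g.symm, h3]
    simp [h1, h2, h3, h4]

/-- The covariant derivative of a skew-adjoint tensor field is skew-adjoint. -/
theorem covEnd_skew {A : Π z : M, TangentSpace 𝓘(ℝ, E) z →L[ℝ] TangentSpace 𝓘(ℝ, E) z}
    [FiniteDimensional ℂ E] (hD : g.IsLeviCivita D)
    (hA : ∀ X, DiffAt X y → DiffAt (fun z => A z (X z)) y)
    (hskew : ∀ᶠ z in 𝓝 y, ∀ x w, g.inner z (A z x) w = -g.inner z x (A z w))
    (x v w : TangentSpace 𝓘(ℝ, E) y) :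
    g.inner y (covEnd D A y x v) w = -g.inner y v (covEnd D A y x w) := by
  have h : (fun z => g.inner z (A z (FiberBundle.extend E v z)) (FiberBundle.extend E w z))
      =ᶠ[𝓝 y] -fun z => g.inner z (FiberBundle.extend E v z) (A z (FiberBundle.extend E w z)) := by
    filter_upwards [hskew] with z hz
    exact hz _ _
  have h1 := hD.metric _ _ y x (hA _ (diffAt_extend v)) (diffAt_extend w)
  have h3 := hD.metric _ _ y x (diffAt_extend v) (hA _ (diffAt_extend w))
  have h4 : mvfderiv 𝓘(ℝ, E) (fun z => g.inner z (A z (FiberBundle.extend E v z))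
      (FiberBundle.extend E w z)) y x = -mvfderiv 𝓘(ℝ, E) (fun z => g.inner z
      (FiberBundle.extend E v z) (A z (FiberBundle.extend E w z))) y x := by
    rw [mvfderiv_congr h, mvfderiv_neg]
    rfl
  rw [h1, h3, covEnd_apply D hA (diffAt_extend v), covEnd_apply D hA (diffAt_extend w)] at h4
  simp only [FiberBundle.extend_apply_self, map_add, add_apply] at h4
  have h5 := hskew.self_of_nhds
  rw [h5, ← neg_eq_iff_eq_neg.2 (h5 v (D (FiberBundle.extend E w) y x))] at h4
  linarith

/-- The derivative of `g(X, Y) = const`. -/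
theorem inner_cov_eq (hD : g.IsLeviCivita D) (hX : DiffAt X y) (hY : DiffAt Y y) {k : ℝ}
    (h : ∀ᶠ z in 𝓝 y, g.inner z (X z) (Y z) = k) (x : TangentSpace 𝓘(ℝ, E) y) :
    g.inner y (D X y x) (Y y) + g.inner y (X y) (D Y y x) = 0 := by
  rw [← hD.metric X Y y x hX hY]
  have h' : (fun z => g.inner z (X z) (Y z)) =ᶠ[𝓝 y] fun _ => k := h
  rw [mvfderiv_congr h', mvfderiv_const]
  rfl

/-- The derivative of `AX = 0`. -/
theorem cov_kernel {A : Π z : M, TangentSpace 𝓘(ℝ, E) z →L[ℝ] TangentSpace 𝓘(ℝ, E) z}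
    [FiniteDimensional ℂ E]
    (hA : ∀ X, DiffAt X y → DiffAt (fun z => A z (X z)) y) (hX : DiffAt X y)
    (h : ∀ᶠ z in 𝓝 y, A z (X z) = 0) (x : TangentSpace 𝓘(ℝ, E) y) :
    covEnd D A y x (X y) = -A y (D X y x) := by
  have h1 := covEnd_apply D hA hX x
  have h2 : D (fun z => A z (X z)) y = D 0 y :=
    cov_congr D (mdifferentiableAt_zeroSection ..) h
  rw [h2, D.isCovariantDerivativeOnUniv.zero] at h1
  exact eq_neg_of_add_eq_zero_left h1.symm

/-- The derivative of `G² = -1 + u ⊗ U + v ⊗ V`. -/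
theorem covEnd_G [FiniteDimensional ℂ E] (hD : g.IsLeviCivita D) (c : ContactGerm g U V G H σ y)
    (x w : TangentSpace 𝓘(ℝ, E) y) :
    covEnd D G y x (G y w) + G y (covEnd D G y x w)
      = (g.inner y (D U y x) w • U y + g.inner y (U y) w • D U y x)
        + (g.inner y (D V y x) w • V y + g.inner y (V y) w • D V y x) := by
  set e : Π z : M, TangentSpace 𝓘(ℝ, E) z := FiberBundle.extend E w with he
  have hey : e y = w := FiberBundle.extend_apply_self E w
  have hd : DiffAt e y := diffAt_extend w
  have hU := c.smooth_U.diffAt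
  have hV := c.smooth_V.diffAt
  have h1 : D (fun z => G z (G z (e z))) y = D (-e + (fun z => g.inner z (U z) (e z)) • U
      + (fun z => g.inner z (V z) (e z)) • V) y := by
    refine cov_congr D ((hd.neg.add (DiffAt.smul (g.mdifferentiableAt_inner_apply hU hd) hU)).add
      (DiffAt.smul (g.mdifferentiableAt_inner_apply hV hd) hV)) ?_
    filter_upwards [c.G_sq] with z hz
    exact hz _
  have h2 := congrArg (fun L => L x) h1
  rw [covEnd_apply D c.diff_G (c.diff_G _ hd), covEnd_apply D c.diff_G hd,
    cov_add D (hd.neg.add (DiffAt.smul (g.mdifferentiableAt_inner_apply hU hd) hU))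
      (DiffAt.smul (g.mdifferentiableAt_inner_apply hV hd) hV),
    cov_add D hd.neg (DiffAt.smul (g.mdifferentiableAt_inner_apply hU hd) hU), cov_neg D hd,
    add_apply, add_apply, cov_smul D (g.mdifferentiableAt_inner_apply hU hd) hU,
    cov_smul D (g.mdifferentiableAt_inner_apply hV hd) hV, hD.metric _ _ y x hU hd,
    hD.metric _ _ y x hV hd, map_add, c.G_sq.self_of_nhds, hey] at h2
  rw [← sub_eq_zero] at h2 ⊢
  rw [← h2, show (-D e y) x = -D e y x from rfl]
  module

/-- The identity `d(du) = 0`, in terms of the covariant derivatives of `G` and `V`.  Inserting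
`du(a, b) = g(a, Gb) + (σ ∧ v)(a, b)` for vector fields with constant coordinates, all terms with
Christoffel symbols cancel in the cyclic sum because these symbols are symmetric.  The derivatives
of `σ` are multiplied by values of `v`, which vanish by assumption. -/
theorem cyclic_covEnd [FiniteDimensional ℂ E] (hD : g.IsLeviCivita D)
    (c : ContactGerm g U V G H σ y) (x v w : TangentSpace 𝓘(ℝ, E) y)
    (hx : g.inner y (V y) x = 0) (hv : g.inner y (V y) v = 0) (hw : g.inner y (V y) w = 0) :
    2 * (g.inner y v (covEnd D G y x w) + g.inner y w (covEnd D G y v x)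
        + g.inner y x (covEnd D G y w v))
      = σ y x * (g.inner y (D V y v) w - g.inner y (D V y w) v)
        + σ y v * (g.inner y (D V y w) x - g.inner y (D V y x) w)
        + σ y w * (g.inner y (D V y x) v - g.inner y (D V y v) x) := by
  have hV := c.smooth_V.diffAt
  have key : ∀ x v w : TangentSpace 𝓘(ℝ, E) y, g.inner y (V y) v = 0 → g.inner y (V y) w = 0 →
      2 * mvfderiv 𝓘(ℝ, E) (dForm (fun z => g.inner z (U z)) (FiberBundle.extend E v)
        (FiberBundle.extend E w)) y x
      = 2 * (g.inner y (D (FiberBundle.extend E v) y x) (G y w)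
          + g.inner y v (covEnd D G y x w + G y (D (FiberBundle.extend E w) y x)))
        + (σ y v * (g.inner y (D V y x) w + g.inner y (V y) (D (FiberBundle.extend E w) y x))
          - σ y w * (g.inner y (D V y x) v
            + g.inner y (V y) (D (FiberBundle.extend E v) y x))) := by
    intro x v w hv hw
    set a : Π z : M, TangentSpace 𝓘(ℝ, E) z := FiberBundle.extend E v with ha
    set b : Π z : M, TangentSpace 𝓘(ℝ, E) z := FiberBundle.extend E w with hb
    have hda : DiffAt a y := diffAt_extend v
    have hdb : DiffAt b y := diffAt_extend w
    have hay : a y = v := FiberBundle.extend_apply_self E v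
    have hby : b y = w := FiberBundle.extend_apply_self E w
    have h1 : dForm (fun z => g.inner z (U z)) a b =ᶠ[𝓝 y]
        (fun z => g.inner z (a z) (G z (b z))) + (fun _ : M => (2 : ℝ)⁻¹) •
          ((fun z => σ z (a z)) * (fun z => g.inner z (V z) (b z))
            - (fun z => σ z (b z)) * (fun z => g.inner z (V z) (a z))) := by
      filter_upwards [c.dU, (chartAt E y).open_source.mem_nhds (mem_chart_source E y)]
        with z hz hzy
      have h2 := hz a b (smoothAt_extend hzy v) (smoothAt_extend hzy w)
      simp only [Pi.add_apply, Pi.sub_apply, Pi.mul_apply, smul_eq_mul]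
      linarith
    have m1 := g.mdifferentiableAt_inner_apply hda (c.diff_G _ hdb)
    have m2 := c.diff_σ _ hda
    have m3 := c.diff_σ _ hdb
    have m4 := g.mdifferentiableAt_inner_apply hV hda
    have m5 := g.mdifferentiableAt_inner_apply hV hdb
    rw [mvfderiv_congr h1, mvfderiv_add m1 (mdifferentiableAt_const.smul ((m2.mul m5).sub
      (m3.mul m4))), mvfderiv_smul mdifferentiableAt_const ((m2.mul m5).sub (m3.mul m4)),
      mvfderiv_sub (m2.mul m5) (m3.mul m4), mvfderiv_mul m2 m5, mvfderiv_mul m3 m4, mvfderiv_const]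
    simp only [add_apply, sub_apply, smul_apply, ContinuousLinearMap.smulRight_apply,
      hD.metric _ _ y x hV hda, hD.metric _ _ y x hV hdb, hD.metric _ _ y x hda (c.diff_G _ hdb),
      covEnd_apply D c.diff_G hdb, hay, hby, hv, hw, smul_eq_mul, zero_apply]
    ring
  have h := cyclic_mvfderiv_dForm (g.contMDiffAt_inner c.smooth_U) x v w
  have h1 := key x v w hv hw
  have h2 := key v w x hw hx
  have h3 := key w x v hx hv
  rw [cov_extend_symm hD x w] at h1
  rw [cov_extend_symm hD v x] at h2
  rw [cov_extend_symm hD w v] at h3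
  have hG : ∀ a b, g.inner y a (G y b) = -g.inner y b (G y a) := fun a b => by
    rw [g.symm, c.G_skew.self_of_nhds]
  rw [map_add, hG v] at h1
  rw [map_add, hG w] at h2
  rw [map_add, hG x] at h3
  linarith

/-- The values at `y` of the local tensors and of their covariant derivatives satisfy the structure
equations of `ContactJet`. -/
theorem jet [FiniteDimensional ℂ E] (hD : g.IsLeviCivita D) (c : ContactGerm g U V G H σ y) :
    ContactJet (g.bilin y) (G y).toLinearMap (H y).toLinearMap (U y) (V y) (σ y).toLinearMap
      (covEnd D G y) (D U y).toLinearMap (D V y).toLinearMap where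
  symm := g.symm y
  nondegenerate := g.nondegenerate y
  G_sq := c.G_sq.self_of_nhds
  HG := c.HG.self_of_nhds
  G_skew := c.G_skew.self_of_nhds
  H_skew := c.H_skew.self_of_nhds
  G_U := c.G_U.self_of_nhds
  G_V := c.G_V.self_of_nhds
  H_U := c.H_U.self_of_nhds
  H_V := c.H_V.self_of_nhds
  U_U := c.U_U.self_of_nhds
  V_V := c.V_V.self_of_nhds
  U_V := c.U_V.self_of_nhds
  A_U x := by
    have h := inner_cov_eq hD c.smooth_U.diffAt c.smooth_U.diffAt c.U_U x
    rw [g.symm y (U y)] at h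
    change g.inner y (D U y x) (U y) = 0
    linarith
  A_V := inner_cov_eq hD c.smooth_U.diffAt c.smooth_V.diffAt c.U_V
  P_zero w := by rw [covEnd, map_zero, map_zero, map_zero, sub_zero]
  P_skew := covEnd_skew hD c.diff_G c.G_skew
  P_G := covEnd_G hD c
  P_U := cov_kernel c.diff_G c.smooth_U.diffAt c.G_U
  P_V := cov_kernel c.diff_G c.smooth_V.diffAt c.G_V
  dU v w := by
    have h := dForm_inner hD c.smooth_U.diffAt (diffAt_extend v) (diffAt_extend w)
    rw [c.dU.self_of_nhds _ _ (smoothAt_extend_self v) (smoothAt_extend_self w)] at h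
    simp only [FiberBundle.extend_apply_self] at h
    exact h.symm
  dV v w := by
    have h := dForm_inner hD c.smooth_V.diffAt (diffAt_extend v) (diffAt_extend w)
    rw [c.dV _ _ (smoothAt_extend_self v) (smoothAt_extend_self w)] at h
    simp only [FiberBundle.extend_apply_self] at h
    exact h.symm
  cyclic x v w := cyclic_covEnd hD c x v w
  S_horizontal x w hUx hVx hUw hVw := by
    obtain ⟨X, hX, rfl, hX0⟩ := c.exists_horizontal_extension hUx hVx
    obtain ⟨Y, hY, rfl, hY0⟩ := c.exists_horizontal_extension hUw hVw
    have h := c.S_horizontal X Y hX hY hX0 hY0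
    rw [nijenhuis_eq hD c.diff_G hX.diffAt hY.diffAt] at h
    exact h
  S_U x := by
    have hX : SmoothAt (FiberBundle.extend E x) y := smoothAt_extend_self x
    have h := c.S_U _ hX
    rw [nijenhuis_eq hD c.diff_G c.smooth_U.diffAt hX.diffAt] at h
    simp only [FiberBundle.extend_apply_self] at h
    exact h

end ContactGerm
end Germ

/-! ### Normal complex contact metric structures -/

section Structure

open SemiRiemannianMetric

variable {E : Type*} [NormedAddCommGroup E] [NormedSpace ℂ E]
  {M : Type*} [TopologicalSpace M] [ChartedSpace E M] {y : M}

theorem J_J (x : TangentSpace 𝓘(ℝ, E) y) : J y (J y x) = -x := by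
  change Complex.I • Complex.I • (show E from x) = -(show E from x)
  rw [smul_smul, Complex.I_mul_I, neg_one_smul]

theorem dForm_congr {η η' : Π z : M, TangentSpace 𝓘(ℝ, E) z →L[ℝ] ℝ}
    (h : ∀ᶠ z in 𝓝 y, η z = η' z) (X Y : Π z : M, TangentSpace 𝓘(ℝ, E) z) :
    dForm η X Y y = dForm η' X Y y := by
  have h1 : ∀ X : Π z : M, TangentSpace 𝓘(ℝ, E) z,
      mvfderiv 𝓘(ℝ, E) (fun z => η z (X z)) y = mvfderiv 𝓘(ℝ, E) (fun z => η' z (X z)) y :=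
    fun X => mvfderiv_congr (h.mono fun z hz => by simp only [hz])
  rw [dForm, dForm, h1, h1, h.self_of_nhds]

theorem dForm_neg (η : Π z : M, TangentSpace 𝓘(ℝ, E) z →L[ℝ] ℝ)
    (X Y : Π z : M, TangentSpace 𝓘(ℝ, E) z) :
    dForm (fun z => -η z) X Y y = -dForm η X Y y := by
  have h1 : ∀ X : Π z : M, TangentSpace 𝓘(ℝ, E) z, mvfderiv 𝓘(ℝ, E) (fun z => (-η z) (X z)) y
      = -mvfderiv 𝓘(ℝ, E) (fun z => η z (X z)) y := fun X => mvfderiv_fun_neg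
  rw [dForm, dForm, h1, h1]
  simp only [neg_apply]
  ring

variable [IsManifold 𝓘(ℂ, E) ∞ M] {n : ℕ} {ι : Type*} {C : ContactStructure E M n ι}
  {g : SemiRiemannianMetric E M} {i : ι}

namespace ContactMetricStructure

variable (K : ContactMetricStructure C g)

theorem inner_J (K : ContactMetricStructure C g) (x w : TangentSpace 𝓘(ℝ, E) y) :
    g.inner y (J y x) w = -g.inner y x (J y w) := by
  rw [← K.hermitian y x, J_J, map_neg, neg_neg]

theorem inner_V (hy : y ∈ C.O i) (x : TangentSpace 𝓘(ℝ, E) y) :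
    g.inner y (K.V i y) x = K.v i y x := by
  rw [V, map_neg, neg_apply, K.inner_J, neg_neg, K.u_dual i y hy]
  rfl

theorem HG (hy : y ∈ C.O i) (x : TangentSpace 𝓘(ℝ, E) y) :
    K.H i y (K.G i y x) = -K.G i y (K.H i y x) := by
  change K.G i y (J y (K.G i y x)) = -K.G i y (K.G i y (J y x))
  rw [K.G_J i y hy x, map_neg, neg_neg]

theorem H_skew (hy : y ∈ C.O i) (x w : TangentSpace 𝓘(ℝ, E) y) :
    g.inner y (K.H i y x) w = -g.inner y x (K.H i y w) := by
  change g.inner y (K.G i y (J y x)) w = -g.inner y x (K.G i y (J y w))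
  rw [K.G_skew i y hy, K.G_J i y hy w, K.inner_J, map_neg]

theorem G_V (hy : y ∈ C.O i) : K.G i y (K.V i y) = 0 := by
  rw [V, map_neg, K.G_J i y hy, K.G_U i y hy, map_zero, neg_zero, neg_zero]

theorem H_U (hy : y ∈ C.O i) : K.H i y (K.U i y) = 0 := by
  change K.G i y (J y (K.U i y)) = 0
  rw [K.G_J i y hy, K.G_U i y hy, map_zero, neg_zero]

theorem H_V (hy : y ∈ C.O i) : K.H i y (K.V i y) = 0 := by
  change K.G i y (J y (-J y (K.U i y))) = 0
  rw [map_neg, J_J, neg_neg, K.G_U i y hy]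

theorem U_U (hy : y ∈ C.O i) : g.inner y (K.U i y) (K.U i y) = 1 := by
  rw [K.u_dual i y hy, K.u_U i y hy]

theorem V_V (hy : y ∈ C.O i) : g.inner y (K.V i y) (K.V i y) = 1 := by
  rw [V, map_neg, map_neg, neg_apply, neg_neg, K.hermitian, K.U_U hy]

theorem U_V : g.inner y (K.U i y) (K.V i y) = 0 := by
  have h := K.inner_J (K.U i y) (K.U i y)
  rw [g.symm] at h
  rw [V, map_neg]
  linarith

theorem G_sq' (hy : y ∈ C.O i) (x : TangentSpace 𝓘(ℝ, E) y) : K.G i y (K.G i y x)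
    = -x + g.inner y (K.U i y) x • K.U i y + g.inner y (K.V i y) x • K.V i y := by
  rw [K.u_dual i y hy, K.inner_V hy, K.G_sq i y hy]
  rfl

theorem H_sq' (hy : y ∈ C.O i) (x : TangentSpace 𝓘(ℝ, E) y) : K.H i y (K.H i y x)
    = -x + g.inner y (K.U i y) x • K.U i y + g.inner y (K.V i y) x • K.V i y := by
  rw [K.u_dual i y hy, K.inner_V hy]
  exact K.H_sq i y hy x

theorem dForm_U (hy : y ∈ C.O i) {X Y : Π z : M, TangentSpace 𝓘(ℝ, E) z} (hX : SmoothAt X y)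
    (hY : SmoothAt Y y) : 2 * dForm (fun z => g.inner z (K.U i z)) X Y y
      = 2 * g.inner y (X y) (K.G i y (Y y)) + (K.σ i y (X y) * g.inner y (K.V i y) (Y y)
        - K.σ i y (Y y) * g.inner y (K.V i y) (X y)) := by
  rw [dForm_congr (η' := K.u i) ?_, K.du_eq i y hy X Y hX hY, K.inner_V hy, K.inner_V hy]
  · simp only [v, ContinuousLinearMap.comp_apply]
    ring
  · filter_upwards [(C.isOpen_O i).mem_nhds hy] with z hz
    exact ContinuousLinearMap.ext (K.u_dual i z hz)

theorem dForm_V (hy : y ∈ C.O i) {X Y : Π z : M, TangentSpace 𝓘(ℝ, E) z} (hX : SmoothAt X y)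
    (hY : SmoothAt Y y) : 2 * dForm (fun z => g.inner z (K.V i z)) X Y y
      = 2 * g.inner y (X y) (K.H i y (Y y)) - (K.σ i y (X y) * g.inner y (K.U i y) (Y y)
        - K.σ i y (Y y) * g.inner y (K.U i y) (X y)) := by
  rw [dForm_congr (η' := fun z => (K.u i z).comp (J z)) ?_, K.dv_eq i y hy X Y hX hY,
    K.u_dual i y hy, K.u_dual i y hy]
  · simp only [H, ContinuousLinearMap.comp_apply]
    ring
  · filter_upwards [(C.isOpen_O i).mem_nhds hy] with z hz
    exact ContinuousLinearMap.ext (K.inner_V hz)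

/-- Vectors orthogonal to `U` and `V` lie in the kernel of the contact form, which is a multiple of
`u - i v`. -/
theorem isHorizontal (hy : y ∈ C.O i) {x : TangentSpace 𝓘(ℝ, E) y}
    (hU : g.inner y (K.U i y) x = 0) (hV : g.inner y (K.V i y) x = 0) :
    C.IsHorizontal i y x := by
  obtain ⟨l, hl⟩ := K.theta_eq i
  rw [K.u_dual i y hy] at hU
  rw [K.inner_V hy] at hV
  have hV' : K.u i y (J y x) = 0 := hV
  rw [ContactStructure.IsHorizontal, (hl y hy).2, hU, hV']
  simp

theorem smooth_V (hy : y ∈ C.O i) : SmoothAt (K.V i) y :=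
  (K.smooth_U i y hy).J.neg

theorem diff_G (hy : y ∈ C.O i) {X : Π z : M, TangentSpace 𝓘(ℝ, E) z} (hX : DiffAt X y) :
    DiffAt (fun z => K.G i z (X z)) y :=
  DiffAt.clm_apply ((K.smooth_G i).contMDiffAt ((C.isOpen_O i).mem_nhds hy)) hX

theorem diff_H (hy : y ∈ C.O i) {X : Π z : M, TangentSpace 𝓘(ℝ, E) z} (hX : DiffAt X y) :
    DiffAt (fun z => K.H i z (X z)) y :=
  K.diff_G hy hX.J

theorem diff_σ (hy : y ∈ C.O i) {X : Π z : M, TangentSpace 𝓘(ℝ, E) z} (hX : DiffAt X y) :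
    MDifferentiableAt 𝓘(ℝ, E) 𝓘(ℝ) (fun z => K.σ i z (X z)) y :=
  DiffAt.form_apply ((K.smooth_σ i).contMDiffAt ((C.isOpen_O i).mem_nhds hy)) hX

variable {K}

/-- For `(U, V, G, H)`, the last two equations of `ContactGerm` are the vanishing of `S` on pairs of
horizontal vectors and on pairs `(U, X)`. -/
theorem IsNormal.germ_G (hK : K.IsNormal) (hy : y ∈ C.O i) :
    ContactGerm g (K.U i) (K.V i) (K.G i) (K.H i) (K.σ i) y := by
  have hO : ∀ᶠ z in 𝓝 y, z ∈ C.O i := (C.isOpen_O i).mem_nhds hy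
  refine ⟨K.smooth_U i y hy, K.smooth_V hy, fun X => K.diff_G hy,
    fun X => K.diff_σ hy, hO.mono fun z hz => K.G_sq' hz, hO.mono fun z hz => K.HG hz,
    hO.mono fun z hz => K.G_skew i z hz, hO.mono fun z hz => K.H_skew hz,
    hO.mono fun z hz => K.G_U i z hz, hO.mono fun z hz => K.G_V hz, hO.mono fun z hz => K.H_U hz,
    hO.mono fun z hz => K.H_V hz, hO.mono fun z hz => K.U_U hz, hO.mono fun z hz => K.V_V hz,
    hO.mono fun z hz => K.U_V, hO.mono fun z hz X Y => K.dForm_U hz, fun X Y => K.dForm_V hy,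
    fun X Y hX hY hX0 hY0 => ?_, fun X hX => ?_⟩
  · have h := (hK.horizontal i y hy X Y hX hY
      ((hO.and hX0).mono fun z hz => K.isHorizontal hz.1 hz.2.1 hz.2.2)
      ((hO.and hY0).mono fun z hz => K.isHorizontal hz.1 hz.2.1 hz.2.2)).1
    rw [S, ← K.inner_V hy, ← K.inner_V hy, hX0.self_of_nhds.2, hY0.self_of_nhds.2, zero_smul,
      zero_smul, sub_zero, smul_zero, add_zero] at h
    exact h
  · have h := (hK.vertical i y hy X hX).1
    rw [S, ← K.inner_V hy, ← K.inner_V hy] at h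
    exact h

/-- For `(V, -U, H, -G)`, the last two equations of `ContactGerm` are the vanishing of `T` on pairs
of horizontal vectors and on pairs `(V, X)`; the formulas for `du` and `dv` exchange their roles. -/
theorem IsNormal.germ_H (hK : K.IsNormal) (hy : y ∈ C.O i) :
    ContactGerm g (K.V i) (-K.U i) (K.H i) (-K.G i) (K.σ i) y := by
  have hO : ∀ᶠ z in 𝓝 y, z ∈ C.O i := (C.isOpen_O i).mem_nhds hy
  refine ⟨K.smooth_V hy, (K.smooth_U i y hy).neg, fun X => K.diff_H hy,
    fun X => K.diff_σ hy, hO.mono fun z hz x => ?_, hO.mono fun z hz x => ?_,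
    hO.mono fun z hz => K.H_skew hz, hO.mono fun z hz x w => ?_,
    hO.mono fun z hz => K.H_V hz, hO.mono fun z hz => ?_, hO.mono fun z hz => ?_,
    hO.mono fun z hz => ?_, hO.mono fun z hz => K.V_V hz, hO.mono fun z hz => ?_,
    hO.mono fun z hz => ?_, hO.mono fun z hz X Y hX hY => ?_, fun X Y hX hY => ?_,
    fun X Y hX hY hX0 hY0 => ?_, fun X hX => ?_⟩
  · rw [K.H_sq' hz]
    simp only [Pi.neg_apply, map_neg, neg_apply]
    module
  · simp only [Pi.neg_apply, neg_apply, map_neg, neg_neg, K.HG hz]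
  · simp only [Pi.neg_apply, neg_apply, map_neg, K.G_skew i z hz]
  · simp only [Pi.neg_apply, map_neg, K.H_U hz, neg_zero]
  · simp only [Pi.neg_apply, neg_apply, K.G_V hz, neg_zero]
  · simp only [Pi.neg_apply, neg_apply, map_neg, K.G_U i z hz, neg_zero]
  · simp only [Pi.neg_apply, neg_apply, map_neg, K.U_U hz, neg_neg]
  · simp only [Pi.neg_apply, map_neg]
    rw [g.symm, K.U_V, neg_zero]
  · rw [K.dForm_V hz hX hY]
    simp only [Pi.neg_apply, map_neg, neg_apply]
    ring
  · have h : (fun z => g.inner z ((-K.U i) z)) = fun z => -g.inner z (K.U i z) :=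
      funext fun z => map_neg _ _
    have h2 := K.dForm_U hy hX hY
    rw [h, dForm_neg]
    simp only [Pi.neg_apply, map_neg, neg_apply]
    linarith
  · have hX1 : ∀ᶠ z in 𝓝 y, g.inner z (K.U i z) (X z) = 0 ∧ g.inner z (K.V i z) (X z) = 0 :=
      hX0.mono fun z hz => ⟨by simpa using hz.2, hz.1⟩
    have hY1 : ∀ᶠ z in 𝓝 y, g.inner z (K.U i z) (Y z) = 0 ∧ g.inner z (K.V i z) (Y z) = 0 :=
      hY0.mono fun z hz => ⟨by simpa using hz.2, hz.1⟩
    have h := (hK.horizontal i y hy X Y hX hY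
      ((hO.and hX1).mono fun z hz => K.isHorizontal hz.1 hz.2.1 hz.2.2)
      ((hO.and hY1).mono fun z hz => K.isHorizontal hz.1 hz.2.1 hz.2.2)).2
    rw [T, ← K.u_dual i y hy, ← K.u_dual i y hy, hX1.self_of_nhds.1, hY1.self_of_nhds.1, zero_smul,
      zero_smul, sub_zero, smul_zero, add_zero] at h
    rw [← h]
    simp only [Pi.neg_apply, map_neg, neg_apply, K.HG hy]
    module
  · have h := (hK.vertical i y hy X hX).2
    rw [T, ← K.u_dual i y hy, ← K.u_dual i y hy] at h
    rw [← h]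
    simp only [Pi.neg_apply, map_neg, neg_apply, K.HG hy]
    module

end ContactMetricStructure
end Structure

/-! ### Vector fields and immersions -/

section Commutator
variable {E : Type*} [NormedAddCommGroup E] [NormedSpace ℝ E]
  {M : Type*} [TopologicalSpace M] [ChartedSpace E M]
  {E' : Type*} [NormedAddCommGroup E'] [NormedSpace ℝ E'] [IsManifold 𝓘(ℝ, E) ∞ M]

/-- The converse of `differentiableAt_chartField`. -/
theorem mdifferentiableAt_of_chartField {p : M} {X : Π q : M, TangentSpace 𝓘(ℝ, E) q}
    (hX : DifferentiableAt ℝ (chartField p X) (extChartAt 𝓘(ℝ, E) p p)) :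
    MDifferentiableAt 𝓘(ℝ, E) 𝓘(ℝ, E).tangent
      (fun q => (⟨q, X q⟩ : TangentBundle 𝓘(ℝ, E) M)) p := by
  refine (mdifferentiableAt_section (F := E) (E := (TangentSpace 𝓘(ℝ, E) : M → Type _))
    (IB := 𝓘(ℝ, E)) _).2 (mdifferentiableAt_of_comp_extChartAt_symm ?_)
  refine hX.congr_of_eventuallyEq ?_
  have hopen := extChartAt_target_mem_nhds (I := 𝓘(ℝ, E)) p
  filter_upwards [mvfderiv_comp_extChartAt_symm_eventuallyEq
    (contMDiffAt_extChartAt (n := ∞)) X, eventually_eventually_nhds.2 hopen] with z hz hz2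
  have hzt := hz2.self_of_nhds
  have hq : (extChartAt 𝓘(ℝ, E) p).symm z ∈ (chartAt E p).source := by
    rw [← extChartAt_source 𝓘(ℝ, E)]
    exact (extChartAt 𝓘(ℝ, E) p).map_target hzt
  rw [Function.comp_apply, trivializationAt_snd_eq_mvfderiv hq]
  refine hz.trans ?_
  have h1 : (extChartAt 𝓘(ℝ, E) p) ∘ (extChartAt 𝓘(ℝ, E) p).symm =ᶠ[𝓝 z] id :=
    hz2.mono fun w hw => (extChartAt 𝓘(ℝ, E) p).right_inv hw
  rw [h1.fderiv_eq, fderiv_id]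
  rfl

/-- If `ψ` is an immersion at `p`, then a vector field `X` is differentiable at `p` as soon as the
derivative of `ψ` along `X` is. -/
theorem mdifferentiableAt_of_mvfderiv_apply [FiniteDimensional ℝ E] [FiniteDimensional ℝ E']
    {p : M} {ψ : M → E'} (hψ : ContMDiffAt 𝓘(ℝ, E) 𝓘(ℝ, E') ∞ ψ p)
    (hinj : Function.Injective (mvfderiv 𝓘(ℝ, E) ψ p))
    {X : Π q : M, TangentSpace 𝓘(ℝ, E) q}
    (hX : MDifferentiableAt 𝓘(ℝ, E) 𝓘(ℝ, E') (fun q => mvfderiv 𝓘(ℝ, E) ψ q (X q)) p) :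
    MDifferentiableAt 𝓘(ℝ, E) 𝓘(ℝ, E).tangent
      (fun q => (⟨q, X q⟩ : TangentBundle 𝓘(ℝ, E) M)) p := by
  refine mdifferentiableAt_of_chartField ?_
  have : CompleteSpace E := FiniteDimensional.complete ℝ E
  set z₀ := extChartAt 𝓘(ℝ, E) p p with hz₀
  set Ψ : E → E' := ψ ∘ (extChartAt 𝓘(ℝ, E) p).symm with hΨ
  have hΨs : ContDiffAt ℝ ∞ Ψ z₀ := contDiffAt_comp_extChartAt_symm hψ
  have hL : DifferentiableAt ℝ (fderiv ℝ Ψ) z₀ :=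
    (hΨs.fderiv_right (m := 1) (by decide)).differentiableAt one_ne_zero
  have hinj' : Function.Injective (fderiv ℝ Ψ z₀) := by
    have h := (hψ.mdifferentiableAt (by simp)).mvfderiv
    rw [modelWithCornersSelf_coe, range_id, fderivWithin_univ] at h
    rw [h] at hinj
    exact hinj
  -- With a left inverse `B` of the derivative of `ψ` at `p`, the operator `Λ = B dψ` is the
  -- identity at `p`, hence invertible nearby, and `X = Λ⁻¹ B (dψ X)`.
  obtain ⟨B₀, hB₀⟩ := LinearMap.exists_leftInverse_of_injective (fderiv ℝ Ψ z₀).toLinearMap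
    (LinearMap.ker_eq_bot.2 hinj')
  set B : E' →L[ℝ] E := B₀.toContinuousLinearMap with hB
  set Λ : E → E →L[ℝ] E := fun z => B.comp (fderiv ℝ Ψ z) with hΛ
  have hΛ₀ : Λ z₀ = 1 := ContinuousLinearMap.ext fun v => LinearMap.congr_fun hB₀ v
  have hΛd : DifferentiableAt ℝ Λ z₀ := (differentiableAt_const B).clm_comp hL
  have hinv : DifferentiableAt ℝ (fun z => Ring.inverse (Λ z)) z₀ := by
    have h : IsUnit (Λ z₀) := hΛ₀ ▸ isUnit_one
    exact (differentiableAt_inverse (𝕜 := ℝ) h).comp z₀ hΛd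
  have hunit : ∀ᶠ z in 𝓝 z₀, IsUnit (Λ z) := by
    refine hΛd.continuousAt.eventually (Units.isOpen.mem_nhds ?_)
    rw [hΛ₀]
    exact isUnit_one
  have hd : DifferentiableAt ℝ ((fun q => mvfderiv 𝓘(ℝ, E) ψ q (X q)) ∘
      (extChartAt 𝓘(ℝ, E) p).symm) z₀ := by
    have h := hX.differentiableWithinAt_writtenInExtChartAt
    rw [modelWithCornersSelf_coe, range_id, differentiableWithinAt_univ] at h
    exact h
  refine DifferentiableAt.congr_of_eventuallyEq (hinv.clm_apply
    ((differentiableAt_const B).clm_apply hd)) ?_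
  filter_upwards [hunit, mvfderiv_comp_extChartAt_symm_eventuallyEq hψ X] with z hz hz2
  rw [hz2]
  exact (DFunLike.congr_fun (Ring.inverse_mul_cancel _ hz) (chartField p X z)).symm

end Commutator

/-! ### The pullback connection -/

section Along

open SemiRiemannianMetric

variable {E : Type*} [NormedAddCommGroup E]
  {M' : Type*} [TopologicalSpace M'] [ChartedSpace E M'] {M : Type*} {f : M → M'} {p : M}

theorem eventually_mem_chart [TopologicalSpace M] (hf : ContinuousAt f p) :
    ∀ᶠ q in 𝓝 p, f q ∈ (chartAt E (f p)).source :=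
  hf.eventually ((chartAt E (f p)).open_source.mem_nhds (mem_chart_source E (f p)))

variable [NormedSpace ℂ E] [IsManifold 𝓘(ℂ, E) ∞ M']
  {W W' : Π q : M, TangentSpace 𝓘(ℝ, E) (f q)} {φ : M → ℝ}

/-- The coordinates of a vector field along `f` in the preferred chart at `f p`. -/
def coordAlong (f : M → M') (p : M) (W : Π q : M, TangentSpace 𝓘(ℝ, E) (f q)) (q : M) : E :=
  (trivializationAt E (TangentSpace 𝓘(ℝ, E) : M' → Type _) (f p) ⟨f q, W q⟩).2

theorem coordAlong_add {q : M} (hq : f q ∈ (chartAt E (f p)).source) :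
    coordAlong f p (W + W') q = coordAlong f p W q + coordAlong f p W' q := by
  simp only [coordAlong, trivializationAt_snd_eq_mvfderiv hq]
  exact map_add _ _ _

theorem coordAlong_smul {q : M} (hq : f q ∈ (chartAt E (f p)).source) :
    coordAlong f p (φ • W) q = φ q • coordAlong f p W q := by
  simp only [coordAlong, trivializationAt_snd_eq_mvfderiv hq]
  exact map_smul (mvfderiv 𝓘(ℝ, E) (extChartAt 𝓘(ℝ, E) (f p)) (f q)) (φ q) (W q)

/-- A vector field along `f` is recovered at `p` from its coordinates. -/
theorem symmₗ_coordAlong (W : Π q : M, TangentSpace 𝓘(ℝ, E) (f q)) (p : M) :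
    (trivializationAt E (TangentSpace 𝓘(ℝ, E) : M' → Type _) (f p)).symmₗ ℝ (f p)
      (coordAlong f p W p) = W p := by
  rw [Trivialization.coe_symmₗ (R := ℝ) _ (mem_chart_source E (f p))]
  exact Trivialization.symm_apply_apply_mk _ (mem_chart_source E (f p)) (W p)

theorem extend_add {y q : M'} (hq : q ∈ (chartAt E y).source) (v w : TangentSpace 𝓘(ℝ, E) y) :
    FiberBundle.extend E (v + w) q = FiberBundle.extend E v q + FiberBundle.extend E w q := by
  simp only [FiberBundle.extend, trivializationAt_snd_eq_mvfderiv (mem_chart_source E y), map_add]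
  rw [← Trivialization.coe_symmₗ (R := ℝ) _ hq, map_add]

theorem extend_smul {y q : M'} (hq : q ∈ (chartAt E y).source) (c : ℝ)
    (v : TangentSpace 𝓘(ℝ, E) y) :
    FiberBundle.extend E (c • v) q = c • FiberBundle.extend E v q := by
  simp only [FiberBundle.extend, trivializationAt_snd_eq_mvfderiv (mem_chart_source E y),
    map_smul]
  rw [← Trivialization.coe_symmₗ (R := ℝ) _ hq, map_smul]

variable {F : Type*} [NormedAddCommGroup F] [NormedSpace ℝ F]
  [TopologicalSpace M] [ChartedSpace F M]
  (D : CovariantDerivative 𝓘(ℝ, E) E (TangentSpace 𝓘(ℝ, E) : M' → Type _))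

variable (F) in
/-- A vector field along `f` is differentiable at `p`. -/
def DiffAlong (f : M → M') (p : M) (W : Π q : M, TangentSpace 𝓘(ℝ, E) (f q)) : Prop :=
  MDifferentiableAt 𝓘(ℝ, F) 𝓘(ℝ, E) (coordAlong f p W) p

theorem coordAlong_congr (h : ∀ᶠ q in 𝓝 p, W q = W' q) :
    coordAlong f p W =ᶠ[𝓝 p] coordAlong f p W' :=
  h.mono fun q hq => by simp only [coordAlong, hq]

theorem DiffAlong.congr (hW : DiffAlong F f p W) (h : ∀ᶠ q in 𝓝 p, W' q = W q) :
    DiffAlong F f p W' :=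
  MDifferentiableAt.congr_of_eventuallyEq hW (coordAlong_congr h)

theorem DiffAlong.add (hf : ContinuousAt f p) (hW : DiffAlong F f p W)
    (hW' : DiffAlong F f p W') : DiffAlong F f p (W + W') :=
  (MDifferentiableAt.add hW hW').congr_of_eventuallyEq
    ((eventually_mem_chart hf).mono fun _ hq => coordAlong_add hq)

theorem DiffAlong.smul (hf : ContinuousAt f p) (hφ : MDifferentiableAt 𝓘(ℝ, F) 𝓘(ℝ) φ p)
    (hW : DiffAlong F f p W) : DiffAlong F f p (φ • W) :=
  (MDifferentiableAt.smul hφ hW).congr_of_eventuallyEq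
    ((eventually_mem_chart hf).mono fun _ hq => coordAlong_smul hq)

theorem DiffAlong.comp (hf : MDifferentiableAt 𝓘(ℝ, F) 𝓘(ℝ, E) f p)
    {Z : Π y : M', TangentSpace 𝓘(ℝ, E) y} (hZ : DiffAt Z (f p)) :
    DiffAlong F f p (fun q => Z (f q)) :=
  ((mdifferentiableAt_section (F := E) (E := (TangentSpace 𝓘(ℝ, E) : M' → Type _))
    (IB := 𝓘(ℝ, E)) _).1 hZ).comp p hf

theorem cov_extend_add {y : M'} (v w : TangentSpace 𝓘(ℝ, E) y) :
    D (FiberBundle.extend E (v + w)) y =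
      D (FiberBundle.extend E v) y + D (FiberBundle.extend E w) y := by
  rw [← cov_add D (diffAt_extend v) (diffAt_extend w)]
  refine cov_congr D ((diffAt_extend v).add (diffAt_extend w)) ?_
  filter_upwards [(chartAt E y).open_source.mem_nhds (mem_chart_source E y)] with q hq
  exact extend_add hq v w

theorem cov_extend_smul {y : M'} (c : ℝ) (v : TangentSpace 𝓘(ℝ, E) y) :
    D (FiberBundle.extend E (c • v)) y = c • D (FiberBundle.extend E v) y := by
  rw [← cov_smul_const D c (diffAt_extend v)]
  refine cov_congr D (DiffAt.smul mdifferentiableAt_const (diffAt_extend v)) ?_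
  filter_upwards [(chartAt E y).open_source.mem_nhds (mem_chart_source E y)] with q hq
  exact extend_smul hq c v

theorem covEnd_add [FiniteDimensional ℂ E] {y : M'}
    {A : Π z : M', TangentSpace 𝓘(ℝ, E) z →L[ℝ] TangentSpace 𝓘(ℝ, E) z}
    (hA : ∀ X, DiffAt X y → DiffAt (fun z => A z (X z)) y) (x v w : TangentSpace 𝓘(ℝ, E) y) :
    covEnd D A y x (v + w) = covEnd D A y x v + covEnd D A y x w := by
  have hv := diffAt_extend v
  have hw := diffAt_extend w
  have h := covEnd_apply D hA (hv.add hw) x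
  have h1 : (fun z => A z ((FiberBundle.extend E v + FiberBundle.extend E w) z))
      = (fun z => A z (FiberBundle.extend E v z)) + fun z => A z (FiberBundle.extend E w z) :=
    funext fun z => map_add (A z) _ _
  rw [h1, cov_add D (hA _ hv) (hA _ hw), cov_add D hv hw, Pi.add_apply,
    FiberBundle.extend_apply_self, FiberBundle.extend_apply_self, add_apply, add_apply,
    map_add] at h
  rw [← sub_eq_iff_eq_add] at h
  rw [← h, covEnd, covEnd]
  abel

theorem covEnd_smul [FiniteDimensional ℂ E] {y : M'}
    {A : Π z : M', TangentSpace 𝓘(ℝ, E) z →L[ℝ] TangentSpace 𝓘(ℝ, E) z}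
    (hA : ∀ X, DiffAt X y → DiffAt (fun z => A z (X z)) y) (x : TangentSpace 𝓘(ℝ, E) y) (c : ℝ)
    (v : TangentSpace 𝓘(ℝ, E) y) : covEnd D A y x (c • v) = c • covEnd D A y x v := by
  set e : Π z : M', TangentSpace 𝓘(ℝ, E) z := FiberBundle.extend E v with he
  have hv : DiffAt e y := diffAt_extend v
  have hey : e y = v := FiberBundle.extend_apply_self E v
  have hd : DiffAt (c • e) y := DiffAt.smul (f := fun _ => c) mdifferentiableAt_const hv
  have h := covEnd_apply D hA hd x
  have h1 : (fun z => A z ((c • e) z)) = c • fun z => A z (e z) :=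
    funext fun z => map_smul (A z) c (e z)
  rw [h1, cov_smul_const D c (hA _ hv), cov_smul_const D c hv, Pi.smul_apply, hey,
    smul_apply, smul_apply, map_smul] at h
  rw [← sub_eq_iff_eq_add] at h
  rw [← h, covEnd, smul_sub]

theorem covAlong_eq (W : Π q : M, TangentSpace 𝓘(ℝ, E) (f q)) (x : TangentSpace 𝓘(ℝ, F) p) :
    covAlong D f W p x = (trivializationAt E (TangentSpace 𝓘(ℝ, E) : M' → Type _) (f p)).symmₗ ℝ
        (f p) (mvfderiv 𝓘(ℝ, F) (coordAlong f p W) p x)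
      + D (FiberBundle.extend E (W p)) (f p) (mfderiv 𝓘(ℝ, F) 𝓘(ℝ, E) f p x) := by
  rw [Trivialization.coe_symmₗ (R := ℝ) _ (mem_chart_source E (f p))]
  rfl

theorem covAlong_congr (h : ∀ᶠ q in 𝓝 p, W q = W' q) (x : TangentSpace 𝓘(ℝ, F) p) :
    covAlong D f W p x = covAlong D f W' p x := by
  have h1 : mvfderiv 𝓘(ℝ, F) (coordAlong f p W) p = mvfderiv 𝓘(ℝ, F) (coordAlong f p W') p :=
    mvfderiv_congr (coordAlong_congr h)
  rw [covAlong_eq, covAlong_eq, h1, h.self_of_nhds]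

theorem covAlong_add (hf : ContinuousAt f p) (hW : DiffAlong F f p W) (hW' : DiffAlong F f p W')
    (x : TangentSpace 𝓘(ℝ, F) p) :
    covAlong D f (W + W') p x = covAlong D f W p x + covAlong D f W' p x := by
  have h1 : mvfderiv 𝓘(ℝ, F) (coordAlong f p (W + W')) p
      = mvfderiv 𝓘(ℝ, F) (coordAlong f p W + coordAlong f p W') p :=
    mvfderiv_congr ((eventually_mem_chart hf).mono fun _ hq => coordAlong_add hq)
  rw [covAlong_eq, covAlong_eq, covAlong_eq, h1, mvfderiv_add hW hW', Pi.add_apply,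
    cov_extend_add, add_apply, add_apply, map_add]
  abel

/-- The Leibniz rule for the pullback connection and a function. -/
theorem covAlong_smul (hf : ContinuousAt f p) (hφ : MDifferentiableAt 𝓘(ℝ, F) 𝓘(ℝ) φ p)
    (hW : DiffAlong F f p W) (x : TangentSpace 𝓘(ℝ, F) p) :
    covAlong D f (φ • W) p x
      = φ p • covAlong D f W p x + mvfderiv 𝓘(ℝ, F) φ p x • W p := by
  have h1 : mvfderiv 𝓘(ℝ, F) (coordAlong f p (φ • W)) p
      = mvfderiv 𝓘(ℝ, F) (φ • coordAlong f p W) p :=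
    mvfderiv_congr ((eventually_mem_chart hf).mono fun _ hq => coordAlong_smul hq)
  rw [covAlong_eq, covAlong_eq, h1, mvfderiv_smul hφ hW]
  change _ + D (FiberBundle.extend E (φ p • W p)) (f p) _ = _
  rw [cov_extend_smul, add_apply, map_add, smul_apply, smul_apply, map_smul,
    ContinuousLinearMap.smulRight_apply, map_smul, symmₗ_coordAlong, smul_add]
  abel

/-- The chain rule for the pullback connection. -/
theorem covAlong_comp [FiniteDimensional ℂ E] (hf : MDifferentiableAt 𝓘(ℝ, F) 𝓘(ℝ, E) f p)
    {Z : Π y : M', TangentSpace 𝓘(ℝ, E) y} (hZ : DiffAt Z (f p)) (x : TangentSpace 𝓘(ℝ, F) p) :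
    covAlong D f (fun q => Z (f q)) p x = D Z (f p) (mfderiv 𝓘(ℝ, F) 𝓘(ℝ, E) f p x) := by
  set v := mfderiv 𝓘(ℝ, F) 𝓘(ℝ, E) f p x with hv
  set ℓ := (trivializationAt E (TangentSpace 𝓘(ℝ, E) : M' → Type _) (f p)).symmₗ ℝ (f p) with hℓ
  have hd : ∀ {Z : Π y : M', TangentSpace 𝓘(ℝ, E) y}, DiffAt Z (f p) →
      MDifferentiableAt 𝓘(ℝ, E) 𝓘(ℝ, E) (coordAlong id (f p) Z) (f p) := fun h =>
    (mdifferentiableAt_section (F := E) (E := (TangentSpace 𝓘(ℝ, E) : M' → Type _))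
      (IB := 𝓘(ℝ, E)) _).1 h
  -- The difference of `D` and of the flat connection of the chart is tensorial.
  have hT : TensorialAt 𝓘(ℝ, E) E (fun Z : Π y : M', TangentSpace 𝓘(ℝ, E) y =>
      D Z (f p) v - ℓ (mvfderiv 𝓘(ℝ, E) (coordAlong id (f p) Z) (f p) v)) (f p) := by
    have hc : ∀ᶠ y in 𝓝 (f p), id y ∈ (chartAt E (f p)).source :=
      eventually_mem_chart (f := id) continuousAt_id
    refine ⟨fun {φ Z} hφ hZ => ?_, fun {Z Z'} hZ hZ' => ?_⟩
    · have h1 : mvfderiv 𝓘(ℝ, E) (coordAlong id (f p) (φ • Z)) (f p)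
          = mvfderiv 𝓘(ℝ, E) (φ • coordAlong id (f p) Z) (f p) :=
        mvfderiv_congr (hc.mono fun _ hq => coordAlong_smul hq)
      have h2 : ℓ (coordAlong id (f p) Z (f p)) = Z (f p) := symmₗ_coordAlong (f := id) Z (f p)
      rw [cov_smul D hφ hZ, h1, mvfderiv_smul hφ (hd hZ), add_apply, map_add, smul_apply,
        map_smul, ContinuousLinearMap.smulRight_apply, map_smul, h2, smul_sub]
      abel
    · have h1 : mvfderiv 𝓘(ℝ, E) (coordAlong id (f p) (Z + Z')) (f p)
          = mvfderiv 𝓘(ℝ, E) (coordAlong id (f p) Z + coordAlong id (f p) Z') (f p) :=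
        mvfderiv_congr (hc.mono fun _ hq => coordAlong_add hq)
      rw [cov_add D hZ hZ', h1, mvfderiv_add (hd hZ) (hd hZ'), add_apply, add_apply, map_add]
      abel
  have : IsManifold 𝓘(ℝ, E) 2 M' := .of_le (n := ∞) ENat.LEInfty.out
  have h := hT.pointwise hZ (diffAt_extend (Z (f p))) (FiberBundle.extend_apply_self E _).symm
  have h0 : mvfderiv 𝓘(ℝ, E) (coordAlong id (f p)
      (show Π y : M', TangentSpace 𝓘(ℝ, E) y from FiberBundle.extend E (Z (f p)))) (f p) = 0 := by
    rw [mvfderiv_congr (ψ := fun _ => coordAlong id (f p) Z (f p)), mvfderiv_const]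
    filter_upwards [(chartAt E (f p)).open_source.mem_nhds (mem_chart_source E (f p))] with y hy
    exact trivializationAt_extend_snd hy _
  have h3 : mvfderiv 𝓘(ℝ, F) (coordAlong f p fun q => Z (f q)) p x
      = mvfderiv 𝓘(ℝ, E) (coordAlong id (f p) Z) (f p) v := by
    exact mfderiv_comp_apply p (hd hZ) hf x
  rw [covAlong_eq, h3, ← hℓ, ← hv]
  rw [h0, zero_apply, map_zero, sub_zero, sub_eq_iff_eq_add'] at h
  exact h.symm

theorem covAlong_map_add (W : Π q : M, TangentSpace 𝓘(ℝ, E) (f q))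
    (x x' : TangentSpace 𝓘(ℝ, F) p) :
    covAlong D f W p (x + x') = covAlong D f W p x + covAlong D f W p x' := by
  rw [covAlong_eq, covAlong_eq, covAlong_eq, map_add, map_add, map_add, map_add]
  abel

theorem covAlong_map_smul (W : Π q : M, TangentSpace 𝓘(ℝ, E) (f q)) (c : ℝ)
    (x : TangentSpace 𝓘(ℝ, F) p) :
    covAlong D f W p (c • x) = c • covAlong D f W p x := by
  rw [covAlong_eq, covAlong_eq, map_smul, map_smul, map_smul, map_smul, smul_add]

/-- A statement about differentiable vector fields along `f` follows from the case of the
restrictions of ambient vector fields, since these span the vector fields along `f` over the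
functions. -/
theorem DiffAlong.induction [FiniteDimensional ℂ E]
    (hf : MDifferentiableAt 𝓘(ℝ, F) 𝓘(ℝ, E) f p)
    {P : (Π q : M, TangentSpace 𝓘(ℝ, E) (f q)) → Prop}
    (comp : ∀ Z : Π y : M', TangentSpace 𝓘(ℝ, E) y, DiffAt Z (f p) → P fun q => Z (f q))
    (add : ∀ W W', DiffAlong F f p W → DiffAlong F f p W' → P W → P W' → P (W + W'))
    (smul : ∀ (φ : M → ℝ) W, MDifferentiableAt 𝓘(ℝ, F) 𝓘(ℝ) φ p → DiffAlong F f p W → P W →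
      P (φ • W))
    (congr : ∀ W W', DiffAlong F f p W → (∀ᶠ q in 𝓝 p, W' q = W q) → P W → P W')
    (hW : DiffAlong F f p W) : P W := by
  -- Near `p`, the field is `∑ a, c a • e a`, where the `e a` are the coordinate vector fields.
  set b := Module.finBasis ℝ E with hb
  set e : Fin (Module.finrank ℝ E) → Π y : M', TangentSpace 𝓘(ℝ, E) y := fun a =>
    FiberBundle.extend E ((trivializationAt E (TangentSpace 𝓘(ℝ, E) : M' → Type _) (f p)).symmₗ ℝ
      (f p) (b a)) with he
  set c : Fin (Module.finrank ℝ E) → M → ℝ := fun a q => b.coord a (coordAlong f p W q) with hc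
  have hcd : ∀ a, MDifferentiableAt 𝓘(ℝ, F) 𝓘(ℝ) (c a) p := fun a =>
    ((b.coord a).toContinuousLinearMap.mdifferentiableAt).comp p hW
  have hed : ∀ a, DiffAlong F f p fun q => e a (f q) := fun a =>
    DiffAlong.comp hf (diffAt_extend _)
  have hterm : ∀ a, DiffAlong F f p (c a • fun q => e a (f q)) ∧ P (c a • fun q => e a (f q)) :=
    fun a => ⟨(hed a).smul hf.continuousAt (hcd a),
      smul _ _ (hcd a) (hed a) (comp _ (diffAt_extend _))⟩
  have hsum : ∀ s : Finset (Fin (Module.finrank ℝ E)),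
      DiffAlong F f p (∑ a ∈ s, c a • fun q => e a (f q)) ∧
        P (∑ a ∈ s, c a • fun q => e a (f q)) := by
    intro s
    induction s using Finset.induction_on with
    | empty =>
      rw [Finset.sum_empty]
      have h0 : DiffAt (0 : Π y : M', TangentSpace 𝓘(ℝ, E) y) (f p) :=
        mdifferentiableAt_zeroSection ..
      exact ⟨DiffAlong.comp hf h0, comp 0 h0⟩
    | insert a s ha h =>
      rw [Finset.sum_insert ha]
      exact ⟨(hterm a).1.add hf.continuousAt h.1, add _ _ (hterm a).1 h.1 (hterm a).2 h.2⟩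
  refine congr _ _ (hsum Finset.univ).1 ?_ (hsum Finset.univ).2
  filter_upwards [eventually_mem_chart (E := E) hf.continuousAt] with q hq
  have h1 : ∀ a, e a (f q) = (trivializationAt E (TangentSpace 𝓘(ℝ, E) : M' → Type _)
      (f p)).symmₗ ℝ (f q) (b a) := fun a => by
    rw [Trivialization.coe_symmₗ (R := ℝ) _ hq, he]
    simp only [FiberBundle.extend]
    rw [Trivialization.coe_symmₗ (R := ℝ) _ (mem_chart_source E (f p)),
      Trivialization.apply_mk_symm _ (mem_chart_source E (f p))]
  rw [Finset.sum_apply]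
  simp only [Pi.smul_apply', h1, ← map_smul]
  rw [← map_sum]
  have h2 : ∑ a, c a q • b a = coordAlong f p W q := b.sum_repr _
  rw [h2, Trivialization.coe_symmₗ (R := ℝ) _ hq]
  exact (Trivialization.symm_apply_apply_mk _ hq (W q)).symm

theorem DiffAlong.clm [FiniteDimensional ℂ E] (hf : MDifferentiableAt 𝓘(ℝ, F) 𝓘(ℝ, E) f p)
    {A : Π z : M', TangentSpace 𝓘(ℝ, E) z →L[ℝ] TangentSpace 𝓘(ℝ, E) z}
    (hA : ∀ X, DiffAt X (f p) → DiffAt (fun z => A z (X z)) (f p)) (hW : DiffAlong F f p W) :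
    DiffAlong F f p (fun q => A (f q) (W q)) := by
  refine DiffAlong.induction (P := fun W => DiffAlong F f p (fun q => A (f q) (W q))) hf
    (fun Z hZ => DiffAlong.comp hf (hA Z hZ)) (fun W W' hW hW' h h' => ?_)
    (fun φ W hφ hW h => ?_) (fun W W' hW he h => h.congr (he.mono fun q hq => by rw [hq])) hW
  · have h1 : (fun q => A (f q) ((W + W') q)) = (fun q => A (f q) (W q))
        + fun q => A (f q) (W' q) :=
      funext fun q => map_add (A (f q)) (W q) (W' q)
    exact h1 ▸ h.add hf.continuousAt h'
  · have h1 : (fun q => A (f q) ((φ • W) q)) = φ • fun q => A (f q) (W q) :=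
      funext fun q => map_smul (A (f q)) (φ q) (W q)
    exact h1 ▸ h.smul hf.continuousAt hφ

/-- The Leibniz rule for the pullback connection and a (1,1)-tensor field. -/
theorem covAlong_clm [FiniteDimensional ℂ E] (hf : MDifferentiableAt 𝓘(ℝ, F) 𝓘(ℝ, E) f p)
    {A : Π z : M', TangentSpace 𝓘(ℝ, E) z →L[ℝ] TangentSpace 𝓘(ℝ, E) z}
    (hA : ∀ X, DiffAt X (f p) → DiffAt (fun z => A z (X z)) (f p)) (hW : DiffAlong F f p W)
    (x : TangentSpace 𝓘(ℝ, F) p) :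
    covAlong D f (fun q => A (f q) (W q)) p x
      = covEnd D A (f p) (mfderiv 𝓘(ℝ, F) 𝓘(ℝ, E) f p x) (W p)
        + A (f p) (covAlong D f W p x) := by
  refine DiffAlong.induction (P := fun W => covAlong D f (fun q => A (f q) (W q)) p x
        = covEnd D A (f p) (mfderiv 𝓘(ℝ, F) 𝓘(ℝ, E) f p x) (W p)
          + A (f p) (covAlong D f W p x)) hf (fun Z hZ => ?_) (fun W W' hW hW' h h' => ?_)
    (fun φ W hφ hW h => ?_) (fun W W' hW he h => ?_) hW
  · rw [covAlong_comp D hf (hA Z hZ), covAlong_comp D hf hZ, covEnd_apply D hA hZ]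
  · have h1 : (fun q => A (f q) ((W + W') q)) = (fun q => A (f q) (W q))
        + fun q => A (f q) (W' q) :=
      funext fun q => map_add (A (f q)) (W q) (W' q)
    rw [h1, covAlong_add D hf.continuousAt (hW.clm hf hA) (hW'.clm hf hA),
      covAlong_add D hf.continuousAt hW hW', h, h', map_add, Pi.add_apply, covEnd_add D hA]
    abel
  · have h1 : (fun q => A (f q) ((φ • W) q)) = φ • fun q => A (f q) (W q) :=
      funext fun q => map_smul (A (f q)) (φ q) (W q)
    rw [h1, covAlong_smul D hf.continuousAt hφ (hW.clm hf hA),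
      covAlong_smul D hf.continuousAt hφ hW, h,
      map_add, map_smul, map_smul, Pi.smul_apply', covEnd_smul D hA, smul_add]
    abel
  · have h1 : ∀ᶠ q in 𝓝 p, A (f q) (W' q) = A (f q) (W q) := he.mono fun q hq => by rw [hq]
    rw [covAlong_congr D h1, covAlong_congr D he, h, he.self_of_nhds]

end Along

/-! ### The second fundamental form -/

section SecondForm

open SemiRiemannianMetric

variable {E : Type*} [NormedAddCommGroup E] [NormedSpace ℂ E]
  {M' : Type*} [TopologicalSpace M'] [ChartedSpace E M']
  {F : Type*} [NormedAddCommGroup F] [NormedSpace ℝ F]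
  {M : Type*} [TopologicalSpace M] [ChartedSpace F M]
  {f : M → M'} {p : M} {X Y : Π q : M, TangentSpace 𝓘(ℝ, F) q}

/-- The vector field `df(Y)` along `f`. -/
def push (f : M → M') (Y : Π q : M, TangentSpace 𝓘(ℝ, F) q) (q : M) :
    TangentSpace 𝓘(ℝ, E) (f q) :=
  mfderiv 𝓘(ℝ, F) 𝓘(ℝ, E) f q (Y q)

theorem contMDiffAt_extChartAt_comp (hf : ContMDiff 𝓘(ℝ, F) 𝓘(ℝ, E) ∞ f) (p : M) :
    ContMDiffAt 𝓘(ℝ, F) 𝓘(ℝ, E) ∞ (extChartAt 𝓘(ℝ, E) (f p) ∘ f) p :=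
  (contMDiffAt_extChartAt (n := ∞)).comp p (hf p)

variable [IsManifold 𝓘(ℂ, E) ∞ M']

theorem mvfderiv_extChartAt_comp (hf : ContMDiff 𝓘(ℝ, F) 𝓘(ℝ, E) ∞ f) {q : M}
    (hq : f q ∈ (chartAt E (f p)).source) (x : TangentSpace 𝓘(ℝ, F) q) :
    mvfderiv 𝓘(ℝ, F) (extChartAt 𝓘(ℝ, E) (f p) ∘ f) q x
      = mvfderiv 𝓘(ℝ, E) (extChartAt 𝓘(ℝ, E) (f p)) (f q) (mfderiv 𝓘(ℝ, F) 𝓘(ℝ, E) f q x) :=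
  mfderiv_comp_apply q (mdifferentiableAt_extChartAt hq) ((hf q).mdifferentiableAt (by simp)) x

theorem coordAlong_push (hf : ContMDiff 𝓘(ℝ, F) 𝓘(ℝ, E) ∞ f)
    (Y : Π q : M, TangentSpace 𝓘(ℝ, F) q) : coordAlong f p (push (E := E) f Y) =ᶠ[𝓝 p]
      fun q => mvfderiv 𝓘(ℝ, F) (extChartAt 𝓘(ℝ, E) (f p) ∘ f) q (Y q) := by
  filter_upwards [eventually_mem_chart (E := E) hf.continuous.continuousAt] with q hq
  rw [mvfderiv_extChartAt_comp hf hq, coordAlong, trivializationAt_snd_eq_mvfderiv hq]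
  rfl

variable [IsManifold 𝓘(ℝ, F) ∞ M]

theorem mdifferentiableAt_extend_field (w : TangentSpace 𝓘(ℝ, F) p) :
    MDifferentiableAt 𝓘(ℝ, F) 𝓘(ℝ, F).tangent
      (fun q => (⟨q, FiberBundle.extend F w q⟩ : TangentBundle 𝓘(ℝ, F) M)) p :=
  (contMDiffAt_extend_of_mem (mem_chart_source F p) w).mdifferentiableAt (by simp)

variable [FiniteDimensional ℝ F]
  {g : SemiRiemannianMetric E M'}
  {D : CovariantDerivative 𝓘(ℝ, E) E (TangentSpace 𝓘(ℝ, E) : M' → Type _)}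

theorem diffAlong_push (hf : ContMDiff 𝓘(ℝ, F) 𝓘(ℝ, E) ∞ f)
    (hY : MDifferentiableAt 𝓘(ℝ, F) 𝓘(ℝ, F).tangent
      (fun q => (⟨q, Y q⟩ : TangentBundle 𝓘(ℝ, F) M)) p) : DiffAlong F f p (push (E := E) f Y) := by
  have : CompleteSpace F := FiniteDimensional.complete ℝ F
  exact (mdifferentiableAt_mvfderiv_apply (contMDiffAt_extChartAt_comp hf p)
    hY).congr_of_eventuallyEq (coordAlong_push hf Y)

/-- Modulo tangent vectors, `D_x df(Y)` depends only on the value of `Y` at the point. -/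
theorem covAlong_push_congr (hf : ContMDiff 𝓘(ℝ, F) 𝓘(ℝ, E) ∞ f)
    (hX : MDifferentiableAt 𝓘(ℝ, F) 𝓘(ℝ, F).tangent
      (fun q => (⟨q, X q⟩ : TangentBundle 𝓘(ℝ, F) M)) p)
    (hY : MDifferentiableAt 𝓘(ℝ, F) 𝓘(ℝ, F).tangent
      (fun q => (⟨q, Y q⟩ : TangentBundle 𝓘(ℝ, F) M)) p) (h : X p = Y p)
    (x : TangentSpace 𝓘(ℝ, F) p) :
    (tangentAt (F := F) f p).mkQ (covAlong D f (push f X) p x)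
      = (tangentAt (F := F) f p).mkQ (covAlong D f (push f Y) p x) := by
  have hc : ContinuousAt f p := hf.continuous.continuousAt
  have hT : TensorialAt 𝓘(ℝ, F) F (fun Y : Π q : M, TangentSpace 𝓘(ℝ, F) q =>
      (tangentAt (F := F) f p).mkQ (covAlong D f (push f Y) p x)) p := by
    refine ⟨fun {φ Y} hφ hY => ?_, fun {Y Y'} hY hY' => ?_⟩
    · have h1 : push (E := E) f (φ • Y) = φ • push f Y :=
        funext fun q => map_smul (mfderiv 𝓘(ℝ, F) 𝓘(ℝ, E) f q) (φ q) (Y q)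
      rw [h1, covAlong_smul D hc hφ (diffAlong_push hf hY), map_add, map_smul, map_smul]
      have h2 : (tangentAt (F := F) f p).mkQ (push (E := E) f Y p) = 0 :=
        (Submodule.Quotient.mk_eq_zero _).2 ⟨Y p, rfl⟩
      rw [h2, smul_zero, add_zero]
    · have h1 : push (E := E) f (Y + Y') = push f Y + push f Y' :=
        funext fun q => map_add (mfderiv 𝓘(ℝ, F) 𝓘(ℝ, E) f q) (Y q) (Y' q)
      rw [h1, covAlong_add D hc (diffAlong_push hf hY) (diffAlong_push hf hY'), map_add]
  have : IsManifold 𝓘(ℝ, F) 2 M := .of_le (n := ∞) ENat.LEInfty.out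
  exact hT.pointwise hX hY h

/-- The second fundamental form of an immersion, with values in the normal bundle, which for a
null submanifold has to be taken as the quotient of the ambient tangent space by the tangent
space. -/
def secondForm (hf : ContMDiff 𝓘(ℝ, F) 𝓘(ℝ, E) ∞ f)
    (D : CovariantDerivative 𝓘(ℝ, E) E (TangentSpace 𝓘(ℝ, E) : M' → Type _)) (p : M) :
    TangentSpace 𝓘(ℝ, F) p →ₗ[ℝ] TangentSpace 𝓘(ℝ, F) p →ₗ[ℝ]
      TangentSpace 𝓘(ℝ, E) (f p) ⧸ tangentAt (F := F) f p :=
  LinearMap.mk₂ ℝ (fun x w => (tangentAt (F := F) f p).mkQ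
      (covAlong D f (push f (FiberBundle.extend F w)) p x))
    (fun x x' w => by rw [covAlong_map_add, map_add])
    (fun c x w => by rw [covAlong_map_smul, map_smul])
    (fun x w w' => by
      have h1 := mdifferentiableAt_extend_field w
      have h2 := mdifferentiableAt_extend_field w'
      rw [covAlong_push_congr hf (mdifferentiableAt_extend_field (w + w'))
        (mdifferentiableAt_add_section h1 h2) (by simp)]
      have h3 : push (E := E) f (FiberBundle.extend F w + FiberBundle.extend F w')
          = push f (FiberBundle.extend F w) + push f (FiberBundle.extend F w') :=
        funext fun q => map_add (mfderiv 𝓘(ℝ, F) 𝓘(ℝ, E) f q) _ _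
      rw [h3, covAlong_add D hf.continuous.continuousAt (diffAlong_push (E := E) hf h1)
        (diffAlong_push hf h2), map_add])
    (fun c x w => by
      have h1 := mdifferentiableAt_extend_field w
      have hc : MDifferentiableAt 𝓘(ℝ, F) 𝓘(ℝ) (fun _ : M => c) p := mdifferentiableAt_const
      rw [covAlong_push_congr hf (mdifferentiableAt_extend_field (c • w))
        (hc.smul_section h1) (by simp)]
      have h3 : push (E := E) f ((fun _ : M => c) • FiberBundle.extend F w)
          = (fun _ : M => c) • push f (FiberBundle.extend F w) :=
        funext fun q => map_smul (mfderiv 𝓘(ℝ, F) 𝓘(ℝ, E) f q) c _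
      rw [h3, covAlong_smul D hf.continuous.continuousAt hc (diffAlong_push hf h1), mvfderiv_const,
        zero_apply, zero_smul, add_zero, map_smul])

theorem secondForm_apply (hf : ContMDiff 𝓘(ℝ, F) 𝓘(ℝ, E) ∞ f)
    (hY : MDifferentiableAt 𝓘(ℝ, F) 𝓘(ℝ, F).tangent
      (fun q => (⟨q, Y q⟩ : TangentBundle 𝓘(ℝ, F) M)) p) (x : TangentSpace 𝓘(ℝ, F) p) :
    secondForm hf D p x (Y p) = (tangentAt (F := F) f p).mkQ (covAlong D f (push f Y) p x) :=
  covAlong_push_congr hf (mdifferentiableAt_extend_field (Y p)) hY (by simp) x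

variable [FiniteDimensional ℂ E]

/-- For an immersion, a vector field is differentiable if its image is. -/
theorem mdifferentiableAt_of_diffAlong_push (hf : ContMDiff 𝓘(ℝ, F) 𝓘(ℝ, E) ∞ f)
    (hinj : Function.Injective (mfderiv 𝓘(ℝ, F) 𝓘(ℝ, E) f p))
    (hY : DiffAlong F f p (push (E := E) f Y)) : MDifferentiableAt 𝓘(ℝ, F) 𝓘(ℝ, F).tangent
      (fun q => (⟨q, Y q⟩ : TangentBundle 𝓘(ℝ, F) M)) p := by
  refine mdifferentiableAt_of_mvfderiv_apply (contMDiffAt_extChartAt_comp hf p) ?_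
    (MDifferentiableAt.congr_of_eventuallyEq hY (coordAlong_push hf Y).symm)
  intro x x' h
  have hp := mem_chart_source E (f p)
  rw [mvfderiv_extChartAt_comp hf hp, mvfderiv_extChartAt_comp hf hp] at h
  refine hinj ?_
  rw [← trivializationAt_symm_mvfderiv_extChartAt hp (mfderiv 𝓘(ℝ, F) 𝓘(ℝ, E) f p x), h,
    trivializationAt_symm_mvfderiv_extChartAt hp]

/-- The pullback of a torsion-free connection is torsion-free. -/
theorem covAlong_push_sub (hf : ContMDiff 𝓘(ℝ, F) 𝓘(ℝ, E) ∞ f) (hD : g.IsLeviCivita D)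
    (hX : MDifferentiableAt 𝓘(ℝ, F) 𝓘(ℝ, F).tangent
      (fun q => (⟨q, X q⟩ : TangentBundle 𝓘(ℝ, F) M)) p)
    (hY : MDifferentiableAt 𝓘(ℝ, F) 𝓘(ℝ, F).tangent
      (fun q => (⟨q, Y q⟩ : TangentBundle 𝓘(ℝ, F) M)) p) :
    covAlong D f (push f Y) p (X p) - covAlong D f (push f X) p (Y p)
      = mfderiv 𝓘(ℝ, F) 𝓘(ℝ, E) f p (mlieBracket 𝓘(ℝ, F) X Y p) := by
  have : CompleteSpace F := FiniteDimensional.complete ℝ F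
  have hp := mem_chart_source E (f p)
  have h := mvfderiv_commutator (contMDiffAt_extChartAt_comp hf p) hX hY
  rw [mvfderiv_extChartAt_comp hf hp] at h
  rw [covAlong_eq, covAlong_eq, mvfderiv_congr (coordAlong_push hf Y),
    mvfderiv_congr (coordAlong_push hf X), add_sub_add_comm, ← map_sub, h]
  have h2 : D (FiberBundle.extend E (push f Y p)) (f p) (mfderiv 𝓘(ℝ, F) 𝓘(ℝ, E) f p (X p))
      = D (FiberBundle.extend E (push f X p)) (f p) (mfderiv 𝓘(ℝ, F) 𝓘(ℝ, E) f p (Y p)) :=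
    cov_extend_symm hD _ _
  rw [h2, sub_self, add_zero, Trivialization.coe_symmₗ (R := ℝ) _ hp,
    trivializationAt_symm_mvfderiv_extChartAt hp]

theorem secondForm_symm (hf : ContMDiff 𝓘(ℝ, F) 𝓘(ℝ, E) ∞ f) (hD : g.IsLeviCivita D)
    (x w : TangentSpace 𝓘(ℝ, F) p) : secondForm hf D p x w = secondForm hf D p w x := by
  have h := covAlong_push_sub hf hD (mdifferentiableAt_extend_field x)
    (mdifferentiableAt_extend_field w)
  rw [FiberBundle.extend_apply_self, FiberBundle.extend_apply_self] at h
  refine sub_eq_zero.1 ?_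
  change (tangentAt (F := F) f p).mkQ _ - (tangentAt (F := F) f p).mkQ _ = 0
  rw [← map_sub, h]
  exact (Submodule.Quotient.mk_eq_zero _).2 ⟨_, rfl⟩

/-- The second fundamental form, computed with a vector field along `f` that is tangent to the
immersed manifold. -/
theorem secondForm_of_tangent (hf : ContMDiff 𝓘(ℝ, F) 𝓘(ℝ, E) ∞ f)
    (hinj : ∀ q, Function.Injective (mfderiv 𝓘(ℝ, F) 𝓘(ℝ, E) f q))
    {W : Π q : M, TangentSpace 𝓘(ℝ, E) (f q)} (hW : DiffAlong F f p W)
    (ht : ∀ᶠ q in 𝓝 p, W q ∈ tangentAt (F := F) f q) {w : TangentSpace 𝓘(ℝ, F) p}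
    (hw : mfderiv 𝓘(ℝ, F) 𝓘(ℝ, E) f p w = W p) (x : TangentSpace 𝓘(ℝ, F) p) :
    secondForm hf D p x w = (tangentAt (F := F) f p).mkQ (covAlong D f W p x) := by
  set Y : Π q : M, TangentSpace 𝓘(ℝ, F) q := fun q =>
    Function.invFun (mfderiv 𝓘(ℝ, F) 𝓘(ℝ, E) f q) (W q) with hY
  have hYW : ∀ᶠ q in 𝓝 p, push f Y q = W q := ht.mono fun q hq => Function.invFun_eq hq
  have hYp : Y p = w := hinj p (hYW.self_of_nhds.trans hw.symm)
  rw [← hYp, secondForm_apply hf (mdifferentiableAt_of_diffAlong_push hf (hinj p)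
    (hW.congr hYW)), covAlong_congr D hYW]

end SecondForm

/-! ### Quaternion null submanifolds -/

section Quaternion

open SemiRiemannianMetric

variable {E : Type*} [NormedAddCommGroup E] [NormedSpace ℂ E]
  {M' : Type*} [TopologicalSpace M'] [ChartedSpace E M'] [IsManifold 𝓘(ℂ, E) ∞ M']
  {F : Type*} [NormedAddCommGroup F] [NormedSpace ℝ F]
  {M : Type*} [TopologicalSpace M] [ChartedSpace F M] {p : M}
  {n r : ℕ} {ι : Type*} {C : ContactStructure E M' n ι} {g : SemiRiemannianMetric E M'}
  {K : ContactMetricStructure C g} {N : NullSubmanifold F M g r} {i : ι}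

namespace NullSubmanifold

/-- An endomorphism that preserves the radical and the screen preserves the tangent space. -/
theorem InvariantAt.le_comap
    {A : TangentSpace 𝓘(ℝ, E) (N.f p) →L[ℝ] TangentSpace 𝓘(ℝ, E) (N.f p)}
    (hA : N.InvariantAt p A) :
    tangentAt (F := F) N.f p ≤ (tangentAt (F := F) N.f p).comap A.toLinearMap := by
  conv_lhs => rw [← N.screen_sup p]
  refine sup_le (fun x hx => ?_) fun x hx => ?_
  · exact (hA.1 x hx).1
  · have h := N.screen_sup p
    rw [Submodule.mem_comap, ← h]
    exact Submodule.mem_sup_right (hA.2 x hx)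

theorem screen_le (N : NullSubmanifold F M g r) (p : M) :
    N.screen p ≤ tangentAt (F := F) N.f p :=
  le_sup_right.trans_eq (N.screen_sup p)

/-- On tangent vectors, `N.act A` is the restriction of `A`: the preimage under `df` in its
definition exists because `A` leaves the tangent space invariant. -/
theorem push_act {A : Π y : M', TangentSpace 𝓘(ℝ, E) y →L[ℝ] TangentSpace 𝓘(ℝ, E) y}
    (hA : N.InvariantAt p (A (N.f p))) (X : Π q : M, TangentSpace 𝓘(ℝ, F) q) :
    push N.f (N.act A X) p = A (N.f p) (push N.f X p) :=
  Function.invFun_eq (hA.le_comap ⟨X p, rfl⟩)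

theorem eventually_mem (N : NullSubmanifold F M g r) (hp : N.f p ∈ C.O i) :
    ∀ᶠ q in 𝓝 p, N.f q ∈ C.O i :=
  N.smooth.continuous.continuousAt.eventually ((C.isOpen_O i).mem_nhds hp)

/-- If `D_X Y` is tangent, both transversal components vanish, by uniqueness of the
decomposition. -/
theorem hl_hs_eq_zero [FiniteDimensional ℂ E]
    {D : CovariantDerivative 𝓘(ℝ, E) E (TangentSpace 𝓘(ℝ, E) : M' → Type _)}
    {X Y : Π q : M, TangentSpace 𝓘(ℝ, F) q}
    (h : covAlong D N.f (push N.f Y) p (X p) ∈ tangentAt (F := F) N.f p) :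
    N.hl D X Y p = 0 ∧ N.hs D X Y p = 0 := by
  obtain ⟨h1, h2, h3, h4⟩ := Classical.choose_spec
    (N.exists_decomp p (covAlong D N.f (push N.f Y) p (X p)))
  exact (N.decomp_unique p h1 h2 h3 h (zero_mem _) (zero_mem _) (by
    rw [← h4, add_zero, add_zero])).2

variable [FiniteDimensional ℂ E] [FiniteDimensional ℝ F] [IsManifold 𝓘(ℝ, F) ∞ M]
  {D : CovariantDerivative 𝓘(ℝ, E) E (TangentSpace 𝓘(ℝ, E) : M' → Type _)}

/-- The vector field `AX` is differentiable, because its image `A (df X)` is. -/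
theorem mdifferentiableAt_act
    {A : Π y : M', TangentSpace 𝓘(ℝ, E) y →L[ℝ] TangentSpace 𝓘(ℝ, E) y}
    (hA : ∀ᶠ q in 𝓝 p, N.InvariantAt q (A (N.f q)))
    (hd : ∀ X, DiffAt X (N.f p) → DiffAt (fun z => A z (X z)) (N.f p))
    {X : Π q : M, TangentSpace 𝓘(ℝ, F) q}
    (hX : MDifferentiableAt 𝓘(ℝ, F) 𝓘(ℝ, F).tangent
      (fun q => (⟨q, X q⟩ : TangentBundle 𝓘(ℝ, F) M)) p) :
    MDifferentiableAt 𝓘(ℝ, F) 𝓘(ℝ, F).tangent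
      (fun q => (⟨q, N.act A X q⟩ : TangentBundle 𝓘(ℝ, F) M)) p :=
  mdifferentiableAt_of_diffAlong_push N.smooth (N.immersion p)
    (((diffAlong_push N.smooth hX).clm ((N.smooth p).mdifferentiableAt (by simp)) hd).congr
      (hA.mono fun q hq => push_act hq X))

/-- A quaternion null submanifold is totally geodesic. -/
theorem IsQuaternion.secondForm_eq_zero (hN : N.IsQuaternion K) (hK : K.IsNormal)
    (hD : g.IsLeviCivita D) (hp : N.f p ∈ C.O i) : secondForm N.smooth D p = 0 := by
  set T := tangentAt (E := E) (F := F) N.f p with hT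
  have hf : MDifferentiableAt 𝓘(ℝ, F) 𝓘(ℝ, E) N.f p :=
    (N.smooth p).mdifferentiableAt (by simp)
  have hO := N.eventually_mem hp
  have c := (hK.germ_G hp).jet hD
  have c' := (hK.germ_H hp).jet hD
  have hGT := (hN.G_invariant i p hp).le_comap
  have hHT := (hN.H_invariant i p hp).le_comap
  have hU := N.screen_le p (hN.vertical i p hp).1
  have hV := N.screen_le p (hN.vertical i p hp).2
  set e : TangentSpace 𝓘(ℝ, F) p ≃ₗ[ℝ] T := LinearEquiv.ofInjective
    (mfderiv 𝓘(ℝ, F) 𝓘(ℝ, E) N.f p).toLinearMap (N.immersion p) with he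
  set II := secondForm N.smooth D p with hII
  set β : T →ₗ[ℝ] T →ₗ[ℝ] TangentSpace 𝓘(ℝ, E) (N.f p) ⧸ T :=
    II.compl₁₂ e.symm.toLinearMap e.symm.toLinearMap with hβ
  have hdf : ∀ a : T, mfderiv 𝓘(ℝ, F) 𝓘(ℝ, E) N.f p (e.symm a) = a := fun a =>
    congrArg Subtype.val (e.apply_symm_apply a)
  -- `β` can be computed with any vector field along `M` with tangent values.
  have hβW : ∀ (W : Π q : M, TangentSpace 𝓘(ℝ, E) (N.f q)) (a b : T), DiffAlong F N.f p W →
      (∀ᶠ q in 𝓝 p, W q ∈ tangentAt (F := F) N.f q) → W p = b →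
      β a b = T.mkQ (covAlong D N.f W p (e.symm a)) := fun W a b hW ht hb =>
    secondForm_of_tangent N.smooth N.immersion hW ht ((hdf b).trans hb.symm) _
  have hmk : ∀ x ∈ T, T.mkQ x = 0 := fun x hx => (Submodule.Quotient.mk_eq_zero _).2 hx
  have hGmem : ∀ a : T, K.G i (N.f p) a ∈ T := fun a => hGT a.2
  have hHmem : ∀ a : T, K.H i (N.f p) a ∈ T := fun a => hHT a.2
  -- The tensor rule, for a (1,1)-tensor field that leaves the tangent spaces invariant.
  have hβA : ∀ (A : Π y : M', TangentSpace 𝓘(ℝ, E) y →L[ℝ] TangentSpace 𝓘(ℝ, E) y)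
      (_ : ∀ᶠ q in 𝓝 p, N.InvariantAt q (A (N.f q)))
      (_ : ∀ X, DiffAt X (N.f p) → DiffAt (fun z => A z (X z)) (N.f p))
      (hAT : T ≤ T.comap (A (N.f p)).toLinearMap) (a b : T),
      covEnd D A (N.f p) a b ∈ T →
      β a ((A (N.f p)).toLinearMap.restrict hAT b)
        = T.mapQ T (A (N.f p)).toLinearMap hAT (β a b) := by
    intro A hA hd hAT a b hab
    have hY := mdifferentiableAt_extend_field (e.symm b)
    have hYd := diffAlong_push (E := E) N.smooth hY
    have hYp : push (E := E) N.f (FiberBundle.extend F (e.symm b)) p = b := by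
      rw [push, FiberBundle.extend_apply_self, hdf]
    rw [hβW _ a _ (hYd.clm hf hd) (hA.mono fun q hq => hq.le_comap ⟨_, rfl⟩) (by rw [hYp]; rfl),
      covAlong_clm D hf hd hYd, map_add, hdf, hYp, hmk _ hab, zero_add,
      hβW _ a b hYd (Filter.Eventually.of_forall fun q => ⟨_, rfl⟩) hYp]
    rfl
  have hβ0 : β = 0 := by
    refine eq_zero_of_quaternionic (g := g.bilin (N.f p)) hGT hHT hU hV c.G_sq (K.H_sq' hp)
      c.HG c.U_U c.V_V
      c.U_V c.V_U c.U_G c.V_G c.U_H c.V_H β ?_ ?_ ?_ ?_ ?_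
    · exact fun a b => secondForm_symm N.smooth hD _ _
    · intro a
      obtain ⟨k, hk⟩ := c.covariant_U a
      rw [hβW (fun q => K.U i (N.f q)) a _ (DiffAlong.comp hf (K.smooth_U i _ hp).diffAt)
        (hO.mono fun q hq => N.screen_le q (hN.vertical i q hq).1) rfl,
        covAlong_comp D hf (K.smooth_U i _ hp).diffAt, hdf]
      refine hmk _ ?_
      have : D (K.U i) (N.f p) a = -K.G i (N.f p) a + k • K.V i (N.f p) := hk
      rw [this]
      exact T.add_mem (T.neg_mem (hGmem a)) (T.smul_mem _ hV)
    · intro a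
      obtain ⟨k, hk⟩ := c'.covariant_U a
      rw [hβW (fun q => K.V i (N.f q)) a _ (DiffAlong.comp hf (K.smooth_V hp).diffAt)
        (hO.mono fun q hq => N.screen_le q (hN.vertical i q hq).2) rfl,
        covAlong_comp D hf (K.smooth_V hp).diffAt, hdf]
      refine hmk _ ?_
      have : D (K.V i) (N.f p) a = -K.H i (N.f p) a + k • -K.U i (N.f p) := hk
      rw [this]
      exact T.add_mem (T.neg_mem (hHmem a)) (T.smul_mem _ (T.neg_mem hU))
    · intro a b ha ha' hb hb'
      refine hβA (K.G i) (hO.mono fun q hq => hN.G_invariant i q hq)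
        (fun X => K.diff_G hp) hGT a b ?_
      obtain ⟨k, l, h⟩ := c.covariant_G ha ha' hb hb'
      rw [h]
      exact T.add_mem (T.add_mem (T.smul_mem _ (hHmem b)) (T.smul_mem _ hU)) (T.smul_mem _ hV)
    · intro a b ha ha' hb hb'
      refine hβA (K.H i) (hO.mono fun q hq => hN.H_invariant i q hq)
        (fun X => K.diff_H hp) hHT a b ?_
      have hneg : ∀ x, g.inner (N.f p) (K.U i (N.f p)) x = 0 →
          g.inner (N.f p) ((-K.U i) (N.f p)) x = 0 := fun x hx => by
        rw [Pi.neg_apply, map_neg, neg_apply, hx, neg_zero]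
      obtain ⟨k, l, h⟩ := c'.covariant_G ha' (hneg _ ha) hb' (hneg _ hb)
      rw [h]
      exact T.add_mem (T.add_mem (T.smul_mem _ (T.neg_mem (hGmem b))) (T.smul_mem _ hV))
        (T.smul_mem _ (T.neg_mem hU))
  refine LinearMap.ext fun x => LinearMap.ext fun w => ?_
  have h := LinearMap.congr_fun (LinearMap.congr_fun hβ0 (e x)) (e w)
  simpa [hβ] using h

theorem IsQuaternion.hl_hs_eq_zero (hN : N.IsQuaternion K) (hK : K.IsNormal)
    (hD : g.IsLeviCivita D) {X Y : Π q : M, TangentSpace 𝓘(ℝ, F) q}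
    (hY : MDifferentiableAt 𝓘(ℝ, F) 𝓘(ℝ, F).tangent
      (fun q => (⟨q, Y q⟩ : TangentBundle 𝓘(ℝ, F) M)) p) :
    N.hl D X Y p = 0 ∧ N.hs D X Y p = 0 := by
  obtain ⟨i, hp⟩ := mem_iUnion.1 (C.cover.symm ▸ mem_univ (N.f p) : N.f p ∈ ⋃ i, C.O i)
  refine NullSubmanifold.hl_hs_eq_zero ((Submodule.Quotient.mk_eq_zero _).1 ?_)
  have h := secondForm_apply (D := D) N.smooth hY (X p)
  rw [hN.secondForm_eq_zero hK hD hp] at h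
  exact h.symm

end NullSubmanifold
end Quaternion

end ComplexContact

end

open ComplexContact in
theorem mainTheorem2 {n q r : ℕ} (hq : 0 < q) (hqn : q < n)
    {E : Type*} [NormedAddCommGroup E] [NormedSpace ℂ E] [FiniteDimensional ℂ E]
    {M' : Type*} [TopologicalSpace M'] [T2Space M'] [ChartedSpace E M']
    [IsManifold 𝓘(ℂ, E) ∞ M']
    {ι : Type*} (C : ContactStructure E M' n ι)
    (g : SemiRiemannianMetric E M') (hg : g.HasIndex (4 * q))
    (K : ContactMetricStructure C g) (hK : K.IsNormal)
    (D : CovariantDerivative 𝓘(ℝ, E) E (TangentSpace 𝓘(ℝ, E) : M' → Type _))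
    (hD : g.IsLeviCivita D)
    {F : Type*} [NormedAddCommGroup F] [NormedSpace ℝ F] [FiniteDimensional ℝ F]
    {M : Type*} [TopologicalSpace M] [T2Space M] [ChartedSpace F M] [IsManifold 𝓘(ℝ, F) ∞ M]
    (N : NullSubmanifold F M g r) (hN : N.IsQuaternion K)
    (O : Set M) (hO : IsOpen O) (X Y : Π p : M, TangentSpace 𝓘(ℝ, F) p)
    (hX : ContMDiffOn 𝓘(ℝ, F) 𝓘(ℝ, F).tangent ∞
      (fun p => (⟨p, X p⟩ : TangentBundle 𝓘(ℝ, F) M)) O)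
    (hY : ContMDiffOn 𝓘(ℝ, F) 𝓘(ℝ, F).tangent ∞
      (fun p => (⟨p, Y p⟩ : TangentBundle 𝓘(ℝ, F) M)) O) :
    (∀ p ∈ O,
      N.hl D (N.act J X) (N.act J Y) p = -N.hl D X Y p ∧
      N.hs D (N.act J X) (N.act J Y) p = -N.hs D X Y p) ∧
    ∀ i, ∀ p ∈ O, N.f p ∈ C.O i →
      (N.hl D (N.act (K.G i) X) (N.act (K.G i) Y) p = -N.hl D X Y p ∧
        N.hs D (N.act (K.G i) X) (N.act (K.G i) Y) p = -N.hs D X Y p) ∧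
      (N.hl D (N.act (K.H i) X) (N.act (K.H i) Y) p = -N.hl D X Y p ∧
        N.hs D (N.act (K.H i) X) (N.act (K.H i) Y) p = -N.hs D X Y p) := by
  have hYp : ∀ p ∈ O, MDifferentiableAt 𝓘(ℝ, F) 𝓘(ℝ, F).tangent
      (fun q => (⟨q, Y q⟩ : TangentBundle 𝓘(ℝ, F) M)) p := fun p hp =>
    (hY.contMDiffAt (hO.mem_nhds hp)).mdifferentiableAt (by simp)
  have key : ∀ p ∈ O, ∀ A : Π y : M', TangentSpace 𝓘(ℝ, E) y →L[ℝ] TangentSpace 𝓘(ℝ, E) y,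
      (∀ᶠ q in 𝓝 p, N.InvariantAt q (A (N.f q))) →
      (∀ X, SemiRiemannianMetric.DiffAt X (N.f p) →
        SemiRiemannianMetric.DiffAt (fun z => A z (X z)) (N.f p)) →
      N.hl D (N.act A X) (N.act A Y) p = -N.hl D X Y p ∧
      N.hs D (N.act A X) (N.act A Y) p = -N.hs D X Y p := by
    intro p hp A hA hd
    obtain ⟨h1, h2⟩ := hN.hl_hs_eq_zero hK hD (X := X) (hYp p hp)
    obtain ⟨h3, h4⟩ := hN.hl_hs_eq_zero hK hD (X := N.act A X)
      (NullSubmanifold.mdifferentiableAt_act hA hd (hYp p hp))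
    -- all the terms of the two identities are zero
    rw [h1, h2, h3, h4]
    exact ⟨neg_zero.symm, neg_zero.symm⟩
  refine ⟨fun p hp => key p hp J (Filter.Eventually.of_forall fun q => hN.J_invariant q)
    fun X hX => hX.J, fun i p hp hpi => ⟨?_, ?_⟩⟩
  · exact key p hp (K.G i) ((N.eventually_mem hpi).mono fun q hq => hN.G_invariant i q hq)
      fun X => K.diff_G hpi
  · exact key p hp (K.H i) ((N.eventually_mem hpi).mono fun q hq => hN.H_invariant i q hq)
      fun X => K.diff_H hpi
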